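/- A Laman graph is a finite simple graph with $n\ge 2$ vertices and exactly $2n-3$ edges in which every set of $k\ge 2$ vertices spans at most $2k-3$ edges. Let $G=(V,E)$ be a graph, let $T$ be a rooted tree with a bijection $\alpha$ from $V$ to the leaves of $T$, and let $\beta$ be a one-to-one map that sends each edge $uv\in E$ to a pair of nodes of $T$ (a *cross edge*), one an ancestor of $\alpha(u)$ and the other an ancestor of $\alpha(v)$ (a node counts as its own ancestor). Then $(T,\alpha,\beta)$ is a *red-black hierarchy* for $G$ if (1) the root has exactly two children; (2) a node is the only child of its parent if and only if it is a leaf; (3) the endpoints of every cross edge have the same grandparent but different parents; (4) for every node $x$ that has grandchildren, the cross edges incident to grandchildren of $x$ form a tree whose vertex set is the set of all grandchildren of $x$. **Theorem.** There is an algorithm that constructs a red-black hierarchy for every Laman graph $G$ with $n$ vertices in $O(n\log n)$ time, on a random access machine whose words have $\log_2 n+O(1)$ bits and whose elementary operations take unit time, when $G$ is given by its edge list together with a partition of its edges into two forests. The same holds if, instead, an edge $e$ (possibly parallel to an edge of $G$) and a partition of $G+e$ into two spanning trees are given. -/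

import Mathlib

/-! ## Laman graphs -/

/-- A finite graph `G` is a Laman graph if it has exactly `2 * |V| - 3` edges and every set of
`k ≥ 2` vertices spans at most `2 * k - 3` edges. (The first condition forces `|V| ≥ 2`.) -/
def IsLaman {V : Type*} [Fintype V] (G : SimpleGraph V) : Prop :=
  G.edgeSet.ncard + 3 = 2 * Fintype.card V ∧
    ∀ S : Finset V, 2 ≤ S.card →
      {e ∈ G.edgeSet | ∀ v ∈ e, v ∈ S}.ncard + 3 ≤ 2 * S.card

/-! ## Rooted trees and red-black hierarchies -/

/-- A rooted tree with node set `X`, given by its root and its parent map. By convention the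
parent map fixes the root; this value is never used to speak of a "parent of the root". -/
structure RootedTreeOn (X : Type*) where
  root : X
  parent : X → X
  parent_root : parent root = root
  reaches_root : ∀ x, ∃ k : ℕ, parent^[k] x = root

namespace RootedTreeOn

variable {X : Type*} (T : RootedTreeOn X)

/-- `x` is a child of `p`. -/
def IsChild (x p : X) : Prop := x ≠ T.root ∧ T.parent x = p

/-- The set of children of `p`. -/
def children (p : X) : Set X := {x | T.IsChild x p}

/-- The set of grandchildren of `g`. -/
def grandchildren (g : X) : Set X := {x | ∃ p, T.IsChild x p ∧ T.IsChild p g}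

/-- `x` has no children. -/
def IsLeaf (x : X) : Prop := T.children x = ∅

/-- `x` is the only child of its parent. -/
def IsOnlyChild (x : X) : Prop := ∃ p, T.children p = {x}

/-- `a` is an ancestor of `x` (a node is an ancestor of itself). -/
def IsAncestor (a x : X) : Prop := ∃ k : ℕ, T.parent^[k] x = a

end RootedTreeOn

/-- `(T, α, β)` is a hierarchy of `G`: the map `α` is a bijection from the vertices of `G` to the
leaves of `T`, and `β` maps the edges of `G` one-to-one to cross edges, the endpoints of the cross
edge of `uv` being ancestors of `α u` and of `α v`, respectively. Only the values of `β` on edges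
of `G` matter. -/
structure IsHierarchy {V X : Type*} (G : SimpleGraph V) (T : RootedTreeOn X)
    (α : V → X) (β : Sym2 V → Sym2 X) : Prop where
  leaves : Set.BijOn α Set.univ {x | T.IsLeaf x}
  cross_injective : Set.InjOn β G.edgeSet
  cross_ancestors : ∀ u v, G.Adj u v →
    ∃ a b, β s(u, v) = s(a, b) ∧ T.IsAncestor a (α u) ∧ T.IsAncestor b (α v)

/-- The graph on the nodes of the hierarchy that is formed by the cross edges. -/
def crossGraph {V X : Type*} (G : SimpleGraph V) (β : Sym2 V → Sym2 X) : SimpleGraph X :=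
  SimpleGraph.fromEdgeSet (β '' G.edgeSet)

/-- A red-black hierarchy of `G`. -/
structure IsRedBlackHierarchy {V X : Type*} (G : SimpleGraph V) (T : RootedTreeOn X)
    (α : V → X) (β : Sym2 V → Sym2 X) : Prop extends IsHierarchy G T α β where
  /-- The root has exactly two children. -/
  root_rule : (T.children T.root).ncard = 2
  /-- A node is the only child of its parent if and only if it is a leaf. -/
  leaf_rule : ∀ x, T.IsOnlyChild x ↔ T.IsLeaf x
  /-- The endpoints of a cross edge have the same grandparent but different parents. -/
  cross_edge_rule : ∀ e ∈ G.edgeSet, ∀ a b, β e = s(a, b) →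
    ∃ p q g, T.IsChild a p ∧ T.IsChild b q ∧ T.IsChild p g ∧ T.IsChild q g ∧ p ≠ q
  /-- If `x` has grandchildren, the cross edges form a tree on the set of its grandchildren.
  (By the previous rule, a cross edge incident to one of them joins two of them.) -/
  tree_rule : ∀ x, (T.grandchildren x).Nonempty →
    ((crossGraph G β).induce (T.grandchildren x)).IsTree

/-! ## Edge lists split into two classes -/

/-- An entry of an edge list: the two endpoints, in either order, and the part (colour) of the
partition to which the edge belongs. -/
structure ColouredEdge (n : ℕ) where
  tail : Fin n
  head : Fin n
  colour : Bool

/-- The unordered pair of endpoints. -/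
def ColouredEdge.edge {n : ℕ} (x : ColouredEdge n) : Sym2 (Fin n) := s(x.tail, x.head)

/-- The list `L` contains every edge of `G` exactly once, and nothing else. -/
def EnumeratesEdges {n : ℕ} (G : SimpleGraph (Fin n)) (L : List (ColouredEdge n)) : Prop :=
  (L.map ColouredEdge.edge).Nodup ∧ ∀ e, e ∈ L.map ColouredEdge.edge ↔ e ∈ G.edgeSet

/-- The edges of colour `c` in `L`, with repetitions. -/
def edgesOfColour {n : ℕ} (L : List (ColouredEdge n)) (c : Bool) : List (Sym2 (Fin n)) :=
  (L.filter fun x => x.colour = c).map ColouredEdge.edge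

/-- The edges of colour `c` in `L` have no loops and no parallel edges among them. -/
def SimpleInColour {n : ℕ} (L : List (ColouredEdge n)) (c : Bool) : Prop :=
  (edgesOfColour L c).Nodup ∧ ∀ e ∈ edgesOfColour L c, ¬ e.IsDiag

/-- The graph on all vertices with the edges of colour `c`. -/
def colourGraph {n : ℕ} (L : List (ColouredEdge n)) (c : Bool) : SimpleGraph (Fin n) :=
  SimpleGraph.fromEdgeSet {e | e ∈ edgesOfColour L c}

/-- The two colours partition the multigraph with edge list `L` into two forests. -/
def IsForestPartition {n : ℕ} (L : List (ColouredEdge n)) : Prop :=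
  ∀ c, SimpleInColour L c ∧ (colourGraph L c).IsAcyclic

/-- The two colours partition the multigraph with edge list `L` into two spanning trees. -/
def IsTreePartition {n : ℕ} (L : List (ColouredEdge n)) : Prop :=
  ∀ c, SimpleInColour L c ∧ (colourGraph L c).IsTree

/-! ## A random access machine with bounded words

Programs are structured programs over scalar variables and arrays of natural numbers; a program
mentions only finitely many variables and arrays. Every arithmetic operation, comparison, memory
access and control decision costs one unit of time. All words are smaller than a bound `W`: a
program that computes a larger number is stuck. -/

namespace RAM

/-- The memory: scalar variables and arrays, both named by natural numbers. -/
structure State where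
  var : ℕ → ℕ
  arr : ℕ → ℕ → ℕ

/-- Assign `v` to the variable `x`. -/
def State.setVar (s : State) (x v : ℕ) : State :=
  { s with var := Function.update s.var x v }

/-- Assign `v` to the cell `i` of the array `a`. -/
def State.setArr (s : State) (a i v : ℕ) : State :=
  { s with arr := Function.update s.arr a (Function.update (s.arr a) i v) }

/-- Binary operations on words. -/
inductive BinOp where
  | add | sub | mul | lt | eq

/-- Subtraction is truncated at `0`; comparisons yield `1` for true and `0` for false. -/
def BinOp.eval : BinOp → ℕ → ℕ → ℕ
  | .add, x, y => x + y
  | .sub, x, y => x - y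
  | .mul, x, y => x * y
  | .lt, x, y => if x < y then 1 else 0
  | .eq, x, y => if x = y then 1 else 0

/-- Expressions; `load a i` reads the cell `i` of the array `a`. -/
inductive Expr where
  | const (k : ℕ)
  | var (x : ℕ)
  | load (a : ℕ) (i : Expr)
  | bin (op : BinOp) (e f : Expr)

namespace Expr

/-- The value of an expression. -/
def eval (s : State) : Expr → ℕ
  | const k => k
  | var x => s.var x
  | load a i => s.arr a (i.eval s)
  | bin op e f => op.eval (e.eval s) (f.eval s)

/-- The time to evaluate an expression: its number of constants, variables and operations. -/
def cost : Expr → ℕ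
  | const _ => 1
  | var _ => 1
  | load _ i => i.cost + 1
  | bin _ e f => e.cost + f.cost + 1

/-- All values that occur in the evaluation of the expression, in particular all addresses, are
smaller than `W`. -/
def Fits (W : ℕ) (s : State) : Expr → Prop
  | const k => k < W
  | var x => s.var x < W
  | load a i => i.Fits W s ∧ s.arr a (i.eval s) < W
  | bin op e f => e.Fits W s ∧ f.Fits W s ∧ op.eval (e.eval s) (f.eval s) < W

end Expr

/-- Programs. A test `b` succeeds if its value is not `0`. -/
inductive Program where
  | skip
  | assign (x : ℕ) (e : Expr)
  | store (a : ℕ) (i e : Expr)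
  | seq (p q : Program)
  | ite (b : Expr) (p q : Program)
  | loop (b : Expr) (p : Program)

/-- `Runs W p s t s'`: with words smaller than `W`, the program `p` started in the state `s` halts
after exactly `t` units of time in the state `s'`. -/
inductive Runs (W : ℕ) : Program → State → ℕ → State → Prop
  | skip (s : State) : Runs W .skip s 1 s
  | assign (x : ℕ) (e : Expr) (s : State) (he : e.Fits W s) :
      Runs W (.assign x e) s (e.cost + 1) (s.setVar x (e.eval s))
  | store (a : ℕ) (i e : Expr) (s : State) (hi : i.Fits W s) (he : e.Fits W s) :
      Runs W (.store a i e) s (i.cost + e.cost + 1) (s.setArr a (i.eval s) (e.eval s))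
  | seq {p q : Program} {s s' s'' : State} {t t' : ℕ}
      (hp : Runs W p s t s') (hq : Runs W q s' t' s'') :
      Runs W (.seq p q) s (t + t') s''
  | ite_true {b : Expr} {p q : Program} {s s' : State} {t : ℕ} (hb : b.Fits W s)
      (h : b.eval s ≠ 0) (hp : Runs W p s t s') :
      Runs W (.ite b p q) s (b.cost + 1 + t) s'
  | ite_false {b : Expr} {p q : Program} {s s' : State} {t : ℕ} (hb : b.Fits W s)
      (h : b.eval s = 0) (hq : Runs W q s t s') :
      Runs W (.ite b p q) s (b.cost + 1 + t) s'
  | loop_done {b : Expr} {p : Program} {s : State} (hb : b.Fits W s)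
      (h : b.eval s = 0) :
      Runs W (.loop b p) s (b.cost + 1) s
  | loop_step {b : Expr} {p : Program} {s s' s'' : State} {t t' : ℕ} (hb : b.Fits W s)
      (h : b.eval s ≠ 0) (hp : Runs W p s t s') (hl : Runs W (.loop b p) s' t' s'') :
      Runs W (.loop b p) s (b.cost + 1 + t + t') s''

end RAM

/-! ## Input and output -/

/-- The initial memory for a coloured edge list `L` on the vertices `0, …, n - 1`. Variable `0`
holds `n` and variable `1` holds the length of `L`; the arrays `0`, `1`, `2` hold the tails, the
heads and the colours (`0` or `1`) of the entries of `L`. Everything else is `0`. -/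
def inputState {n : ℕ} (L : List (ColouredEdge n)) : RAM.State where
  var x := match x with
    | 0 => n
    | 1 => L.length
    | _ => 0
  arr a i := match a, L[i]? with
    | 0, some e => e.tail
    | 1, some e => e.head
    | 2, some e => e.colour.toNat
    | _, _ => 0

/-- The memory `s` holds the hierarchy `(T, α, β)` with nodes `0, …, N - 1` of the graph with edge
list `L`. Variable `2` holds `N` and variable `3` holds the root; array `3` holds the parents,
array `4` the leaves that correspond to the vertices, and the arrays `5` and `6` the two endpoints
of the cross edges that correspond to the entries of `L`. -/
structure HoldsHierarchy {n : ℕ} (L : List (ColouredEdge n)) {N : ℕ} (T : RootedTreeOn (Fin N))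
    (α : Fin n → Fin N) (β : Sym2 (Fin n) → Sym2 (Fin N)) (s : RAM.State) : Prop where
  size : s.var 2 = N
  root : s.var 3 = T.root
  parent : ∀ x : Fin N, s.arr 3 x = T.parent x
  leaf : ∀ v : Fin n, s.arr 4 v = α v
  cross : ∀ i : Fin L.length, ∃ a b : Fin N,
    β L[i].edge = s(a, b) ∧ s.arr 5 i = a ∧ s.arr 6 i = b

/-!
# Red-black hierarchies of Laman graphs in `O(n log n)` time

Colour the edges of a Laman graph by the two forests of the given partition. As the graph has
`2n - 3` edges, one colour class is a spanning tree and the other one a forest with two components. (If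
two spanning trees of `G + e` are given, `e` is simply ignored.) The *levels* of the hierarchy are a
sequence of finer and finer partitions of the vertex set, with alternating colours: level `0` has
one class, with the colour of the tree, and the classes of level `r + 1` are the components formed
by the edges of the other colour within the classes of level `r` (`EdgeData.Level`). The nodes of
the hierarchy are the classes of all levels, as far as the grandparent class is not a single vertex
(`EdgeData.IsNode`). An edge that is cut between the levels `k` and `k + 1` yields a cross edge
between the classes of its ends at level `k + 2`. A class `C` that does not split is connected in
both colours, hence spans `2 (|C| - 1)` edges, and is a single vertex by the Laman condition: this
gives the leaf rule (`EdgeData.IsLamanSplit.eq_of_not_split`). A class of level `k` is connected by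
edges of the colour of level `k`; those among them that are cut between the levels `k` and `k + 1`
link the classes of level `k + 2` within it, which gives the tree rule
(`EdgeData.Realizes.isRedBlackHierarchy`).

The program represents each component of each colour by a closed walk in the component, a cycle of a
permutation of *markers* (one for each vertex and colour) and *darts* (two for each edge, in both
colours). Cutting an edge is a transposition (`EdgeData.Tour.cut`). Both parts of the split cycle
are walked along in parallel, so that the time is proportional to the smaller part, which then gets
a new label. Each edge has darts in the layer of the other colour, too: those in the smaller part
whose two labels differ belong to the edges that have just become separated in the other colour;
they are appended to a queue, and are cut in the next round (`RAM.cutEdge_spec`). As always only the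
smaller part is traversed, the potential `∑ x, log₂ |cycle of x|`, initially `O(n log n)`, pays for
all cuts (`logPotential_split`). After each round, new nodes are created for the classes that
contain an end of an edge cut in this round, and these are all classes that need one
(`RAM.round_spec`). When the queue is empty, no class splits any more, and the larger one of the two
current nodes of each vertex is its leaf.
-/

/-! ### Running programs: bounded memories, frames, straight-line code and loops -/

namespace RAM

/-- Every word of the memory is smaller than `W`. -/
def State.Bdd (W : ℕ) (s : State) : Prop := (∀ x, s.var x < W) ∧ ∀ a i, s.arr a i < W

@[simp] theorem State.setVar_var (s : State) (x v y : ℕ) :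
    (s.setVar x v).var y = if y = x then v else s.var y := by
  simp [State.setVar, Function.update_apply]

@[simp] theorem State.setVar_arr (s : State) (x v : ℕ) : (s.setVar x v).arr = s.arr := rfl

@[simp] theorem State.setArr_var (s : State) (a i v : ℕ) : (s.setArr a i v).var = s.var := rfl

@[simp] theorem State.setArr_arr (s : State) (a i v b : ℕ) :
    (s.setArr a i v).arr b = if b = a then Function.update (s.arr a) i v else s.arr b := by
  simp [State.setArr, Function.update_apply]

theorem State.Bdd.setVar {W : ℕ} {s : State} (h : s.Bdd W) {x v : ℕ} (hv : v < W) :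
    (s.setVar x v).Bdd W := by
  refine ⟨fun y => ?_, fun a i => h.2 a i⟩
  rw [State.setVar_var]; split_ifs
  exacts [hv, h.1 y]

theorem State.Bdd.setArr {W : ℕ} {s : State} (h : s.Bdd W) {a i v : ℕ} (hv : v < W) :
    (s.setArr a i v).Bdd W := by
  refine ⟨fun y => h.1 y, fun b j => ?_⟩
  rw [State.setArr_arr]; split_ifs with hb
  · rw [Function.update_apply]; split_ifs
    exacts [hv, h.2 a j]
  · exact h.2 b j

theorem Expr.Fits.eval_lt {W : ℕ} {s : State} : ∀ {e : Expr}, e.Fits W s → e.eval s < W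
  | .const _, h => h
  | .var _, h => h
  | .load _ _, h => h.2
  | .bin _ _ _, h => h.2.2

/-- In a bounded memory only constants, sums and products can leave the range of words. This is
the remaining condition for the evaluation of an expression to be possible. -/
def Expr.Ok (W : ℕ) (s : State) : Expr → Prop
  | const k => k < W
  | var _ => True
  | load _ i => i.Ok W s
  | bin .add e f => e.Ok W s ∧ f.Ok W s ∧ e.eval s + f.eval s < W
  | bin .mul e f => e.Ok W s ∧ f.Ok W s ∧ e.eval s * f.eval s < W
  | bin _ e f => e.Ok W s ∧ f.Ok W s

theorem Expr.Ok.fits {W : ℕ} {s : State} (hs : s.Bdd W) (hW : 1 < W) :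
    ∀ {e : Expr}, e.Ok W s → e.Fits W s
  | .const _, h => h
  | .var x, _ => hs.1 x
  | .load a _, h => ⟨Ok.fits hs hW h, hs.2 a _⟩
  | .bin .add _ _, h => ⟨Ok.fits hs hW h.1, Ok.fits hs hW h.2.1, h.2.2⟩
  | .bin .mul _ _, h => ⟨Ok.fits hs hW h.1, Ok.fits hs hW h.2.1, h.2.2⟩
  | .bin .sub _ _, h => ⟨Ok.fits hs hW h.1, Ok.fits hs hW h.2,
      lt_of_le_of_lt (Nat.sub_le _ _) (Ok.fits hs hW h.1).eval_lt⟩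
  | .bin .lt _ _, h => ⟨Ok.fits hs hW h.1, Ok.fits hs hW h.2, by
      simp only [BinOp.eval]; split_ifs <;> omega⟩
  | .bin .eq _ _, h => ⟨Ok.fits hs hW h.1, Ok.fits hs hW h.2, by
      simp only [BinOp.eval]; split_ifs <;> omega⟩

namespace Program

/-- The variables that a program assigns. -/
def wvars : Program → List ℕ
  | skip => []
  | assign x _ => [x]
  | store _ _ _ => []
  | seq p q => p.wvars ++ q.wvars
  | ite _ p q => p.wvars ++ q.wvars
  | loop _ p => p.wvars

/-- The arrays that a program writes. -/
def warrs : Program → List ℕ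
  | skip => []
  | assign _ _ => []
  | store a _ _ => [a]
  | seq p q => p.warrs ++ q.warrs
  | ite _ p q => p.warrs ++ q.warrs
  | loop _ p => p.warrs

/-- The effect of a program without loops. -/
def run : Program → State → State
  | skip, s => s
  | assign x e, s => s.setVar x (e.eval s)
  | store a i e, s => s.setArr a (i.eval s) (e.eval s)
  | seq p q, s => q.run (p.run s)
  | ite b p q, s => if b.eval s = 0 then q.run s else p.run s
  | loop _ _, s => s

/-- A bound for the running time of a program without loops. -/
def time : Program → ℕ
  | skip => 1
  | assign _ e => e.cost + 1
  | store _ i e => i.cost + e.cost + 1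
  | seq p q => p.time + q.time
  | ite b p q => b.cost + 1 + (p.time + q.time)
  | loop _ _ => 0

/-- The program has no loops, and in a bounded memory it does not get stuck. -/
def Safe (W : ℕ) : Program → State → Prop
  | skip, _ => True
  | assign _ e, s => e.Ok W s
  | store _ i e, s => i.Ok W s ∧ e.Ok W s
  | seq p q, s => p.Safe W s ∧ q.Safe W (p.run s)
  | ite b p q, s => b.Ok W s ∧ (b.eval s ≠ 0 → p.Safe W s) ∧ (b.eval s = 0 → q.Safe W s)
  | loop _ _, _ => False

end Program

theorem Runs.bdd {W : ℕ} {p : Program} {s s' : State} {t : ℕ} (h : Runs W p s t s') :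
    s.Bdd W → s'.Bdd W := by
  induction h with
  | skip => exact id
  | assign x e s he => exact fun hs => hs.setVar he.eval_lt
  | store a i e s hi he => exact fun hs => hs.setArr he.eval_lt
  | seq _ _ h1 h2 => exact fun hs => h2 (h1 hs)
  | ite_true _ _ _ h => exact h
  | ite_false _ _ _ h => exact h
  | loop_done => exact id
  | loop_step _ _ _ _ h1 h2 => exact fun hs => h2 (h1 hs)

theorem Runs.var_eq {W : ℕ} {p : Program} {s s' : State} {t : ℕ} (h : Runs W p s t s') :
    ∀ x, x ∉ p.wvars → s'.var x = s.var x := by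
  induction h with
  | skip => exact fun _ _ => rfl
  | assign x e s he =>
    intro y hy
    simp only [Program.wvars, List.mem_singleton] at hy
    simp [hy]
  | store a i e s hi he => exact fun _ _ => rfl
  | seq _ _ h1 h2 =>
    intro y hy
    simp only [Program.wvars, List.mem_append, not_or] at hy
    rw [h2 y hy.2, h1 y hy.1]
  | ite_true _ _ _ h | ite_false _ _ _ h =>
    intro y hy
    simp only [Program.wvars, List.mem_append, not_or] at hy
    first | exact h y hy.1 | exact h y hy.2
  | loop_done => exact fun _ _ => rfl
  | loop_step _ _ _ _ h1 h2 => exact fun y hy => (h2 y hy).trans (h1 y hy)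

theorem Runs.arr_eq {W : ℕ} {p : Program} {s s' : State} {t : ℕ} (h : Runs W p s t s') :
    ∀ a, a ∉ p.warrs → s'.arr a = s.arr a := by
  induction h with
  | skip => exact fun _ _ => rfl
  | assign x e s he => exact fun _ _ => rfl
  | store a i e s hi he =>
    intro y hy
    simp only [Program.warrs, List.mem_singleton] at hy
    simp [hy]
  | seq _ _ h1 h2 =>
    intro y hy
    simp only [Program.warrs, List.mem_append, not_or] at hy
    rw [h2 y hy.2, h1 y hy.1]
  | ite_true _ _ _ h | ite_false _ _ _ h =>
    intro y hy
    simp only [Program.warrs, List.mem_append, not_or] at hy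
    first | exact h y hy.1 | exact h y hy.2
  | loop_done => exact fun _ _ => rfl
  | loop_step _ _ _ _ h1 h2 => exact fun y hy => (h2 y hy).trans (h1 y hy)

/-- A program without loops that is safe in a bounded memory runs. -/
theorem Program.Safe.runs {W : ℕ} (hW : 1 < W) : ∀ {p : Program} {s : State}, s.Bdd W →
    p.Safe W s → ∃ t, Runs W p s t (p.run s) ∧ t ≤ p.time
  | .skip, s, _, _ => ⟨1, .skip s, le_rfl⟩
  | .assign x e, s, hs, h => ⟨_, .assign x e s (h.fits hs hW), le_rfl⟩
  | .store a i e, s, hs, h => ⟨_, .store a i e s (h.1.fits hs hW) (h.2.fits hs hW), le_rfl⟩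
  | .seq p q, s, hs, h => by
    obtain ⟨t, h1, ht⟩ := Program.Safe.runs hW hs h.1
    obtain ⟨t', h2, ht'⟩ := Program.Safe.runs hW (h1.bdd hs) h.2
    exact ⟨_, .seq h1 h2, Nat.add_le_add ht ht'⟩
  | .ite b p q, s, hs, h => by
    by_cases hb : b.eval s = 0
    · obtain ⟨t, h1, ht⟩ := Program.Safe.runs hW hs (h.2.2 hb)
      have hr : (Program.ite b p q).run s = q.run s := if_pos hb
      exact ⟨b.cost + 1 + t, by rw [hr]; exact .ite_false (h.1.fits hs hW) hb h1, by
        simp only [Program.time]; omega⟩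
    · obtain ⟨t, h1, ht⟩ := Program.Safe.runs hW hs (h.2.1 hb)
      have hr : (Program.ite b p q).run s = p.run s := if_neg hb
      exact ⟨b.cost + 1 + t, by rw [hr]; exact .ite_true (h.1.fits hs hW) hb h1, by
        simp only [Program.time]; omega⟩

/-- The rule for loops: `I k` is an invariant, with a parameter `k` that changes from step to step,
and the potential `Φ k` pays for the running time. The frame, i.e. the variables and arrays that
the body does not write, is available in the proof that the body preserves the invariant. -/
theorem runs_loop {W : ℕ} (hW : 1 < W) {b : Expr} {p : Program} {s₀ : State} (hs₀ : s₀.Bdd W)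
    {ι : Type*} (I : ι → State → Prop) (Φ : ι → ℕ) {k₀ : ι} (h₀ : I k₀ s₀)
    (hb : ∀ s k, s.Bdd W → I k s → b.Ok W s)
    (step : ∀ s k, s.Bdd W → (∀ x, x ∉ p.wvars → s.var x = s₀.var x) →
      (∀ a, a ∉ p.warrs → s.arr a = s₀.arr a) → I k s → b.eval s ≠ 0 →
      ∃ t s' k', Runs W p s t s' ∧ I k' s' ∧ t + (b.cost + 1) + Φ k' ≤ Φ k) :
    ∃ t s k, Runs W (.loop b p) s₀ t s ∧ I k s ∧ b.eval s = 0 ∧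
      t + Φ k ≤ Φ k₀ + (b.cost + 1) := by
  have key : ∀ N, ∀ s k, Φ k ≤ N → s.Bdd W → (∀ x, x ∉ p.wvars → s.var x = s₀.var x) →
      (∀ a, a ∉ p.warrs → s.arr a = s₀.arr a) → I k s →
      ∃ t s' k', Runs W (.loop b p) s t s' ∧ I k' s' ∧ b.eval s' = 0 ∧
        t + Φ k' ≤ Φ k + (b.cost + 1) := by
    intro N
    induction N with
    | zero =>
      intro s k hN hs hv ha hI
      by_cases h : b.eval s = 0
      · exact ⟨_, s, k, .loop_done ((hb s k hs hI).fits hs hW) h, hI, h, by omega⟩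
      · obtain ⟨t, s', k', -, -, h3⟩ := step s k hs hv ha hI h
        omega
    | succ N ih =>
      intro s k hN hs hv ha hI
      by_cases h : b.eval s = 0
      · exact ⟨_, s, k, .loop_done ((hb s k hs hI).fits hs hW) h, hI, h, by omega⟩
      · obtain ⟨t, s', k', h1, h2, h3⟩ := step s k hs hv ha hI h
        obtain ⟨t', s'', k'', g1, g2, g3, g4⟩ := ih s' k' (by omega) (h1.bdd hs)
          (fun x hx => (h1.var_eq x hx).trans (hv x hx))
          (fun x hx => (h1.arr_eq x hx).trans (ha x hx)) h2
        exact ⟨_, s'', k'', .loop_step ((hb s k hs hI).fits hs hW) h h1 g1, g2, g3, by omega⟩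
  exact key _ s₀ k₀ le_rfl hs₀ (fun _ _ => rfl) (fun _ _ => rfl) h₀

end RAM

/-! ### Permutations: multiplication by a transposition merges two cycles -/

open Equiv in
/-- Multiplication by a transposition of two elements of different cycles merges the two cycles
and leaves the others alone. -/
theorem Equiv.Perm.sameCycle_mul_swap_iff {X : Type*} [Finite X] [DecidableEq X] {σ : Perm X}
    {a b : X} (hab : ¬ σ.SameCycle a b) (x y : X) :
    (σ * swap a b).SameCycle x y ↔ σ.SameCycle x y ∨ (σ.SameCycle x a ∧ σ.SameCycle y b) ∨
      (σ.SameCycle x b ∧ σ.SameCycle y a) := by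
  set τ := σ * swap a b with hτ
  have hτa : τ a = σ b := by simp [hτ]
  have hτb : τ b = σ a := by simp [hτ]
  have hτo : ∀ x, x ≠ a → x ≠ b → τ x = σ x := fun x h1 h2 => by
    simp [hτ, swap_apply_of_ne_of_ne h1 h2]
  -- the orbit of `a` under `τ` contains the old cycle of `b`, and vice versa
  have orb : ∀ a b : X, ¬ σ.SameCycle a b → τ a = σ b → τ b = σ a →
      (∀ x, x ≠ a → x ≠ b → τ x = σ x) → ∀ j : ℕ, τ.SameCycle a ((σ ^ (j + 1)) b) := by
    intro a b hab h1 h2 h3 j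
    induction j with
    | zero => exact ⟨1, by simpa using h1⟩
    | succ j ih =>
      set z := (σ ^ (j + 1)) b with hz
      have hz' : (σ ^ (j + 1 + 1)) b = σ z := by rw [hz, pow_succ' σ (j + 1)]; rfl
      rw [hz']
      by_cases hzb : z = b
      · rw [hzb, ← h1]; exact ⟨1, by simp⟩
      · have hza : z ≠ a := by
          intro h; apply hab; rw [← h]
          exact SameCycle.symm ⟨((j + 1 : ℕ) : ℤ), by rw [zpow_natCast]⟩
        rw [← h3 z hza hzb]
        exact ih.trans ⟨1, by simp⟩
  have orb' : ∀ a b : X, ¬ σ.SameCycle a b → τ a = σ b → τ b = σ a →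
      (∀ x, x ≠ a → x ≠ b → τ x = σ x) → ∀ x, σ.SameCycle b x → τ.SameCycle a x := by
    intro a b hab h1 h2 h3 x hx
    obtain ⟨k, hk, -, h⟩ := hx.exists_pow_eq''
    obtain ⟨j, rfl⟩ : ∃ j, k = j + 1 := ⟨k - 1, by omega⟩
    rw [← h]; exact orb a b hab h1 h2 h3 j
  have ob := orb' a b hab hτa hτb hτo
  have oa := orb' b a (fun h => hab h.symm) hτb hτa (fun x h1 h2 => hτo x h2 h1)
  have hτab : τ.SameCycle a b := ob b (SameCycle.refl _ _)
  constructor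
  · rintro ⟨i, rfl⟩
    -- one step of `τ` stays within the merged class
    have stp : ∀ z, σ.SameCycle z (τ z) ∨ (σ.SameCycle z a ∧ σ.SameCycle (τ z) b) ∨
        (σ.SameCycle z b ∧ σ.SameCycle (τ z) a) := by
      intro z
      by_cases h1 : z = a
      · subst h1; right; left
        exact ⟨SameCycle.refl _ _, by rw [hτa]; exact SameCycle.symm ⟨1, by simp⟩⟩
      by_cases h2 : z = b
      · subst h2; right; right
        exact ⟨SameCycle.refl _ _, by rw [hτb]; exact SameCycle.symm ⟨1, by simp⟩⟩
      · left; rw [hτo z h1 h2]; exact ⟨1, by simp⟩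
    have main : ∀ k : ℕ, ∀ z, σ.SameCycle z ((τ ^ k) z) ∨
        (σ.SameCycle z a ∧ σ.SameCycle ((τ ^ k) z) b) ∨
        (σ.SameCycle z b ∧ σ.SameCycle ((τ ^ k) z) a) := by
      intro k z
      induction k with
      | zero => left; exact SameCycle.refl _ _
      | succ k ih =>
        rw [pow_succ', Perm.mul_apply]
        have := stp ((τ ^ k) z)
        generalize (τ ^ k) z = w at *
        generalize τ w = w' at *
        rcases ih with h | h | h <;> rcases this with g | g | g
        · exact Or.inl (h.trans g)
        · exact Or.inr (Or.inl ⟨h.trans g.1, g.2⟩)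
        · exact Or.inr (Or.inr ⟨h.trans g.1, g.2⟩)
        · exact Or.inr (Or.inl ⟨h.1, g.symm.trans h.2⟩)
        · exact absurd (g.1.symm.trans h.2) hab
        · exact Or.inl (h.1.trans g.2.symm)
        · exact Or.inr (Or.inr ⟨h.1, g.symm.trans h.2⟩)
        · exact Or.inl (h.1.trans g.2.symm)
        · exact absurd (h.2.symm.trans g.1) hab
    obtain ⟨k, hk⟩ : ∃ k : ℕ, (τ ^ k) x = (τ ^ i) x := by
      obtain ⟨k, -, h⟩ := (show τ.SameCycle x ((τ ^ i) x) from ⟨i, rfl⟩).exists_pow_eq'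
      exact ⟨k, h⟩
    rw [← hk]; exact main k x
  · have key : ∀ x y, σ.SameCycle x y → τ.SameCycle x y := by
      intro x y h
      by_cases h1 : σ.SameCycle a x
      · exact (oa x h1).symm.trans (oa y (h1.trans h))
      by_cases h2 : σ.SameCycle b x
      · exact (ob x h2).symm.trans (ob y (h2.trans h))
      obtain ⟨k, -, rfl⟩ := h.exists_pow_eq'
      refine ⟨k, ?_⟩
      rw [zpow_natCast]
      clear h
      induction k with
      | zero => rfl
      | succ k ih =>
        rw [pow_succ', pow_succ', Perm.mul_apply, Perm.mul_apply, ih]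
        apply hτo
        · intro h; exact h1 (SameCycle.symm ⟨k, by simpa using h⟩)
        · intro h; exact h2 (SameCycle.symm ⟨k, by simpa using h⟩)
    rintro (h | ⟨h1, h2⟩ | ⟨h1, h2⟩)
    · exact key x y h
    · exact (key _ _ h1).trans (hτab.trans (key _ _ h2).symm)
    · exact (key _ _ h1).trans (hτab.symm.trans (key _ _ h2).symm)

/-- The cycle of `x` under `σ`, as a finite set; it is `{x}` if `x` is a fixed point. -/
noncomputable def cyc {X : Type*} [Fintype X] (σ : Equiv.Perm X) (x : X) : Finset X :=
  open Classical in Finset.univ.filter fun y => σ.SameCycle x y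

theorem mem_cyc {X : Type*} [Fintype X] {σ : Equiv.Perm X} {x y : X} :
    y ∈ cyc σ x ↔ σ.SameCycle x y := by
  simp [cyc]

theorem card_cyc_pos {X : Type*} [Fintype X] (σ : Equiv.Perm X) (x : X) : 0 < (cyc σ x).card :=
  Finset.card_pos.2 ⟨x, mem_cyc.2 (Equiv.Perm.SameCycle.refl _ _)⟩

theorem cyc_eq {X : Type*} [Fintype X] {σ : Equiv.Perm X} {x y : X} (h : σ.SameCycle x y) :
    cyc σ x = cyc σ y := by
  ext z; rw [mem_cyc, mem_cyc]
  exact ⟨fun g => h.symm.trans g, fun g => h.trans g⟩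

/-- As long as the walk along the cycle of `x` has not returned to `x`, it visits different
elements. -/
theorem card_image_iterate {X : Type*} [Fintype X] [DecidableEq X] {σ : Equiv.Perm X} {x : X}
    {j : ℕ} (h : ∀ i, 0 < i → i < j → (σ ^ i) x ≠ x) :
    ((Finset.range j).image fun i => (σ ^ i) x).card = j := by
  rw [Finset.card_image_of_injOn, Finset.card_range]
  have aux : ∀ i k : ℕ, i < k → k < j → (σ ^ i) x ≠ (σ ^ k) x := by
    intro i k hik hk heq
    apply h (k - i) (by omega) (by omega)
    have : (σ ^ k) x = (σ ^ i) ((σ ^ (k - i)) x) := by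
      rw [← Equiv.Perm.mul_apply, ← pow_add]; congr 2; omega
    rw [this] at heq
    exact ((σ ^ i).injective heq).symm
  intro i hi k hk heq
  simp only [Finset.coe_range, Set.mem_Iio] at hi hk
  rcases lt_trichotomy i k with g | g | g
  · exact absurd heq (aux i k g hk)
  · exact g
  · exact absurd heq.symm (aux k i g hi)

theorem le_card_cyc {X : Type*} [Fintype X] {σ : Equiv.Perm X} {x : X} {j : ℕ}
    (h : ∀ i, 0 < i → i < j → (σ ^ i) x ≠ x) : j ≤ (cyc σ x).card := by
  classical
  rw [← card_image_iterate h]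
  apply Finset.card_le_card
  intro y hy
  obtain ⟨i, -, rfl⟩ := Finset.mem_image.1 hy
  exact mem_cyc.2 ⟨i, by simp⟩

/-- When the walk along the cycle of `x` returns to `x`, it has visited the whole cycle. -/
theorem exists_lt_of_sameCycle {X : Type*} {σ : Equiv.Perm X} [Finite X] {x y : X}
    {j : ℕ} (hj : 0 < j) (h : (σ ^ j) x = x) (hy : σ.SameCycle x y) :
    ∃ i, i < j ∧ (σ ^ i) x = y := by
  obtain ⟨k, -, rfl⟩ := hy.exists_pow_eq'
  refine ⟨k % j, Nat.mod_lt _ hj, ?_⟩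
  conv_rhs => rw [← Nat.mod_add_div k j, pow_add, Equiv.Perm.mul_apply, pow_mul]
  congr 1
  have : ∀ i : ℕ, ((σ ^ j) ^ i) x = x := fun i => by
    induction i with
    | zero => rfl
    | succ i ih => rw [pow_succ, Equiv.Perm.mul_apply, h, ih]
  exact (this _).symm

theorem card_cyc_eq {X : Type*} [Fintype X] {σ : Equiv.Perm X} {x : X} {j : ℕ} (hj : 0 < j)
    (h : ∀ i, 0 < i → i < j → (σ ^ i) x ≠ x) (hx : (σ ^ j) x = x) : (cyc σ x).card = j := by
  classical
  rw [← card_image_iterate h]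
  congr 1
  ext y
  rw [mem_cyc, Finset.mem_image]
  constructor
  · intro hy
    obtain ⟨i, hi, h⟩ := exists_lt_of_sameCycle hj hx hy
    exact ⟨i, Finset.mem_range.2 hi, h⟩
  · rintro ⟨i, -, rfl⟩; exact ⟨i, by simp⟩

/-- The potential of a permutation: every element counts with the logarithm of the length of its
cycle. -/
noncomputable def logPotential {X : Type*} [Fintype X] (σ : Equiv.Perm X) : ℕ :=
  ∑ x, Nat.log 2 (cyc σ x).card

theorem logPotential_le {X : Type*} [Fintype X] (σ : Equiv.Perm X) :
    logPotential σ ≤ Fintype.card X * Nat.log 2 (Fintype.card X) := by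
  refine (Finset.sum_le_sum fun x _ => Nat.log_mono_right (Finset.card_le_univ _)).trans ?_
  simp

/-- When a cycle is split by a transposition, the potential decreases at least by the length of
the smaller part. -/
theorem logPotential_split {X : Type*} [Fintype X] [DecidableEq X] {σ : Equiv.Perm X} {a b : X}
    (hab : ¬ σ.SameCycle a b) (hle : (cyc σ a).card ≤ (cyc σ b).card) :
    logPotential σ + (cyc σ a).card ≤ logPotential (σ * Equiv.swap a b) := by
  set τ := σ * Equiv.swap a b
  have hm := fun x y => Equiv.Perm.sameCycle_mul_swap_iff hab x y
  have hmono : ∀ x, (cyc σ x).card ≤ (cyc τ x).card := fun x =>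
    Finset.card_le_card fun y hy => mem_cyc.2 ((hm x y).2 (Or.inl (mem_cyc.1 hy)))
  have hdisj : Disjoint (cyc σ a) (cyc σ b) := by
    rw [Finset.disjoint_left]
    intro z h1 h2
    exact hab ((mem_cyc.1 h1).trans (mem_cyc.1 h2).symm)
  have hbig : ∀ x ∈ cyc σ a, 2 * (cyc σ x).card ≤ (cyc τ x).card := by
    intro x hx
    rw [mem_cyc] at hx
    rw [← cyc_eq hx]
    have : cyc σ a ∪ cyc σ b ⊆ cyc τ x := by
      intro z hz
      rw [Finset.mem_union, mem_cyc, mem_cyc] at hz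
      rw [mem_cyc, hm]
      rcases hz with h | h
      · exact Or.inl (hx.symm.trans h)
      · exact Or.inr (Or.inl ⟨hx.symm, h.symm⟩)
    have h2 := Finset.card_le_card this
    rw [Finset.card_union_of_disjoint hdisj] at h2
    omega
  have hsum : (cyc σ a).card = ∑ x, if x ∈ cyc σ a then 1 else 0 := by simp
  rw [hsum]
  unfold logPotential
  rw [← Finset.sum_add_distrib]
  apply Finset.sum_le_sum
  intro x _
  split_ifs with hx
  · have h1 := hbig x hx
    have h2 : Nat.log 2 ((cyc σ x).card * 2) = Nat.log 2 (cyc σ x).card + 1 :=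
      Nat.log_mul_base (by norm_num) (card_cyc_pos σ x).ne'
    rw [← h2]
    exact Nat.log_mono_right (by omega)
  · rw [add_zero]; exact Nat.log_mono_right (hmono x)

/-! ### Connectivity by sets of edges -/

/-- A list of `m` edges on the vertices `0, …, n - 1`, each with its two ends (`false` for the
tail, `true` for the head) and a colour. -/
structure EdgeData (n m : ℕ) where
  endpt : Fin m → Bool → Fin n
  col : Fin m → Bool

namespace EdgeData

variable {n m : ℕ} (D : EdgeData n m)

/-- Two vertices are connected by edges with indices in `A`. -/
def Conn (A : Set (Fin m)) : Fin n → Fin n → Prop :=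
  Relation.EqvGen fun u v => ∃ i ∈ A, D.endpt i false = u ∧ D.endpt i true = v

variable {D} {A B : Set (Fin m)} {x y z : Fin n}

theorem Conn.refl (x : Fin n) : D.Conn A x x := Relation.EqvGen.refl x

theorem Conn.symm (h : D.Conn A x y) : D.Conn A y x := Relation.EqvGen.symm _ _ h

theorem Conn.trans (h : D.Conn A x y) (g : D.Conn A y z) : D.Conn A x z :=
  Relation.EqvGen.trans _ _ _ h g

theorem Conn.edge {i : Fin m} (hi : i ∈ A) : D.Conn A (D.endpt i false) (D.endpt i true) :=
  Relation.EqvGen.rel _ _ ⟨i, hi, rfl, rfl⟩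

theorem Conn.edge' {i : Fin m} (hi : i ∈ A) (b : Bool) :
    D.Conn A (D.endpt i b) (D.endpt i !b) := by
  cases b
  exacts [Conn.edge hi, (Conn.edge hi).symm]

/-- To show that connected vertices are related by an equivalence relation it suffices to show
that the ends of each edge are related. -/
theorem Conn.lift {r : Fin n → Fin n → Prop} (hr : Equivalence r)
    (h : ∀ i ∈ A, r (D.endpt i false) (D.endpt i true)) (hxy : D.Conn A x y) : r x y := by
  induction hxy with
  | rel a b hab => obtain ⟨i, hi, rfl, rfl⟩ := hab; exact h i hi
  | refl a => exact hr.refl a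
  | symm a b _ ih => exact hr.symm ih
  | trans a b c _ _ ih1 ih2 => exact hr.trans ih1 ih2

theorem conn_equivalence (A : Set (Fin m)) : Equivalence (D.Conn A) :=
  ⟨Conn.refl, Conn.symm, Conn.trans⟩

theorem Conn.mono (h : A ⊆ B) (hxy : D.Conn A x y) : D.Conn B x y :=
  hxy.lift (conn_equivalence B) fun _ hi => Conn.edge (h hi)

theorem conn_insert_iff {i : Fin m} : D.Conn (insert i A) x y ↔ D.Conn A x y ∨
    (D.Conn A x (D.endpt i false) ∧ D.Conn A y (D.endpt i true)) ∨
    (D.Conn A x (D.endpt i true) ∧ D.Conn A y (D.endpt i false)) := by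
  constructor
  · intro h
    refine h.lift (r := fun x y => D.Conn A x y ∨
      (D.Conn A x (D.endpt i false) ∧ D.Conn A y (D.endpt i true)) ∨
      (D.Conn A x (D.endpt i true) ∧ D.Conn A y (D.endpt i false))) ⟨?_, ?_, ?_⟩ ?_
    · exact fun x => Or.inl (Conn.refl x)
    · rintro x y (h | h | h)
      exacts [Or.inl h.symm, Or.inr (Or.inr ⟨h.2, h.1⟩), Or.inr (Or.inl ⟨h.2, h.1⟩)]
    · rintro x y z (h | h | h) (g | g | g)
      · exact Or.inl (h.trans g)
      · exact Or.inr (Or.inl ⟨h.trans g.1, g.2⟩)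
      · exact Or.inr (Or.inr ⟨h.trans g.1, g.2⟩)
      · exact Or.inr (Or.inl ⟨h.1, g.symm.trans h.2⟩)
      · exact Or.inr (Or.inl ⟨h.1, g.2⟩)
      · exact Or.inl (h.1.trans g.2.symm)
      · exact Or.inr (Or.inr ⟨h.1, g.symm.trans h.2⟩)
      · exact Or.inl (h.1.trans g.2.symm)
      · exact Or.inr (Or.inr ⟨h.1, g.2⟩)
    · intro j hj
      rcases Set.mem_insert_iff.1 hj with rfl | hj
      · exact Or.inr (Or.inl ⟨Conn.refl _, Conn.refl _⟩)
      · exact Or.inl (Conn.edge hj)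
  · have hm : ∀ {x y}, D.Conn A x y → D.Conn (insert i A) x y :=
      fun h => h.mono (Set.subset_insert i A)
    have hi : D.Conn (insert i A) (D.endpt i false) (D.endpt i true) :=
      Conn.edge (Set.mem_insert i A)
    rintro (h | h | h)
    · exact hm h
    · exact ((hm h.1).trans hi).trans (hm h.2).symm
    · exact ((hm h.1).trans hi.symm).trans (hm h.2).symm

/-- Connectivity within a set of vertices that no edge leaves. -/
theorem Conn.restrict {C : Set (Fin n)} (hC : ∀ i ∈ A, D.endpt i false ∈ C ↔ D.endpt i true ∈ C)
    (h : D.Conn A x y) (hx : x ∈ C) : D.Conn {i ∈ A | ∀ b, D.endpt i b ∈ C} x y := by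
  refine (h.lift (r := fun x y => (x ∈ C ↔ y ∈ C) ∧
    (x ∈ C → D.Conn {i ∈ A | ∀ b, D.endpt i b ∈ C} x y)) ⟨?_, ?_, ?_⟩ ?_).2 hx
  · exact fun x => ⟨Iff.rfl, fun _ => Conn.refl x⟩
  · exact fun h => ⟨h.1.symm, fun hy => (h.2 (h.1.2 hy)).symm⟩
  · exact fun h g => ⟨h.1.trans g.1, fun hx => (h.2 hx).trans (g.2 (h.1.1 hx))⟩
  · intro i hi
    refine ⟨hC i hi, fun hx => Conn.edge ⟨hi, fun b => ?_⟩⟩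
    cases b
    exacts [hx, (hC i hi).1 hx]

variable (D)

/-- The edges of colour `c` form a forest: every edge of colour `c` is a bridge. -/
def IsForest (c : Bool) : Prop :=
  ∀ i, D.col i = c → ¬ D.Conn {j | D.col j = c ∧ j ≠ i} (D.endpt i false) (D.endpt i true)

/-- A labelling of the connected components. Every edge decreases the number of components by at
most one. -/
theorem exists_labelling (A : Finset (Fin m)) :
    ∃ f : Fin n → Fin n, (∀ x y, f x = f y ↔ D.Conn (A : Set (Fin m)) x y) ∧
      n ≤ (Finset.univ.image f).card + A.card ∧
      ((∀ i ∈ A, ¬ D.Conn ((A : Set (Fin m)) \ {i}) (D.endpt i false) (D.endpt i true)) →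
        (Finset.univ.image f).card + A.card = n) := by
  classical
  induction A using Finset.induction_on with
  | empty =>
    refine ⟨id, fun x y => ⟨?_, fun h => ?_⟩, by simp, by simp⟩
    · rintro rfl; exact Conn.refl _
    · exact h.lift (r := Eq) eq_equivalence (by simp)
  | insert i A hi ih =>
    obtain ⟨f, hf, h1, h2⟩ := ih
    have hins : ((insert i A : Finset (Fin m)) : Set (Fin m)) = insert i (A : Set (Fin m)) := by
      simp
    rw [hins, Finset.card_insert_of_notMem hi]
    by_cases hc : D.Conn (A : Set (Fin m)) (D.endpt i false) (D.endpt i true)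
    · refine ⟨f, fun x y => ?_, by omega, fun h => ?_⟩
      · rw [hf, conn_insert_iff]
        refine ⟨Or.inl, ?_⟩
        rintro (h | h | h)
        exacts [h, (h.1.trans hc).trans h.2.symm, (h.1.trans hc.symm).trans h.2.symm]
      · refine absurd hc fun hc => h i (Finset.mem_insert_self i A) (hc.mono ?_)
        intro j hj
        exact ⟨Set.mem_insert_of_mem _ hj, fun h => hi (h ▸ hj)⟩
    · have hne : f (D.endpt i false) ≠ f (D.endpt i true) := fun h => hc ((hf _ _).1 h)
      set p := f (D.endpt i false) with hp
      set q := f (D.endpt i true) with hq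
      have himg : (Finset.univ.image fun x => if f x = p then q else f x)
          = (Finset.univ.image f).erase p := by
        ext z
        simp only [Finset.mem_image, Finset.mem_univ, true_and, Finset.mem_erase]
        constructor
        · rintro ⟨x, rfl⟩
          split_ifs with h
          exacts [⟨hne.symm, _, rfl⟩, ⟨h, _, rfl⟩]
        · rintro ⟨h, x, rfl⟩
          exact ⟨x, if_neg h⟩
      have hcard : ((Finset.univ.image f).erase p).card + 1 = (Finset.univ.image f).card :=
        Finset.card_erase_add_one (Finset.mem_image_of_mem f (Finset.mem_univ _))
      refine ⟨fun x => if f x = p then q else f x, fun x y => ?_, ?_, fun h => ?_⟩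
      · rw [conn_insert_iff, ← hf, ← hf, ← hf, ← hf, ← hf, ← hp, ← hq]
        by_cases hx : f x = p <;> by_cases hy : f y = p <;> simp only [hx, hy, if_true, if_false]
        · simp
        · constructor
          · intro h; right; left; exact ⟨trivial, h.symm⟩
          · rintro (h | h | h)
            exacts [absurd h.symm hy, h.2.symm, absurd h.1 hne]
        · constructor
          · intro h; right; right; exact ⟨h, trivial⟩
          · rintro (h | h | h)
            exacts [h.elim, h.1.elim, h.1]
        · simp
      · rw [himg]; omega
      · rw [himg]
        have := h2 fun j hj hcj => h j (Finset.mem_insert_of_mem hj) (hcj.mono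
          (Set.sdiff_subset_sdiff_left (Set.subset_insert _ _)))
        omega

variable {D}

/-- A set of vertices that is connected by the edges of `A` has at most `|A| + 1` elements. -/
theorem card_le_of_conn (A : Finset (Fin m)) (C : Finset (Fin n))
    (h : ∀ x ∈ C, ∀ y ∈ C, D.Conn (A : Set (Fin m)) x y) : C.card ≤ A.card + 1 := by
  classical
  obtain ⟨f, hf, h1, -⟩ := D.exists_labelling A
  have h2 : (C.image f).card ≤ 1 := by
    rw [Finset.card_le_one]
    intro a ha b hb
    obtain ⟨x, hx, rfl⟩ := Finset.mem_image.1 ha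
    obtain ⟨y, hy, rfl⟩ := Finset.mem_image.1 hb
    exact (hf x y).2 (h x hx y hy)
  have h3 : (Finset.univ.image f).card ≤ (C.image f).card + (Cᶜ.image f).card := by
    rw [← Finset.union_compl C, Finset.image_union]
    exact Finset.card_union_le _ _
  have h4 : (Cᶜ.image f).card ≤ n - C.card := by
    refine Finset.card_image_le.trans ?_
    rw [Finset.card_compl, Fintype.card_fin]
  have h5 : C.card ≤ n := by simpa using Finset.card_le_univ C
  omega

/-- The number of components of a forest. -/
theorem IsForest.exists_labelling {c : Bool} (h : D.IsForest c) :
    ∃ f : Fin n → Fin n, (∀ x y, f x = f y ↔ D.Conn {i | D.col i = c} x y) ∧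
      (Finset.univ.image f).card + (Finset.univ.filter fun i => D.col i = c).card = n := by
  obtain ⟨f, hf, -, h2⟩ := D.exists_labelling (Finset.univ.filter fun i => D.col i = c)
  rw [show ((Finset.univ.filter fun i => D.col i = c : Finset (Fin m)) : Set (Fin m))
    = {i | D.col i = c} by ext; simp] at hf h2
  refine ⟨f, hf, h2 fun i hi => ?_⟩
  have := h i (by simpa using hi)
  exact fun g => this (g.mono fun j hj => ⟨hj.1, hj.2⟩)

theorem IsForest.conn {c : Bool} (h : D.IsForest c)
    (hn : (Finset.univ.filter fun i => D.col i = c).card + 1 = n) (x y : Fin n) :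
    D.Conn {i | D.col i = c} x y := by
  obtain ⟨f, hf, h2⟩ := h.exists_labelling
  rw [← hf]
  obtain ⟨a, ha⟩ := Finset.card_eq_one.1 (show (Finset.univ.image f).card = 1 by omega)
  have : ∀ x, f x = a := fun x =>
    Finset.mem_singleton.1 (ha ▸ Finset.mem_image_of_mem f (Finset.mem_univ x))
  rw [this, this]

theorem IsForest.two_components {c : Bool} (h : D.IsForest c)
    (hn : (Finset.univ.filter fun i => D.col i = c).card + 2 = n) :
    (∃ x y, ¬ D.Conn {i | D.col i = c} x y) ∧ ∀ x y z, ¬ D.Conn {i | D.col i = c} x y →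
      ¬ D.Conn {i | D.col i = c} x z → D.Conn {i | D.col i = c} y z := by
  obtain ⟨f, hf, h2⟩ := h.exists_labelling
  simp only [← hf]
  obtain ⟨a, b, hab, himg⟩ :=
    Finset.card_eq_two.1 (show (Finset.univ.image f).card = 2 by omega)
  have hmem : ∀ x, f x = a ∨ f x = b := fun x => by
    have := himg ▸ Finset.mem_image_of_mem f (Finset.mem_univ x)
    simpa using this
  obtain ⟨x, -, hx⟩ := Finset.mem_image.1 (himg ▸ Finset.mem_insert_self a {b} :
    a ∈ Finset.univ.image f)
  obtain ⟨y, -, hy⟩ := Finset.mem_image.1 (himg ▸ Finset.mem_insert_of_mem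
    (Finset.mem_singleton_self b) : b ∈ Finset.univ.image f)
  refine ⟨⟨x, y, by rw [hx, hy]; exact hab⟩, fun x y z h1 h2 => ?_⟩
  rcases hmem x with h | h <;> rcases hmem y with g | g <;> rcases hmem z with k | k <;>
    simp_all

end EdgeData

/-! ### The sequence of partitions -/

/-- The colour of level `r` if the colour of level `0` is `t`. -/
def levelColour (t : Bool) : ℕ → Bool
  | 0 => t
  | r + 1 => !levelColour t r

namespace EdgeData

variable {n m : ℕ} (D : EdgeData n m) (t : Bool)

/-- The partition of the vertices at level `r` of the hierarchy, as an equivalence relation: at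
level `0` there is one class, and the classes of level `r + 1` are the components that the edges
with the colour of level `r + 1` form within the classes of level `r`. -/
def Level : ℕ → Fin n → Fin n → Prop
  | 0 => fun _ _ => True
  | r + 1 => D.Conn {i | D.col i = levelColour t (r + 1) ∧
      Level r (D.endpt i false) (D.endpt i true)}

/-- Edge data of a Laman graph whose colour classes are a spanning tree, of colour `t`, and a
forest with two components. -/
structure IsLamanSplit : Prop where
  laman : ∀ S : Finset (Fin n), 2 ≤ S.card →
    (Finset.univ.filter fun i => ∀ b, D.endpt i b ∈ S).card + 3 ≤ 2 * S.card
  count : m + 3 = 2 * n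
  ne : ∀ i, D.endpt i false ≠ D.endpt i true
  forest : ∀ c, D.IsForest c
  conn : ∀ x y, D.Conn {i | D.col i = t} x y
  two : ∃ x y, ¬ D.Conn {i | D.col i = !t} x y
  two' : ∀ x y z, ¬ D.Conn {i | D.col i = !t} x y → ¬ D.Conn {i | D.col i = !t} x z →
    D.Conn {i | D.col i = !t} y z

variable {D t} {r k : ℕ} {x y z v w : Fin n} {i : Fin m}

theorem level_equivalence (r : ℕ) : Equivalence (D.Level t r) := by
  cases r with
  | zero => exact ⟨fun _ => trivial, fun _ => trivial, fun _ _ => trivial⟩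
  | succ r => exact conn_equivalence _

theorem Level.refl (r : ℕ) (x : Fin n) : D.Level t r x x := (level_equivalence r).refl x

theorem Level.symm (h : D.Level t r x y) : D.Level t r y x := (level_equivalence r).symm h

theorem Level.trans (h : D.Level t r x y) (g : D.Level t r y z) : D.Level t r x z :=
  (level_equivalence r).trans h g

theorem Level.of_succ (h : D.Level t (r + 1) x y) : D.Level t r x y :=
  Conn.lift (level_equivalence r) (fun _ hi => hi.2) h

theorem Level.anti (h : D.Level t k x y) (hr : r ≤ k) : D.Level t r x y := by
  induction k, hr using Nat.le_induction with
  | base => exact h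
  | succ k _ ih => exact ih h.of_succ

theorem Level.edge_succ (hc : D.col i = levelColour t (r + 1))
    (h : D.Level t r (D.endpt i false) (D.endpt i true)) :
    D.Level t (r + 1) (D.endpt i false) (D.endpt i true) :=
  Conn.edge ⟨hc, h⟩

theorem col_eq_or (i : Fin m) (r : ℕ) :
    D.col i = levelColour t r ∨ D.col i = levelColour t (r + 1) := by
  simp only [levelColour]
  cases D.col i <;> cases levelColour t r <;> simp

theorem levelColour_add_two (r : ℕ) : levelColour t (r + 2) = levelColour t r := by
  simp [levelColour]

/-- The edges that run between different classes of level `r`. -/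
def cutSet (D : EdgeData n m) (t : Bool) (r : ℕ) : Set (Fin m) :=
  {i | ¬ D.Level t r (D.endpt i false) (D.endpt i true)}

/-- The class of `v` at level `k` is a node of the hierarchy: the levels stop when the
grandparent class is a single vertex. -/
def IsNode (D : EdgeData n m) (t : Bool) (k : ℕ) (v : Fin n) : Prop :=
  k ≤ 1 ∨ ∃ w, w ≠ v ∧ D.Level t (k - 2) v w

theorem IsNode.congr (h : D.IsNode t k v) (hvw : D.Level t (k - 2) v w) : D.IsNode t k w := by
  rcases h with h | ⟨z, hz, hvz⟩
  · exact Or.inl h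
  · by_cases hw : w = v
    · exact Or.inr ⟨z, hw ▸ hz, hw ▸ hvz⟩
    · exact Or.inr ⟨v, fun e => hw e.symm, hvw.symm⟩

theorem IsNode.anti (h : D.IsNode t k v) (hr : r ≤ k) : D.IsNode t r v := by
  rcases h with h | ⟨z, hz, hvz⟩
  · exact Or.inl (hr.trans h)
  · exact Or.inr ⟨z, hz, hvz.anti (by omega)⟩

theorem isNode_add_two : D.IsNode t (k + 2) v ↔ ∃ w, w ≠ v ∧ D.Level t k v w := by
  simp [IsNode]

namespace IsLamanSplit

variable (h : D.IsLamanSplit t)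
include h

/-- The classes of level `r` are the components of the edges with the colour of level `r` that
run within these classes. -/
theorem level_iff_conn (r : ℕ) (x y : Fin n) : D.Level t r x y ↔
    D.Conn {i | D.col i = levelColour t r ∧ i ∉ D.cutSet t r} x y := by
  simp only [cutSet, Set.mem_ofPred_eq, not_not]
  cases r with
  | zero =>
    refine ⟨fun _ => (h.conn x y).mono fun i hi => ⟨hi, trivial⟩, fun _ => trivial⟩
  | succ r =>
    refine ⟨fun g => Conn.mono (fun i hi => ⟨hi.1, Level.edge_succ hi.1 hi.2⟩) g,
      fun g => Conn.mono (fun i hi => ⟨hi.1, hi.2.of_succ⟩) g⟩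

omit h in
theorem level_succ_iff_conn (r : ℕ) (x y : Fin n) : D.Level t (r + 1) x y ↔
    D.Conn {i | D.col i = levelColour t (r + 1) ∧ i ∉ D.cutSet t r} x y := by
  simp only [cutSet, Set.mem_ofPred_eq, not_not]
  rfl

theorem two_le : 2 ≤ n := by
  obtain ⟨x, y, hxy⟩ := h.two
  have : x ≠ y := fun e => hxy (e ▸ Conn.refl _)
  have := Fin.val_ne_of_ne this
  omega

/-- If a class does not split from one level to the next, it is connected in both colours, and
then, by the Laman condition, it is a single vertex. -/
theorem eq_of_not_split (hv : ∀ w, D.Level t r v w → D.Level t (r + 1) v w)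
    (hw : D.Level t r v w) : v = w := by
  classical
  set C : Finset (Fin n) := Finset.univ.filter fun w => D.Level t r v w with hC
  have memC : ∀ w, w ∈ C ↔ D.Level t r v w := fun w => by simp [hC]
  by_contra hne
  have hcard : 2 ≤ C.card := by
    have : ({v, w} : Finset (Fin n)) ⊆ C := by
      intro z hz
      rw [memC]
      rcases Finset.mem_insert.1 hz with rfl | hz
      · exact Level.refl _ _
      · rw [Finset.mem_singleton.1 hz]; exact hw
    simpa [Finset.card_pair hne] using Finset.card_le_card this
  have key : ∀ c, (∀ w ∈ C, D.Conn {i | D.col i = c ∧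
      D.Level t r (D.endpt i false) (D.endpt i true)} v w) →
      C.card ≤ (Finset.univ.filter fun i => D.col i = c ∧ ∀ b, D.endpt i b ∈ C).card + 1 := by
    intro c hc
    have hc' : ∀ w ∈ C, D.Conn ((Finset.univ.filter fun i => D.col i = c ∧
        ∀ b, D.endpt i b ∈ C : Finset (Fin m)) : Set (Fin m)) v w := by
      intro w hw
      refine (Conn.restrict (C := {w | w ∈ C}) (fun i hi => ?_) (hc w hw) ?_).mono ?_
      · simp only [Set.mem_ofPred_eq, memC]
        exact ⟨fun g => g.trans hi.2, fun g => g.trans hi.2.symm⟩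
      · exact (memC v).2 (Level.refl _ _)
      · intro i hi
        exact Finset.mem_coe.2 (Finset.mem_filter.2 ⟨Finset.mem_univ _, hi.1.1, hi.2⟩)
    exact card_le_of_conn _ C fun x hx y hy => (hc' x hx).symm.trans (hc' y hy)
  have h1 := key (levelColour t r) fun w hw => by
    have := (h.level_iff_conn r v w).1 ((memC w).1 hw)
    simpa [cutSet] using this
  have h2 := key (levelColour t (r + 1)) fun w hw => hv w ((memC w).1 hw)
  have h3 := h.laman C hcard
  have h4 : (Finset.univ.filter fun i => D.col i = levelColour t r ∧ ∀ b, D.endpt i b ∈ C).card +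
      (Finset.univ.filter fun i => D.col i = levelColour t (r + 1) ∧
        ∀ b, D.endpt i b ∈ C).card ≤ (Finset.univ.filter fun i => ∀ b, D.endpt i b ∈ C).card := by
    rw [← Finset.card_union_of_disjoint]
    · apply Finset.card_le_card
      intro i hi
      simp only [Finset.mem_union, Finset.mem_filter, Finset.mem_univ, true_and] at hi ⊢
      rcases hi with hi | hi
      exacts [hi.2, hi.2]
    · rw [Finset.disjoint_left]
      intro i hi hj
      simp only [Finset.mem_filter, Finset.mem_univ, true_and] at hi hj
      have := hi.1.symm.trans hj.1
      rw [levelColour] at this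
      cases levelColour t r <;> simp at this
  omega

/-- A set of edges of one colour does not connect the ends of another edge of that colour. -/
theorem not_conn {c : Bool} (hi : D.col i = c) {A : Set (Fin m)} (hA : ∀ j ∈ A, D.col j = c)
    (hiA : i ∉ A) : ¬ D.Conn A (D.endpt i false) (D.endpt i true) := fun g =>
  h.forest c i hi (g.mono fun j hj => ⟨hA j hj, fun e => hiA (e ▸ hj)⟩)

omit h in
theorem mem_cutSet_succ_iff (hc : D.col i = levelColour t (r + 1)) :
    i ∈ D.cutSet t (r + 1) ↔ i ∈ D.cutSet t r :=
  not_congr ⟨fun g => g.of_succ, fun g => Level.edge_succ hc g⟩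

/-- Every edge is cut at some level if the classes finally are single vertices. -/
theorem exists_cut {R : ℕ} (hR : ∀ v w, D.Level t R v w → v = w) (i : Fin m) :
    ∃ k, i ∉ D.cutSet t k ∧ i ∈ D.cutSet t (k + 1) := by
  have h0 : i ∉ D.cutSet t 0 := fun e => e trivial
  have h1 : i ∈ D.cutSet t R := fun e => h.ne i (hR _ _ e)
  by_contra! hc
  have : ∀ k, i ∉ D.cutSet t k := fun k => by
    induction k with
    | zero => exact h0
    | succ k ih => exact hc k ih
  exact this R h1

/-- If no edge is cut between the levels `r` and `r + 1`, all classes are single vertices. -/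
theorem discrete_of_cutSet_subset (hr : D.cutSet t (r + 1) ⊆ D.cutSet t r) :
    ∀ v w, D.Level t r v w → v = w := by
  intro v w
  refine h.eq_of_not_split fun z hz => Level.of_succ ?_
  rw [level_succ_iff_conn, levelColour_add_two]
  exact ((h.level_iff_conn r v z).1 hz).mono fun i hi => ⟨hi.1, fun e => hi.2 (hr e)⟩

/-- Every class of level `r + 2` that is a node of the hierarchy contains an end of an edge that is
cut between the levels `r` and `r + 1`: such an edge joins the class to the other classes in its
grandparent, and if there are no other classes, the grandparent does not split. -/
theorem exists_cut_level (hv : D.IsNode t (r + 2) v) : ∃ i b, i ∉ D.cutSet t r ∧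
    i ∈ D.cutSet t (r + 1) ∧ D.Level t (r + 2) (D.endpt i b) v := by
  obtain ⟨w, hwv, hvw⟩ := isNode_add_two.1 hv
  by_contra! hc
  refine hwv (h.eq_of_not_split (fun z hz => Level.of_succ ?_) hvw).symm
  refine (((h.level_iff_conn r v z).1 hz).lift
    (r := fun x y => D.Level t (r + 2) v x ↔ D.Level t (r + 2) v y)
    ⟨fun _ => Iff.rfl, fun e => e.symm, fun e f => e.trans f⟩ fun i hi => ?_).1 (Level.refl _ _)
  by_cases hi' : i ∈ D.cutSet t (r + 1)
  · exact iff_of_false (fun e => hc i false hi.2 hi' e.symm)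
      (fun e => hc i true hi.2 hi' e.symm)
  · have : D.Level t (r + 2) (D.endpt i false) (D.endpt i true) :=
      Level.edge_succ (by rw [levelColour_add_two]; exact hi.1) (not_not.1 hi')
    exact ⟨fun e => e.trans this, fun e => e.trans this.symm⟩

end IsLamanSplit

/-! ### The hierarchy formed by the classes of all levels -/

/-- A rooted tree `T` whose nodes are the classes of all levels: `nd k v` is the class of `v` at
level `k`. The map `α` sends a vertex to its last node, and `β` sends an edge, whose ends are
separated from level `k` to level `k + 1`, to the classes of its ends at level `k + 2`. -/
structure Realizes {X : Type*} (D : EdgeData n m) (t : Bool) (T : RootedTreeOn X)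
    (nd : ℕ → Fin n → X) (α : Fin n → X) (β : Sym2 (Fin n) → Sym2 X) : Prop where
  root : ∀ v, nd 0 v = T.root
  surj : ∀ y, ∃ k v, D.IsNode t k v ∧ nd k v = y
  inj : ∀ {k v k' w}, D.IsNode t k v → D.IsNode t k' w →
    (nd k v = nd k' w ↔ k = k' ∧ D.Level t k v w)
  parent : ∀ {k v}, D.IsNode t (k + 1) v → T.parent (nd (k + 1) v) = nd k v
  leaf : ∀ v, ∃ k, D.IsNode t k v ∧ ¬ D.IsNode t (k + 1) v ∧ α v = nd k v
  cross : ∀ {k i}, i ∉ D.cutSet t k → i ∈ D.cutSet t (k + 1) →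
    β s(D.endpt i false, D.endpt i true) =
      s(nd (k + 2) (D.endpt i false), nd (k + 2) (D.endpt i true))
  discrete : ∃ R, ∀ v w, D.Level t R v w → v = w

namespace Realizes

variable {X : Type*} {T : RootedTreeOn X} {nd : ℕ → Fin n → X} {α : Fin n → X}
  {β : Sym2 (Fin n) → Sym2 X} (hT : D.Realizes t T nd α β)
include hT

theorem isChild_iff {k' : ℕ} (hw : D.IsNode t k' w) (hv : D.IsNode t k v) :
    T.IsChild (nd k' w) (nd k v) ↔ k' = k + 1 ∧ D.Level t k v w := by
  have h0 : D.IsNode t 0 w := Or.inl (by omega)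
  rw [RootedTreeOn.IsChild, ← hT.root w, Ne, hT.inj hw h0]
  constructor
  · rintro ⟨h1, h2⟩
    obtain ⟨j, rfl⟩ : ∃ j, k' = j + 1 := by
      refine Nat.exists_eq_succ_of_ne_zero fun e => h1 ⟨e, Level.refl _ _⟩
    rw [hT.parent hw, hT.inj (hw.anti (by omega)) hv] at h2
    obtain ⟨rfl, h2⟩ := h2
    exact ⟨rfl, h2.symm⟩
  · rintro ⟨rfl, h⟩
    refine ⟨fun e => by omega, ?_⟩
    rw [hT.parent hw, hT.inj (hw.anti (by omega)) hv]
    exact ⟨rfl, h.symm⟩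

theorem isLeaf_iff (hv : D.IsNode t k v) : T.IsLeaf (nd k v) ↔ ¬ D.IsNode t (k + 1) v := by
  rw [RootedTreeOn.IsLeaf, Set.eq_empty_iff_forall_notMem]
  constructor
  · exact fun h hk => h (nd (k + 1) v) ((hT.isChild_iff hk hv).2 ⟨rfl, Level.refl _ _⟩)
  · intro h y hy
    obtain ⟨k', w, hw, rfl⟩ := hT.surj y
    obtain ⟨rfl, hvw⟩ := (hT.isChild_iff hw hv).1 hy
    exact h (hw.congr (hvw.symm.anti (by omega)))

theorem isOnlyChild_iff (h : D.IsLamanSplit t) (hv : D.IsNode t k v) :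
    T.IsOnlyChild (nd k v) ↔ ¬ D.IsNode t (k + 1) v := by
  constructor
  · rintro ⟨p, hp⟩ hk
    obtain ⟨j, u, hu, rfl⟩ := hT.surj p
    obtain ⟨rfl, huv⟩ := (hT.isChild_iff hv hu).1
      (show nd k v ∈ T.children (nd j u) from hp ▸ Set.mem_singleton _)
    obtain ⟨w, hwv, hvw⟩ := isNode_add_two.1 hk
    refine hwv (h.eq_of_not_split (fun z hz => ?_) hvw).symm
    have hz' : D.IsNode t (j + 1) z := hv.congr (hz.anti (by omega))
    have : nd (j + 1) z ∈ T.children (nd j u) := (hT.isChild_iff hz' hu).2 ⟨rfl, huv.trans hz⟩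
    rw [hp, Set.mem_singleton_iff, hT.inj hz' hv] at this
    exact this.2.symm
  · intro hk
    obtain ⟨j, rfl⟩ : ∃ j, k = j + 1 :=
      Nat.exists_eq_succ_of_ne_zero fun e => hk (Or.inl (by omega))
    have hj : D.IsNode t j v := hv.anti (by omega)
    refine ⟨nd j v, Set.eq_singleton_iff_unique_mem.2
      ⟨(hT.isChild_iff hv hj).2 ⟨rfl, Level.refl _ _⟩, fun y hy => ?_⟩⟩
    obtain ⟨k', w, hw, rfl⟩ := hT.surj y
    obtain ⟨rfl, hvw⟩ := (hT.isChild_iff hw hj).1 hy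
    have : w = v := by
      by_contra hne
      exact hk (isNode_add_two.2 ⟨w, hne, hvw⟩)
    rw [this]

theorem root_children (h : D.IsLamanSplit t) : (T.children T.root).ncard = 2 := by
  obtain ⟨x, y, hxy⟩ := h.two
  have h1 : ∀ v, D.IsNode t 1 v := fun v => Or.inl le_rfl
  have h0 : ∀ v, D.IsNode t 0 v := fun v => Or.inl (by omega)
  have hl : ∀ v w, D.Level t 1 v w ↔ D.Conn {i | D.col i = !t} v w := fun v w => by
    simp [Level, levelColour]
  have : T.children T.root = {nd 1 x, nd 1 y} := by
    ext z
    rw [← hT.root x, Set.mem_insert_iff, Set.mem_singleton_iff]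
    obtain ⟨k, v, hv, rfl⟩ := hT.surj z
    rw [RootedTreeOn.children, Set.mem_ofPred_eq, hT.isChild_iff hv (h0 x), hT.inj hv (h1 x),
      hT.inj hv (h1 y), ← and_or_left]
    refine and_congr_right fun hk => ⟨fun _ => ?_, fun _ => trivial⟩
    subst hk
    rw [zero_add, hl, hl]
    by_cases hc : D.Conn {i | D.col i = !t} x v
    · exact Or.inl hc.symm
    · exact Or.inr (h.two' x y v hxy hc).symm
  rw [this, Set.ncard_pair]
  rw [Ne, hT.inj (h1 x) (h1 y), hl]
  exact fun e => hxy e.2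

theorem exists_level (h : D.IsLamanSplit t) (i : Fin m) :
    ∃ k, i ∉ D.cutSet t k ∧ i ∈ D.cutSet t (k + 1) := by
  obtain ⟨R, hR⟩ := hT.discrete
  exact h.exists_cut hR i

omit hT in
theorem col_of_cut (hk : i ∉ D.cutSet t k) (hk' : i ∈ D.cutSet t (k + 1)) :
    D.col i = levelColour t k := by
  rcases col_eq_or i k with hc | hc
  · exact hc
  · exact absurd ((IsLamanSplit.mem_cutSet_succ_iff hc).1 hk') hk

omit hT in
theorem isNode_of_cut (h : D.IsLamanSplit t) (hk : i ∉ D.cutSet t k) (b : Bool) :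
    D.IsNode t (k + 2) (D.endpt i b) := by
  rw [cutSet, Set.mem_ofPred_eq, not_not] at hk
  refine isNode_add_two.2 ⟨D.endpt i !b, ?_, ?_⟩
  · have := h.ne i
    cases b
    exacts [this.symm, this]
  · cases b
    exacts [hk, hk.symm]

omit hT in
/-- Within a class of level `k + 2`, one gets from any vertex to any other without an edge `i`
that was cut earlier. -/
theorem conn_avoiding (h : D.IsLamanSplit t) (hi : i ∈ D.cutSet t (k + 1))
    (hvw : D.Level t (k + 2) v w) :
    D.Conn {j | D.col j = levelColour t k ∧ j ≠ i} v w := by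
  refine ((h.level_iff_conn (k + 2) v w).1 hvw).mono fun j hj => ⟨?_, ?_⟩
  · rw [← levelColour_add_two]; exact hj.1
  · rintro rfl
    exact hj.2 fun e => hi e.of_succ

/-- The cross edge of `j` joins the classes of `x` and `y` at level `k + 2`. -/
theorem conn_of_cross (h : D.IsLamanSplit t) {j : Fin m} (hi : i ∈ D.cutSet t (k + 1))
    (hji : j ≠ i) (hx : D.IsNode t (k + 2) x) (hy : D.IsNode t (k + 2) y)
    (hj : β s(D.endpt j false, D.endpt j true) = s(nd (k + 2) x, nd (k + 2) y)) :
    D.Conn {j | D.col j = levelColour t k ∧ j ≠ i} x y := by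
  obtain ⟨l, hl, hl'⟩ := hT.exists_level h j
  rw [hT.cross hl hl', Sym2.eq_iff, hT.inj (isNode_of_cut h hl _) hx,
    hT.inj (isNode_of_cut h hl _) hy, hT.inj (isNode_of_cut h hl _) hx,
    hT.inj (isNode_of_cut h hl _) hy] at hj
  have hlk : l = k := by rcases hj with ⟨⟨e, -⟩, -⟩ | ⟨⟨e, -⟩, -⟩ <;> omega
  subst hlk
  have hjc : D.Conn {j | D.col j = levelColour t l ∧ j ≠ i} (D.endpt j false) (D.endpt j true) :=
    Conn.edge ⟨col_of_cut hl hl', hji⟩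
  rcases hj with ⟨⟨-, h1⟩, -, h2⟩ | ⟨⟨-, h1⟩, -, h2⟩
  · exact ((conn_avoiding h hi h1).symm.trans hjc).trans (conn_avoiding h hi h2)
  · exact ((conn_avoiding h hi h2).symm.trans hjc.symm).trans (conn_avoiding h hi h1)

theorem mem_grandchildren_iff (hv : D.IsNode t k v) (y : X) :
    y ∈ T.grandchildren (nd k v) ↔ ∃ w, D.IsNode t (k + 2) w ∧ D.Level t k v w ∧
      nd (k + 2) w = y := by
  constructor
  · rintro ⟨p, hp, hp'⟩
    obtain ⟨k', w, hw, rfl⟩ := hT.surj y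
    obtain ⟨l, u, hu, rfl⟩ := hT.surj p
    obtain ⟨rfl, hvu⟩ := (hT.isChild_iff hu hv).1 hp'
    obtain ⟨rfl, huw⟩ := (hT.isChild_iff hw hu).1 hp
    exact ⟨w, hw, hvu.trans huw.of_succ, rfl⟩
  · rintro ⟨w, hw, hvw, rfl⟩
    have hw' : D.IsNode t (k + 1) w := hw.anti (by omega)
    exact ⟨nd (k + 1) w, (hT.isChild_iff hw hw').2 ⟨rfl, Level.refl _ _⟩,
      (hT.isChild_iff hw' hv).2 ⟨rfl, hvw⟩⟩

theorem iterate_parent (d : ℕ) (h : D.IsNode t (k + d) v) :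
    T.parent^[d] (nd (k + d) v) = nd k v := by
  induction d with
  | zero => rfl
  | succ d ih =>
    have := hT.parent (k := k + d) h
    rw [Function.iterate_succ_apply, ← Nat.add_assoc, this]
    exact ih (h.anti (by omega))

variable {G : SimpleGraph (Fin n)}
  (hG : ∀ e, e ∈ G.edgeSet ↔ ∃ i, s(D.endpt i false, D.endpt i true) = e)
include hG

theorem isHierarchy (h : D.IsLamanSplit t) : IsHierarchy G T α β where
  leaves := by
    refine ⟨fun v _ => ?_, fun v _ w _ hvw => ?_, fun y hy => ?_⟩
    · obtain ⟨k, h1, h2, h3⟩ := hT.leaf v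
      rw [h3]; exact (hT.isLeaf_iff h1).2 h2
    · obtain ⟨k, h1, h2, h3⟩ := hT.leaf v
      obtain ⟨k', g1, g2, g3⟩ := hT.leaf w
      rw [h3, g3, hT.inj h1 g1] at hvw
      by_contra hne
      obtain ⟨j, rfl⟩ : ∃ j, k = j + 1 :=
        Nat.exists_eq_succ_of_ne_zero fun e => h2 (Or.inl (by omega))
      exact h2 (isNode_add_two.2 ⟨w, fun e => hne e.symm, hvw.2.of_succ⟩)
    · obtain ⟨k, v, hv, rfl⟩ := hT.surj y
      have hl := (hT.isLeaf_iff hv).1 hy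
      obtain ⟨k', g1, g2, g3⟩ := hT.leaf v
      refine ⟨v, Set.mem_univ v, ?_⟩
      have : k' = k := by
        rcases lt_trichotomy k' k with e | e | e
        exacts [absurd (hv.anti e) g2, e, absurd (g1.anti e) hl]
      rw [g3, this]
  cross_injective := by
    intro e he f hf hef
    obtain ⟨i, rfl⟩ := (hG e).1 he
    obtain ⟨j, rfl⟩ := (hG f).1 hf
    by_contra hne
    have hji : j ≠ i := fun e => hne (e ▸ rfl)
    obtain ⟨k, hk, hk'⟩ := hT.exists_level h i
    rw [hT.cross hk hk'] at hef
    exact h.not_conn (col_of_cut hk hk') (fun j hj => hj.1) (fun e => e.2 rfl)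
      (hT.conn_of_cross h hk' hji (isNode_of_cut h hk _) (isNode_of_cut h hk _) hef.symm)
  cross_ancestors := by
    intro u v huv
    obtain ⟨i, hi⟩ := (hG s(u, v)).1 huv
    obtain ⟨k, hk, hk'⟩ := hT.exists_level h i
    have key : ∀ w, D.IsNode t (k + 2) w → T.IsAncestor (nd (k + 2) w) (α w) := by
      intro w hw
      obtain ⟨l, g1, g2, g3⟩ := hT.leaf w
      have hl : k + 2 ≤ l := by
        by_contra hlt
        exact g2 (hw.anti (by omega))
      obtain ⟨d, rfl⟩ := Nat.exists_eq_add_of_le hl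
      exact ⟨d, by rw [g3]; exact hT.iterate_parent d g1⟩
    have k1 := key _ (isNode_of_cut h hk false)
    have k2 := key _ (isNode_of_cut h hk true)
    have hc := hT.cross hk hk'
    rw [hi] at hc
    rcases Sym2.eq_iff.1 hi with ⟨e1, e2⟩ | ⟨e1, e2⟩
    · rw [e1] at k1 hc; rw [e2] at k2 hc
      exact ⟨_, _, hc, k1, k2⟩
    · rw [e1] at k1 hc; rw [e2] at k2 hc
      exact ⟨_, _, hc.trans Sym2.eq_swap, k2, k1⟩

omit hT in
theorem crossGraph_adj_iff (a b : X) : (crossGraph G β).Adj a b ↔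
    (∃ i, β s(D.endpt i false, D.endpt i true) = s(a, b)) ∧ a ≠ b := by
  rw [crossGraph, SimpleGraph.fromEdgeSet_adj]
  refine and_congr_left fun _ => ⟨?_, ?_⟩
  · rintro ⟨e, he, hb⟩
    obtain ⟨i, rfl⟩ := (hG e).1 he
    exact ⟨i, hb⟩
  · rintro ⟨i, hi⟩
    exact ⟨_, (hG _).2 ⟨i, rfl⟩, hi⟩

theorem connected_crossGraph (h : D.IsLamanSplit t) (hv : D.IsNode t (k + 2) v) :
    ((crossGraph G β).induce (T.grandchildren (nd k v))).Connected := by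
  have hkv : D.IsNode t k v := hv.anti (by omega)
  have hnode : ∀ w, D.Level t k v w → D.IsNode t (k + 2) w := fun w hw => hv.congr hw
  have hmem : ∀ w, D.Level t k v w → nd (k + 2) w ∈ T.grandchildren (nd k v) := fun w hw =>
    (hT.mem_grandchildren_iff hkv _).2 ⟨w, hnode w hw, hw, rfl⟩
  set X' := (crossGraph G β).induce (T.grandchildren (nd k v))
  have key : ∀ x y, D.Level t k x y → (D.Level t k v x ↔ D.Level t k v y) ∧
      ∀ hx hy, X'.Reachable ⟨nd (k + 2) x, hmem x hx⟩ ⟨nd (k + 2) y, hmem y hy⟩ := by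
    intro x y hxy
    refine ((h.level_iff_conn k x y).1 hxy).lift (r := fun x y =>
      (D.Level t k v x ↔ D.Level t k v y) ∧ ∀ hx hy,
        X'.Reachable ⟨nd (k + 2) x, hmem x hx⟩ ⟨nd (k + 2) y, hmem y hy⟩) ⟨?_, ?_, ?_⟩ ?_
    · exact fun x => ⟨Iff.rfl, fun _ _ => SimpleGraph.Reachable.rfl⟩
    · exact fun e => ⟨e.1.symm, fun hx hy => (e.2 hy hx).symm⟩
    · exact fun e f => ⟨e.1.trans f.1, fun hx hz =>
        (e.2 hx (e.1.1 hx)).trans (f.2 (e.1.1 hx) hz)⟩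
    · intro i hi
      have hik : D.Level t k (D.endpt i false) (D.endpt i true) := not_not.1 hi.2
      refine ⟨⟨fun e => e.trans hik, fun e => e.trans hik.symm⟩, fun hx hy => ?_⟩
      by_cases hi' : i ∈ D.cutSet t (k + 1)
      · refine SimpleGraph.Adj.reachable ?_
        rw [SimpleGraph.comap_adj]
        refine (crossGraph_adj_iff hG _ _).2 ⟨⟨i, hT.cross hi.2 hi'⟩, ?_⟩
        intro e
        exact hi' ((hT.inj (hnode _ hx) (hnode _ hy)).1 e).2.of_succ
      · have : D.Level t (k + 2) (D.endpt i false) (D.endpt i true) :=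
          Level.edge_succ (by rw [levelColour_add_two]; exact hi.1) (not_not.1 hi')
        have e : nd (k + 2) (D.endpt i false) = nd (k + 2) (D.endpt i true) :=
          (hT.inj (hnode _ hx) (hnode _ hy)).2 ⟨rfl, this⟩
        simp only [e]
        exact SimpleGraph.Reachable.rfl
  rw [SimpleGraph.connected_iff]
  refine ⟨?_, ⟨⟨_, hmem v (Level.refl _ _)⟩⟩⟩
  rintro ⟨a, ha⟩ ⟨b, hb⟩
  obtain ⟨x, -, hvx, rfl⟩ := (hT.mem_grandchildren_iff hkv _).1 ha
  obtain ⟨y, -, hvy, rfl⟩ := (hT.mem_grandchildren_iff hkv _).1 hb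
  exact (key x y (hvx.symm.trans hvy)).2 hvx hvy

/-- The cross edges between the classes of one level form a forest: a path between the ends of
the cross edge of `i` that avoids this cross edge would, together with paths within the classes,
connect the ends of `i` without `i`. -/
theorem isAcyclic_crossGraph (h : D.IsLamanSplit t) (hv : D.IsNode t k v) :
    ((crossGraph G β).induce (T.grandchildren (nd k v))).IsAcyclic := by
  rw [SimpleGraph.isAcyclic_iff_forall_adj_isBridge]
  rintro ⟨a, ha⟩ ⟨b, hb⟩ hab
  rw [SimpleGraph.isBridge_iff]
  intro hreach
  rw [SimpleGraph.comap_adj] at hab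
  obtain ⟨⟨i, hi⟩, -⟩ := (crossGraph_adj_iff hG _ _).1 hab
  simp only [Function.Embedding.subtype_apply] at hi
  obtain ⟨x, hx, -, rfl⟩ := (hT.mem_grandchildren_iff hv _).1 ha
  obtain ⟨y, hy, -, rfl⟩ := (hT.mem_grandchildren_iff hv _).1 hb
  obtain ⟨l, hl, hl'⟩ := hT.exists_level h i
  have hi' := hi
  rw [hT.cross hl hl', Sym2.eq_iff, hT.inj (isNode_of_cut h hl _) hx,
    hT.inj (isNode_of_cut h hl _) hy, hT.inj (isNode_of_cut h hl _) hx,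
    hT.inj (isNode_of_cut h hl _) hy] at hi'
  have hlk : l = k := by rcases hi' with ⟨⟨e, -⟩, -⟩ | ⟨⟨e, -⟩, -⟩ <;> omega
  subst hlk
  have key : ∀ p q, ((((crossGraph G β).induce (T.grandchildren (nd l v))).deleteEdges
      {s(⟨nd (l + 2) x, ha⟩, ⟨nd (l + 2) y, hb⟩)}).Reachable p q) → ∀ x y,
      D.IsNode t (l + 2) x → D.IsNode t (l + 2) y → nd (l + 2) x = p → nd (l + 2) y = q →
      D.Conn {j | D.col j = levelColour t l ∧ j ≠ i} x y := by
    intro p q hpq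
    rw [SimpleGraph.reachable_iff_reflTransGen] at hpq
    induction hpq with
    | refl =>
      intro x y hx hy h1 h2
      exact conn_avoiding h hl' ((hT.inj hx hy).1 (h1.trans h2.symm)).2
    | @tail q r _ hqr ih =>
      intro x' z hx' hz h1 h2
      obtain ⟨q, hq⟩ := q
      obtain ⟨r, hr⟩ := r
      obtain ⟨y', hy', -, rfl⟩ := (hT.mem_grandchildren_iff hv _).1 hq
      change nd (l + 2) z = r at h2
      subst h2
      refine (ih x' y' hx' hy' h1 rfl).trans ?_
      rw [SimpleGraph.deleteEdges_adj, SimpleGraph.comap_adj] at hqr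
      obtain ⟨⟨j, hj⟩, -⟩ := (crossGraph_adj_iff hG _ _).1 hqr.1
      refine hT.conn_of_cross h hl' ?_ hy' hz hj
      rintro rfl
      apply hqr.2
      have := hi.symm.trans hj
      simp only [Function.Embedding.subtype_apply] at this
      rw [Set.mem_singleton_iff]
      rcases Sym2.eq_iff.1 this with ⟨e1, e2⟩ | ⟨e1, e2⟩
      · exact Sym2.eq_iff.2 (Or.inl ⟨Subtype.ext e1.symm, Subtype.ext e2.symm⟩)
      · exact Sym2.eq_iff.2 (Or.inr ⟨Subtype.ext e2.symm, Subtype.ext e1.symm⟩)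
  have hc := key _ _ hreach x y hx hy rfl rfl
  refine h.not_conn (col_of_cut hl hl') (A := {j | D.col j = levelColour t l ∧ j ≠ i})
    (fun j hj => hj.1) (fun e => e.2 rfl) ?_
  rcases hi' with ⟨⟨-, h1⟩, -, h2⟩ | ⟨⟨-, h1⟩, -, h2⟩
  · exact ((conn_avoiding h hl' h1).trans hc).trans (conn_avoiding h hl' h2).symm
  · exact ((conn_avoiding h hl' h1).trans hc.symm).trans (conn_avoiding h hl' h2).symm

/-- The tree of the classes of all levels is a red-black hierarchy. -/
theorem isRedBlackHierarchy (h : D.IsLamanSplit t) : IsRedBlackHierarchy G T α β where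
  toIsHierarchy := hT.isHierarchy hG h
  root_rule := hT.root_children h
  leaf_rule := by
    intro x
    obtain ⟨k, v, hv, rfl⟩ := hT.surj x
    rw [hT.isOnlyChild_iff h hv, hT.isLeaf_iff hv]
  cross_edge_rule := by
    intro e he a b hab
    obtain ⟨i, rfl⟩ := (hG e).1 he
    obtain ⟨k, hk, hk'⟩ := hT.exists_level h i
    rw [hT.cross hk hk'] at hab
    have n2 := fun b => isNode_of_cut h hk b
    have n1 : ∀ b, D.IsNode t (k + 1) (D.endpt i b) := fun b => (n2 b).anti (by omega)
    have n0 : ∀ b, D.IsNode t k (D.endpt i b) := fun b => (n2 b).anti (by omega)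
    have hik : D.Level t k (D.endpt i false) (D.endpt i true) := not_not.1 hk
    have c2 : ∀ b, T.IsChild (nd (k + 2) (D.endpt i b)) (nd (k + 1) (D.endpt i b)) := fun b =>
      (hT.isChild_iff (n2 b) (n1 b)).2 ⟨rfl, Level.refl _ _⟩
    have c1 : ∀ b, T.IsChild (nd (k + 1) (D.endpt i b)) (nd k (D.endpt i false)) := fun b =>
      (hT.isChild_iff (n1 b) (n0 false)).2 ⟨rfl, by cases b; exacts [Level.refl _ _, hik]⟩
    have hne : nd (k + 1) (D.endpt i false) ≠ nd (k + 1) (D.endpt i true) := fun e =>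
      hk' ((hT.inj (n1 _) (n1 _)).1 e).2
    rcases Sym2.eq_iff.1 hab with ⟨rfl, rfl⟩ | ⟨rfl, rfl⟩
    · exact ⟨_, _, _, c2 _, c2 _, c1 _, c1 _, hne⟩
    · exact ⟨_, _, _, c2 _, c2 _, c1 _, c1 _, hne.symm⟩
  tree_rule := by
    intro x hx
    obtain ⟨k, v, hv, rfl⟩ := hT.surj x
    obtain ⟨y, hy⟩ := hx
    obtain ⟨w, hw, hvw, -⟩ := (hT.mem_grandchildren_iff hv _).1 hy
    exact ⟨hT.connected_crossGraph hG h (hw.congr hvw.symm), hT.isAcyclic_crossGraph hG h hv⟩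

end Realizes

/-- A numbering of the nodes of the first `R + 1` levels by `0, …, N - 1`, with a map `par` that
yields the parents, and with numbers `cr b i` for the two ends of the cross edge that belongs to
edge `i`. The class of `v` at level `k` has the number `nd k v`; beyond the last node above `v`,
`nd k v` repeats with period `2`. -/
structure Numbering (D : EdgeData n m) (t : Bool) (R N : ℕ) (nd : ℕ → Fin n → ℕ) (par : ℕ → ℕ)
    (cr : Bool → Fin m → ℕ) : Prop where
  root : ∀ v, nd 0 v = 0
  lt : ∀ k ≤ R, ∀ v, nd k v < N
  surj : ∀ y < N, ∃ k v, k ≤ R ∧ D.IsNode t k v ∧ nd k v = y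
  inj : ∀ k v k' w, k ≤ R → k' ≤ R → D.IsNode t k v → D.IsNode t k' w →
    (nd k v = nd k' w ↔ k = k' ∧ D.Level t k v w)
  mono : ∀ k v k' w, k < k' → k' ≤ R → D.IsNode t k' w → nd k v < nd k' w
  repeat_two : ∀ k v, k + 2 ≤ R → ¬ D.IsNode t (k + 2) v → nd (k + 2) v = nd k v
  par_root : par 0 = 0
  par_succ : ∀ k v, k + 1 ≤ R → D.IsNode t (k + 1) v → par (nd (k + 1) v) = nd k v
  cross : ∀ k i b, k + 2 ≤ R → i ∉ D.cutSet t k → i ∈ D.cutSet t (k + 1) →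
    cr b i = nd (k + 2) (D.endpt i b)

end EdgeData

/-! ### From a numbering of the classes to the hierarchy -/

namespace EdgeData

variable {n m : ℕ} {D : EdgeData n m} {t : Bool} {R N : ℕ} {nd : ℕ → Fin n → ℕ} {par : ℕ → ℕ}
  {cr : Bool → Fin m → ℕ}

namespace Numbering

/-- Add a level to a numbering: `f` yields new numbers `N, …, N' - 1` for the new nodes, and the
numbers of level `R` for the vertices without a new node. -/
theorem extend {r : ℕ} (h : D.Numbering t (r + 1) N nd par cr) (hN : 0 < N)
    {N' : ℕ} {par' : ℕ → ℕ} {cr' : Bool → Fin m → ℕ} {f : Fin n → ℕ} (hNN : N ≤ N')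
    (hnew : ∀ v, D.IsNode t (r + 2) v → N ≤ f v ∧ f v < N' ∧ par' (f v) = nd (r + 1) v)
    (hold : ∀ v, ¬ D.IsNode t (r + 2) v → f v = nd r v)
    (hinj : ∀ v w, D.IsNode t (r + 2) v → D.IsNode t (r + 2) w →
      (f v = f w ↔ D.Level t (r + 2) v w))
    (hsurj : ∀ y, N ≤ y → y < N' → ∃ v, D.IsNode t (r + 2) v ∧ f v = y)
    (hpar : ∀ y < N, par' y = par y)
    (hcr : ∀ i b, i ∉ D.cutSet t r → i ∈ D.cutSet t (r + 1) → cr' b i = f (D.endpt i b))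
    (hcr' : ∀ i b, i ∈ D.cutSet t r → cr' b i = cr b i) :
    D.Numbering t (r + 2) N' (Function.update nd (r + 2) f) par' cr' := by
  have eq : Function.update nd (r + 2) f (r + 2) = f := Function.update_self _ _ _
  have ne : ∀ k, k ≤ r + 1 → Function.update nd (r + 2) f k = nd k := fun k hk =>
    Function.update_of_ne (by omega) _ _
  have cases : ∀ k, k ≤ r + 2 → k = r + 2 ∨ k ≤ r + 1 := by omega
  constructor
  · intro v
    rw [ne 0 (by omega)]; exact h.root v
  · intro k hk v
    rcases cases k hk with rfl | hk
    · rw [eq]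
      by_cases hv : D.IsNode t (r + 2) v
      · exact (hnew v hv).2.1
      · rw [hold v hv]; exact (h.lt r (by omega) v).trans_le hNN
    · rw [ne k hk]; exact (h.lt k hk v).trans_le hNN
  · intro y hy
    by_cases hyN : y < N
    · obtain ⟨k, v, hk, hv, e⟩ := h.surj y hyN
      exact ⟨k, v, by omega, hv, by rw [ne k hk, e]⟩
    · obtain ⟨v, hv, e⟩ := hsurj y (by omega) hy
      exact ⟨r + 2, v, le_rfl, hv, by rw [eq, e]⟩
  · intro k v k' w hk hk' hv hw
    rcases cases k hk with rfl | hk <;> rcases cases k' hk' with rfl | hk'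
    · rw [eq, hinj v w hv hw]; simp
    · have := hnew v hv
      have := h.lt k' hk' w
      rw [eq, ne k' hk']
      exact iff_of_false (by omega) (fun e => by omega)
    · have := hnew w hw
      have := h.lt k hk v
      rw [eq, ne k hk]
      exact iff_of_false (by omega) (fun e => by omega)
    · rw [ne k hk, ne k' hk']; exact h.inj k v k' w hk hk' hv hw
  · intro k v k' w hkk hk' hw
    rcases cases k' hk' with rfl | hk'
    · have := hnew w hw
      have := h.lt k (by omega) v
      rw [eq, ne k (by omega)]; omega
    · rw [ne k' hk', ne k (by omega)]; exact h.mono k v k' w hkk hk' hw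
  · intro k v hk hv
    rcases cases (k + 2) hk with e | hk
    · obtain rfl : k = r := by omega
      rw [eq, ne k (by omega), hold v hv]
    · rw [ne _ hk, ne k (by omega)]; exact h.repeat_two k v hk hv
  · rw [hpar 0 hN]; exact h.par_root
  · intro k v hk hv
    rcases cases (k + 1) hk with e | hk
    · obtain rfl : k = r + 1 := by omega
      rw [eq, ne _ le_rfl]; exact (hnew v hv).2.2
    · rw [ne _ hk, ne k (by omega), hpar _ (h.lt _ hk v)]; exact h.par_succ k v hk hv
  · intro k i b hk hi hi'
    rcases cases (k + 2) hk with e | hk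
    · obtain rfl : k = r := by omega
      rw [eq]; exact hcr i b hi hi'
    · rw [ne _ hk, ← h.cross k i b hk hi hi']
      exact hcr' i b fun e => hi' (e.anti (by omega))

/-- The last node above a vertex has the larger one of the two numbers that finally alternate. -/
theorem exists_last {r : ℕ} (h : D.Numbering t (r + 1) N nd par cr)
    (hr : ∀ v w, D.Level t r v w → v = w) (v : Fin n) :
    ∃ k, D.IsNode t k v ∧ ¬ D.IsNode t (k + 1) v ∧ max (nd r v) (nd (r + 1) v) = nd k v := by
  have hlast : ¬ D.IsNode t (r + 2) v := fun e => by
    obtain ⟨w, hw, e⟩ := isNode_add_two.1 e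
    exact hw (hr v w e).symm
  obtain ⟨a, ha, ha', har⟩ : ∃ a, D.IsNode t (a + 1) v ∧ ¬ D.IsNode t (a + 2) v ∧ a ≤ r := by
    by_contra! hc
    have : ∀ a, a ≤ r + 1 → D.IsNode t (a + 1) v := fun a => by
      induction a with
      | zero => exact fun _ => Or.inl le_rfl
      | succ a ih =>
        intro ha
        by_contra e
        have := hc a (ih (by omega)) e
        omega
    exact hlast (this (r + 1) le_rfl)
  have key : ∀ d, a + d + 1 ≤ r + 1 →
      (nd (a + d) v = nd a v ∧ nd (a + d + 1) v = nd (a + 1) v) ∨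
      (nd (a + d) v = nd (a + 1) v ∧ nd (a + d + 1) v = nd a v) := by
    intro d
    induction d with
    | zero => exact fun _ => Or.inl ⟨rfl, rfl⟩
    | succ d ih =>
      intro hd
      have e : nd (a + d + 2) v = nd (a + d) v :=
        h.repeat_two _ v (by omega) fun e => ha' (e.anti (by omega))
      rcases ih (by omega) with ⟨h1, h2⟩ | ⟨h1, h2⟩
      · exact Or.inr ⟨h2, e.trans h1⟩
      · exact Or.inl ⟨h2, e.trans h1⟩
  have hlt : nd a v < nd (a + 1) v := h.mono a v (a + 1) v (by omega) (by omega) ha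
  obtain ⟨d, rfl⟩ := Nat.exists_eq_add_of_le har
  refine ⟨a + 1, ha, ha', ?_⟩
  rcases key d le_rfl with ⟨h1, h2⟩ | ⟨h1, h2⟩ <;> rw [h1, h2] <;> omega

theorem par_lt (h : D.Numbering t R N nd par cr) {y : ℕ} (hy : y < N) : par y < N := by
  obtain ⟨k, v, hk, hv, rfl⟩ := h.surj y hy
  cases k with
  | zero => rwa [h.root, h.par_root, ← h.root v]
  | succ k => rw [h.par_succ k v hk hv]; exact h.lt k (by omega) v

theorem iterate_par (h : D.Numbering t R N nd par cr) {k : ℕ} {v : Fin n} (hk : k ≤ R)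
    (hv : D.IsNode t k v) : par^[k] (nd k v) = 0 := by
  induction k with
  | zero => exact h.root v
  | succ k ih =>
    rw [Function.iterate_succ_apply, h.par_succ k v hk hv]
    exact ih (by omega) (hv.anti (by omega))

/-- A complete numbering is a red-black hierarchy. -/
theorem exists_hierarchy {r : ℕ} (h : D.Numbering t (r + 1) N nd par cr) (hS : D.IsLamanSplit t)
    (hr : ∀ v w, D.Level t r v w → v = w) {leaf : Fin n → ℕ}
    (hleaf : ∀ v, ∃ k, D.IsNode t k v ∧ ¬ D.IsNode t (k + 1) v ∧ leaf v = nd k v)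
    {G : SimpleGraph (Fin n)}
    (hG : ∀ e, e ∈ G.edgeSet ↔ ∃ i, s(D.endpt i false, D.endpt i true) = e)
    (hinj : Function.Injective fun i => s(D.endpt i false, D.endpt i true)) :
    ∃ (T : RootedTreeOn (Fin N)) (α : Fin n → Fin N) (β : Sym2 (Fin n) → Sym2 (Fin N)),
      IsRedBlackHierarchy G T α β ∧ T.root.1 = 0 ∧ (∀ y, (T.parent y).1 = par y) ∧
      (∀ v, (α v).1 = leaf v) ∧ ∀ i, ∃ a b : Fin N,
        β s(D.endpt i false, D.endpt i true) = s(a, b) ∧ a.1 = cr false i ∧ b.1 = cr true i := by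
  classical
  have hn := hS.two_le
  have hN : 0 < N := (Nat.zero_le _).trans_lt (h.lt 0 (by omega) ⟨0, by omega⟩)
  have hle : ∀ {k v}, D.IsNode t k v → k ≤ r + 1 := by
    intro k v hv
    by_contra hk
    obtain ⟨w, hw, e⟩ := isNode_add_two.1 (hv.anti (show r + 2 ≤ k by omega))
    exact hw (hr v w e).symm
  set nd' : ℕ → Fin n → Fin N := fun k v =>
    ⟨nd (min k (r + 1)) v, h.lt _ (min_le_right _ _) v⟩ with hnd'
  have nd'_eq : ∀ {k v}, k ≤ r + 1 → (nd' k v).1 = nd k v := fun {k v} hk => by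
    simp [hnd', min_eq_left hk]
  have hiter : ∀ (y : Fin N) (k : ℕ),
      ((fun y : Fin N => (⟨par y, h.par_lt y.2⟩ : Fin N))^[k] y).1 = par^[k] y.1 := by
    intro y k
    induction k generalizing y with
    | zero => rfl
    | succ k ih => rw [Function.iterate_succ_apply, Function.iterate_succ_apply, ih]
  have hcr : ∀ i b, cr b i < N := by
    intro i b
    obtain ⟨k, hk, hk'⟩ := hS.exists_cut hr i
    have := hle (Realizes.isNode_of_cut hS hk b)
    rw [h.cross k i b this hk hk']
    exact h.lt _ this _
  let T : RootedTreeOn (Fin N) :=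
    { root := ⟨0, hN⟩
      parent := fun y => ⟨par y, h.par_lt y.2⟩
      parent_root := Fin.ext h.par_root
      reaches_root := by
        intro y
        obtain ⟨k, v, hk, hv, e⟩ := h.surj y y.2
        refine ⟨k, Fin.ext ?_⟩
        rw [hiter, ← e]
        exact h.iterate_par hk hv }
  have hleaf' : ∀ v, leaf v < N := by
    intro v
    obtain ⟨k, hk, -, e⟩ := hleaf v
    rw [e]; exact h.lt k (hle hk) v
  let α : Fin n → Fin N := fun v => ⟨leaf v, hleaf' v⟩
  let β : Sym2 (Fin n) → Sym2 (Fin N) := fun e =>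
    if he : ∃ i, s(D.endpt i false, D.endpt i true) = e then
      s(⟨cr false he.choose, hcr _ _⟩, ⟨cr true he.choose, hcr _ _⟩)
    else s(⟨0, hN⟩, ⟨0, hN⟩)
  have hβ : ∀ i, β s(D.endpt i false, D.endpt i true) =
      s(⟨cr false i, hcr _ _⟩, ⟨cr true i, hcr _ _⟩) := by
    intro i
    have he : ∃ j, s(D.endpt j false, D.endpt j true) = s(D.endpt i false, D.endpt i true) :=
      ⟨i, rfl⟩
    have : he.choose = i := hinj he.choose_spec
    simp only [β, dif_pos he, this]
  have hT : D.Realizes t T nd' α β := by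
    constructor
    · intro v
      exact Fin.ext ((nd'_eq (by omega)).trans (h.root v))
    · intro y
      obtain ⟨k, v, hk, hv, e⟩ := h.surj y y.2
      exact ⟨k, v, hv, Fin.ext ((nd'_eq hk).trans e)⟩
    · intro k v k' w hv hw
      rw [Fin.ext_iff, nd'_eq (hle hv), nd'_eq (hle hw)]
      exact h.inj k v k' w (hle hv) (hle hw) hv hw
    · intro k v hv
      refine Fin.ext ?_
      change par (nd' (k + 1) v).1 = _
      rw [nd'_eq (hle hv), nd'_eq ((Nat.le_succ k).trans (hle hv))]
      exact h.par_succ k v (hle hv) hv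
    · intro v
      obtain ⟨k, h1, h2, h3⟩ := hleaf v
      exact ⟨k, h1, h2, Fin.ext (h3.trans (nd'_eq (hle h1)).symm)⟩
    · intro k i hk hk'
      have hb := fun b => Realizes.isNode_of_cut hS hk b
      have e : ∀ b, (⟨cr b i, hcr i b⟩ : Fin N) = nd' (k + 2) (D.endpt i b) := fun b =>
        Fin.ext ((h.cross k i b (hle (hb b)) hk hk').trans (nd'_eq (hle (hb b))).symm)
      rw [hβ, e, e]
    · exact ⟨r, hr⟩
  exact ⟨T, α, β, hT.isRedBlackHierarchy hG hS, rfl, fun _ => rfl, fun _ => rfl, fun i =>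
    ⟨_, _, hβ i, rfl, rfl⟩⟩

end Numbering

end EdgeData

/-! ### Tours -/

/-- The elements of the tours. Every vertex has a stub for itself (a marker) and a stub for each
incident edge (a dart), and every stub occurs in two layers, one for each colour. -/
abbrev El (n m : ℕ) := (Fin n ⊕ Fin m × Bool) × Bool

/-- The number that represents an element in the memory; its parity is the layer. -/
def enc {n m : ℕ} : El n m → ℕ
  | (.inl v, c) => v + v + c.toNat
  | (.inr (i, b), c) => n + n + (i + i + (i + i)) + (b.toNat + b.toNat) + c.toNat

theorem enc_injective {n m : ℕ} : Function.Injective (enc (n := n) (m := m)) := by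
  have tn : ∀ {a b : Bool}, a.toNat = b.toNat → a = b := by decide
  rintro ⟨v | ⟨i, b⟩, c⟩ ⟨w | ⟨j, b'⟩, c'⟩ h <;> simp only [enc] at h
  · have := Bool.toNat_lt c
    have := Bool.toNat_lt c'
    rw [Fin.ext (show v.1 = w.1 by omega), tn (show c.toNat = c'.toNat by omega)]
  · exfalso
    have := Bool.toNat_lt c
    have := v.2
    omega
  · exfalso
    have := Bool.toNat_lt c'
    have := w.2
    omega
  · have := Bool.toNat_lt c
    have := Bool.toNat_lt c'
    have := Bool.toNat_lt b
    have := Bool.toNat_lt b'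
    rw [Fin.ext (show i.1 = j.1 by omega), tn (show b.toNat = b'.toNat by omega),
      tn (show c.toNat = c'.toNat by omega)]

theorem enc_inj {n m : ℕ} {x y : El n m} : enc x = enc y ↔ x = y := enc_injective.eq_iff

/-- The reversal of a dart. -/
def rev {n m : ℕ} : El n m → El n m
  | (.inl v, c) => (.inl v, c)
  | (.inr (i, b), c) => (.inr (i, !b), c)

/-- The dart of edge `i` at its end `b` in layer `c`. -/
def dart (n : ℕ) {m : ℕ} (i : Fin m) (b c : Bool) : El n m := (.inr (i, b), c)

/-- The marker of vertex `v` in layer `c`. -/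
def marker {n : ℕ} (m : ℕ) (v : Fin n) (c : Bool) : El n m := (.inl v, c)

namespace EdgeData

variable {n m : ℕ} (D : EdgeData n m)

/-- The vertex to which an element belongs. -/
def src : El n m → Fin n
  | (.inl v, _) => v
  | (.inr (i, b), _) => D.endpt i b

/-- The vertex to which the successor of an element in a tour belongs if the edges in `K` have
been cut. Darts of edges whose colour is not that of the layer are always cut. -/
noncomputable def tgt (K : Set (Fin m)) : El n m → Fin n
  | (.inl v, _) => v
  | (.inr (i, b), c) => open Classical in
      if D.col i = c ∧ i ∉ K then D.endpt i !b else D.endpt i b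

/-- The edges of colour `c` outside `K`. -/
def alive (K : Set (Fin m)) (c : Bool) : Set (Fin m) := {i | D.col i = c ∧ i ∉ K}

/-- The cycles of `σ` are closed walks, in the forests of edges outside `K`, one for each
component in each layer. -/
structure Tour (K : Set (Fin m)) (σ : Equiv.Perm (El n m)) : Prop where
  layer : ∀ x, (σ x).2 = x.2
  src_apply : ∀ x, D.src (σ x) = D.tgt K x
  sameCycle_of_conn : ∀ x y, x.2 = y.2 → D.Conn (D.alive K x.2) (D.src x) (D.src y) →
    σ.SameCycle x y

variable {D} {K : Set (Fin m)} {σ : Equiv.Perm (El n m)} {i : Fin m}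

theorem conn_tgt (x : El n m) : D.Conn (D.alive K x.2) (D.src x) (D.tgt K x) := by
  obtain ⟨v | ⟨i, b⟩, c⟩ := x
  · exact Conn.refl _
  · simp only [tgt, src]
    split_ifs with h
    · exact Conn.edge' (A := D.alive K c) h b
    · exact Conn.refl _

theorem conn_of_sameCycle (h1 : ∀ x, (σ x).2 = x.2) (h2 : ∀ x, D.src (σ x) = D.tgt K x)
    {x y : El n m} (h : σ.SameCycle x y) :
    x.2 = y.2 ∧ D.Conn (D.alive K x.2) (D.src x) (D.src y) := by
  obtain ⟨k, -, rfl⟩ := h.exists_pow_eq'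
  clear h
  induction k with
  | zero => exact ⟨rfl, Conn.refl _⟩
  | succ k ih =>
    rw [pow_succ', Equiv.Perm.mul_apply, h1, h2]
    refine ⟨ih.1, ih.2.trans ?_⟩
    rw [ih.1]
    exact conn_tgt _

theorem Tour.sameCycle_iff (h : D.Tour K σ) (x y : El n m) :
    σ.SameCycle x y ↔ x.2 = y.2 ∧ D.Conn (D.alive K x.2) (D.src x) (D.src y) :=
  ⟨conn_of_sameCycle h.layer h.src_apply, fun g => h.sameCycle_of_conn x y g.1 g.2⟩

/-- The permutation after a change at the two darts of edge `i` in the layer of its colour: the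
same operation cuts a tour at `i` and links two tours by `i`. -/
def flip (D : EdgeData n m) (σ : Equiv.Perm (El n m)) (i : Fin m) : Equiv.Perm (El n m) :=
  σ * Equiv.swap (dart n i false (D.col i)) (dart n i true (D.col i))

theorem flip_flip (σ : Equiv.Perm (El n m)) (i : Fin m) : D.flip (D.flip σ i) i = σ := by
  simp [flip, mul_assoc]

theorem flip_layer (h : ∀ x, (σ x).2 = x.2) (x : El n m) : (D.flip σ i x).2 = x.2 := by
  rw [flip, Equiv.Perm.mul_apply, h, Equiv.swap_apply_def]
  split_ifs with h1 h2
  exacts [h1 ▸ rfl, h2 ▸ rfl, rfl]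

theorem flip_src {K' : Set (Fin m)} (h : ∀ x, D.src (σ x) = D.tgt K x)
    (hK : ∀ j, j ≠ i → (j ∈ K' ↔ j ∈ K)) (hi : i ∈ K' ↔ i ∉ K) (x : El n m) :
    D.src (D.flip σ i x) = D.tgt K' x := by
  rw [flip, Equiv.Perm.mul_apply, h, Equiv.swap_apply_def]
  by_cases h1 : x = dart n i false (D.col i)
  · rw [if_pos h1, h1]
    simp only [dart, tgt]
    by_cases g : i ∈ K <;> simp [g, hi]
  by_cases h2 : x = dart n i true (D.col i)
  · rw [if_neg h1, if_pos h2, h2]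
    simp only [dart, tgt]
    by_cases g : i ∈ K <;> simp [g, hi]
  rw [if_neg h1, if_neg h2]
  obtain ⟨v | ⟨j, b⟩, c⟩ := x
  · rfl
  · simp only [tgt]
    by_cases hj : j = i
    · subst hj
      have : D.col j ≠ c := by
        rintro rfl
        cases b
        exacts [h1 rfl, h2 rfl]
      simp [this]
    · have := hK j hj
      by_cases hjK : j ∈ K
      · simp [hjK, this.2 hjK]
      · simp [hjK, mt this.1 hjK]

theorem alive_eq_insert (hi : i ∉ K) : D.alive K (D.col i) =
    insert i (D.alive (insert i K) (D.col i)) := by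
  ext j
  by_cases hj : j = i
  · subst hj; simp [alive, hi]
  · simp [alive, hj]

theorem alive_insert_of_ne {c : Bool} (hc : D.col i ≠ c) :
    D.alive (insert i K) c = D.alive K c := by
  ext j
  by_cases hj : j = i
  · subst hj; simp [alive, hc]
  · simp [alive, hj]

theorem alive_anti {K' : Set (Fin m)} (h : K ⊆ K') (c : Bool) : D.alive K' c ⊆ D.alive K c :=
  fun _ hj => ⟨hj.1, fun e => hj.2 (h e)⟩

/-- Cutting an edge of a forest splits a tour into two tours. -/
theorem Tour.cut (h : D.Tour K σ) (hi : i ∉ K)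
    (hb : ¬ D.Conn (D.alive (insert i K) (D.col i)) (D.endpt i false) (D.endpt i true)) :
    D.Tour (insert i K) (D.flip σ i) ∧
      ¬ (D.flip σ i).SameCycle (dart n i false (D.col i)) (dart n i true (D.col i)) := by
  have hl := fun x => flip_layer (D := D) (i := i) h.layer x
  have hs : ∀ x, D.src (D.flip σ i x) = D.tgt (insert i K) x :=
    flip_src h.src_apply (fun j hj => by simp [hj]) (by simp [hi])
  have hnot : ¬ (D.flip σ i).SameCycle (dart n i false (D.col i)) (dart n i true (D.col i)) :=
    fun e => hb (conn_of_sameCycle hl hs e).2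
  refine ⟨⟨hl, hs, fun x y hxy hc => ?_⟩, hnot⟩
  have h1 : σ.SameCycle x y :=
    h.sameCycle_of_conn x y hxy (hc.mono (alive_anti (Set.subset_insert i K) _))
  have hσ : σ = D.flip σ i * Equiv.swap (dart n i false (D.col i)) (dart n i true (D.col i)) :=
    (flip_flip σ i).symm
  rw [hσ, Equiv.Perm.sameCycle_mul_swap_iff hnot] at h1
  rcases h1 with h1 | ⟨h1, h2⟩ | ⟨h1, h2⟩
  · exact h1
  all_goals
    obtain ⟨e1, c1⟩ := conn_of_sameCycle hl hs h1
    obtain ⟨e2, c2⟩ := conn_of_sameCycle hl hs h2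
    have e1 : x.2 = D.col i := e1
    have e2 : y.2 = D.col i := e2
    rw [e1] at c1 hc
    rw [e2] at c2
    exfalso; apply hb
  · exact (c1.symm.trans hc).trans c2
  · exact (c2.symm.trans hc.symm).trans c1

/-- Linking two components by an edge merges their tours. -/
theorem Tour.link (h : D.Tour (insert i K) σ) (hi : i ∉ K)
    (hb : ¬ D.Conn (D.alive (insert i K) (D.col i)) (D.endpt i false) (D.endpt i true)) :
    D.Tour K (D.flip σ i) := by
  have hl := fun x => flip_layer (D := D) (i := i) h.layer x
  have hs : ∀ x, D.src (D.flip σ i x) = D.tgt K x :=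
    flip_src h.src_apply (fun j hj => by simp [hj]) (by simp [hi])
  have hnot : ¬ σ.SameCycle (dart n i false (D.col i)) (dart n i true (D.col i)) :=
    fun e => hb (conn_of_sameCycle h.layer h.src_apply e).2
  refine ⟨hl, hs, fun x y hxy hc => ?_⟩
  rw [flip, Equiv.Perm.sameCycle_mul_swap_iff hnot]
  by_cases hx : D.col i = x.2
  · rw [← hx, alive_eq_insert hi, conn_insert_iff] at hc
    refine hc.imp ?_ (Or.imp ?_ ?_)
    · exact fun e => h.sameCycle_of_conn x y hxy (hx ▸ e)
    all_goals
      rintro ⟨e1, e2⟩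
      exact ⟨h.sameCycle_of_conn _ _ hx.symm (hx ▸ e1),
        h.sameCycle_of_conn _ _ (hxy ▸ hx.symm) (by rw [← hxy, ← hx]; exact e2)⟩
  · rw [← alive_insert_of_ne hx] at hc
    exact Or.inl (h.sameCycle_of_conn x y hxy hc)

/-- The cycles of `σ` consist of the elements in `I` with the same vertex and layer; all other
elements are fixed points. -/
def Star (D : EdgeData n m) (I : Set (El n m)) (σ : Equiv.Perm (El n m)) : Prop :=
  ∀ x y, σ.SameCycle x y ↔ x = y ∨ (x ∈ I ∧ y ∈ I ∧ x.2 = y.2 ∧ D.src x = D.src y)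

theorem star_one : D.Star {x | ∃ v c, x = marker m v c} 1 := by
  intro x y
  rw [Equiv.Perm.sameCycle_one]
  refine ⟨Or.inl, ?_⟩
  rintro (h | ⟨⟨v, c, rfl⟩, ⟨w, c', rfl⟩, h1, h2⟩)
  · exact h
  · have h1 : c = c' := h1
    have h2 : v = w := h2
    rw [h1, h2]

theorem Star.insert {I : Set (El n m)} (h : D.Star I σ) {x k : El n m} (hx : x ∉ I) (hk : k ∈ I)
    (hl : k.2 = x.2) (hs : D.src k = D.src x) :
    D.Star (insert x I) (σ * Equiv.swap k x) := by
  have hnot : ¬ σ.SameCycle k x := by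
    rw [h]
    rintro (e | e)
    exacts [hx (e ▸ hk), hx e.2.1]
  intro y z
  rw [Equiv.Perm.sameCycle_mul_swap_iff hnot, h, h, h, h, h]
  by_cases hy : y = x
  · by_cases hz : z = x
    · simp [hy, hz]
    · subst hy
      have hyk : y ≠ k := fun e => hx (e ▸ hk)
      have hzy : y ≠ z := fun e => hz e.symm
      simp only [hx, hz, hzy, hyk, hk, false_and, and_false, or_false, false_or, true_and,
        Set.mem_insert_iff]
      rw [hl, hs]
      constructor
      · rintro (rfl | ⟨a1, a2, a3⟩)
        exacts [⟨hk, hl.symm, hs.symm⟩, ⟨a1, a2.symm, a3.symm⟩]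
      · exact fun ⟨a1, a2, a3⟩ => Or.inr ⟨a1, a2.symm, a3.symm⟩
  · by_cases hz : z = x
    · subst hz
      have hzk : z ≠ k := fun e => hx (e ▸ hk)
      simp only [hx, hy, hzk, hk, false_and, and_false, or_false, false_or, true_and,
        Set.mem_insert_iff, and_true]
      rw [hl, hs]
      constructor
      · rintro (rfl | ⟨a1, a2, a3⟩)
        exacts [⟨hk, hl, hs⟩, ⟨a1, a2, a3⟩]
      · exact fun ⟨a1, a2, a3⟩ => Or.inr ⟨a1, a2, a3⟩
    · simp only [hx, hy, hz, false_and, and_false, or_false, false_or, Set.mem_insert_iff]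

theorem Star.tour (h : D.Star Set.univ σ) : D.Tour Set.univ σ := by
  have key : ∀ x, (σ x).2 = x.2 ∧ D.src (σ x) = D.src x := by
    intro x
    rcases (h x (σ x)).1 ⟨1, by simp⟩ with e | ⟨-, -, e1, e2⟩
    · rw [← e]; exact ⟨rfl, rfl⟩
    · exact ⟨e1.symm, e2.symm⟩
  have ht : ∀ x, D.tgt Set.univ x = D.src x := by
    rintro ⟨v | ⟨i, b⟩, c⟩ <;> simp [tgt, src]
  refine ⟨fun x => (key x).1, fun x => by rw [ht]; exact (key x).2, fun x y hxy hc => ?_⟩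
  rw [h]
  refine Or.inr ⟨trivial, trivial, hxy, ?_⟩
  exact hc.lift (r := Eq) eq_equivalence (fun i hi => absurd trivial hi.2)

end EdgeData

/-! ### The memory layout -/

infixl:65 " +ₑ " => RAM.Expr.bin RAM.BinOp.add
infixl:65 " -ₑ " => RAM.Expr.bin RAM.BinOp.sub
infixl:70 " *ₑ " => RAM.Expr.bin RAM.BinOp.mul
infix:50 " <ₑ " => RAM.Expr.bin RAM.BinOp.lt
infix:50 " =ₑ " => RAM.Expr.bin RAM.BinOp.eq
infixr:30 " ;; " => RAM.Program.seq

-- The variables (`v…`) and arrays (`a…`) of the program. The variables `0`, `2`, `3` and the arrays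
-- `0`, …, `6` are those of the input and the output; variable `3`, the root, always is `0`.
notation "vCount" => (0 : ℕ)
notation "vNodes" => (2 : ℕ)
notation "vEdges" => (4 : ℕ)
notation "vSize" => (5 : ℕ)
notation "vX" => (6 : ℕ)
notation "vI" => (7 : ℕ)
notation "vD" => (8 : ℕ)
notation "vA" => (9 : ℕ)
notation "vB" => (10 : ℕ)
notation "vTmp" => (11 : ℕ)
notation "vSum" => (12 : ℕ)
notation "vOther" => (14 : ℕ)
notation "vLabel" => (15 : ℕ)
notation "vZ" => (16 : ℕ)
notation "vDone" => (17 : ℕ)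
notation "vQueued" => (18 : ℕ)
notation "vStop" => (19 : ℕ)
notation "vOld" => (20 : ℕ)
notation "vJ" => (21 : ℕ)
notation "vGo" => (22 : ℕ)
notation "vC" => (23 : ℕ)
notation "vP" => (24 : ℕ)
notation "vQ" => (25 : ℕ)
notation "aTail" => (0 : ℕ)
notation "aHead" => (1 : ℕ)
notation "aColour" => (2 : ℕ)
notation "aParent" => (3 : ℕ)
notation "aLeaf" => (4 : ℕ)
notation "aCrossTail" => (5 : ℕ)
notation "aCrossHead" => (6 : ℕ)
notation "aNext" => (7 : ℕ)
notation "aRev" => (8 : ℕ)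
notation "aEdge" => (9 : ℕ)
notation "aLabel" => (10 : ℕ)
notation "aNode" => (11 : ℕ)
notation "aQueued" => (12 : ℕ)
notation "aQueue" => (13 : ℕ)

namespace RAM

open RAM.Expr RAM.Program Equiv

/-- The words are large enough for all numbers that occur: there are `2 * n + 4 * m ≤ 10 * n`
elements, `O(n)` labels and `O(n)` nodes. -/
structure Room (n m W : ℕ) : Prop where
  two_le : 2 ≤ n
  count : m + 3 = 2 * n
  le : 100 * n ≤ W

theorem Room.one_lt {n m W : ℕ} (h : Room n m W) : 1 < W := by
  have := h.two_le
  have := h.le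
  omega

variable {n m W : ℕ} {D : EdgeData n m}

/-- The part of the memory that does not change any more after the initialization. -/
structure Wired (D : EdgeData n m) (s : State) : Prop where
  count : s.var vCount = n
  edges : s.var vEdges = m
  colour : ∀ i : Fin m, s.arr aColour i = (D.col i).toNat
  rev : ∀ x : El n m, s.arr aRev (enc x) = enc (rev x)
  edge : ∀ (i : Fin m) b c, s.arr aEdge (enc (dart n i b c)) = i

/-- The array `aNext` represents the permutation `σ`. -/
def NextIs (s : State) (σ : Perm (El n m)) : Prop := ∀ x, s.arr aNext (enc x) = enc (σ x)

/-- The array `aLabel` represents the function `lab`. -/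
def LabelIs (s : State) (lab : El n m → ℕ) : Prop := ∀ x, s.arr aLabel (enc x) = lab x

/-- The queue contains the edges `q`, which are marked in the array `aQueued`. -/
structure QueueIs (s : State) (q : List (Fin m)) : Prop where
  length : s.var vQueued = q.length
  get : ∀ j (h : j < q.length), s.arr aQueue j = q[j]
  mark : ∀ i : Fin m, s.arr aQueued i = if i ∈ q then 1 else 0
  nodup : q.Nodup

theorem QueueIs.length_le {s : State} {q : List (Fin m)} (h : QueueIs s q) : q.length ≤ m := by
  simpa using h.nodup.length_le_card

theorem Wired.of_runs {p : Program} {s s' : State} {t : ℕ} (h : Wired D s)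
    (hr : Runs W p s t s')
    (hp : vCount ∉ p.wvars ∧ vEdges ∉ p.wvars ∧ aColour ∉ p.warrs ∧ aRev ∉ p.warrs ∧
      aEdge ∉ p.warrs) : Wired D s' := by
  refine ⟨?_, ?_, ?_, ?_, ?_⟩
  · rw [hr.var_eq _ hp.1]; exact h.count
  · rw [hr.var_eq _ hp.2.1]; exact h.edges
  · rw [hr.arr_eq _ hp.2.2.1]; exact h.colour
  · rw [hr.arr_eq _ hp.2.2.2.1]; exact h.rev
  · rw [hr.arr_eq _ hp.2.2.2.2]; exact h.edge

theorem NextIs.of_runs {p : Program} {s s' : State} {t : ℕ} {σ : Perm (El n m)} (h : NextIs s σ)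
    (hr : Runs W p s t s') (hp : aNext ∉ p.warrs) : NextIs s' σ := by
  intro x; rw [hr.arr_eq _ hp]; exact h x

theorem LabelIs.of_runs {p : Program} {s s' : State} {t : ℕ} {lab : El n m → ℕ}
    (h : LabelIs s lab) (hr : Runs W p s t s') (hp : aLabel ∉ p.warrs) : LabelIs s' lab := by
  intro x; rw [hr.arr_eq _ hp]; exact h x

theorem QueueIs.of_runs {p : Program} {s s' : State} {t : ℕ} {q : List (Fin m)}
    (h : QueueIs s q) (hr : Runs W p s t s')
    (hp : vQueued ∉ p.wvars ∧ aQueue ∉ p.warrs ∧ aQueued ∉ p.warrs) : QueueIs s' q := by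
  refine ⟨?_, ?_, ?_, h.nodup⟩
  · rw [hr.var_eq _ hp.1]; exact h.length
  · rw [hr.arr_eq _ hp.2.1]; exact h.get
  · rw [hr.arr_eq _ hp.2.2]; exact h.mark

/-! ### Elementary operations on tours -/

/-- Exchange the successors of the elements `vA` and `vB`. -/
def swapNext : Program :=
  assign vTmp (load aNext (var vA)) ;; store aNext (var vA) (load aNext (var vB)) ;;
    store aNext (var vB) (var vTmp)

theorem swapNext_spec (hW : 1 < W) {s : State} (hs : s.Bdd W) {σ : Perm (El n m)}
    (hσ : NextIs s σ) {a b : El n m} (ha : s.var vA = enc a) (hb : s.var vB = enc b) :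
    ∃ t s', Runs W swapNext s t s' ∧ t ≤ 20 ∧ NextIs s' (σ * swap a b) := by
  obtain ⟨t, hr, ht⟩ := Program.Safe.runs (p := swapNext) hW hs
    (by simp [swapNext, Program.Safe, Expr.Ok])
  refine ⟨t, _, hr, ht.trans (by decide), fun x => ?_⟩
  simp only [swapNext, run, eval, State.setArr_arr, State.setVar_arr, State.setVar_var,
    State.setArr_var, Perm.mul_apply, Equiv.swap_apply_def]
  simp [ha, hb, Function.update_apply, enc_inj, hσ a, hσ b, hσ x]
  split_ifs <;> simp_all

/-- Walk along the cycle of the element `vZ` and apply `body` to every element `vX`. -/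
def walk (body : Program) : Program :=
  assign vX (var vZ) ;; assign vGo (const 1) ;;
    loop (var vGo) (body ;; assign vX (load aNext (var vX)) ;;
      assign vGo (const 1 -ₑ (var vX =ₑ var vZ)))

theorem walk_spec (hW : 1 < W) {body : Program} {s₀ : State} (hs₀ : s₀.Bdd W)
    (hbv : vX ∉ body.wvars ∧ vGo ∉ body.wvars ∧ vZ ∉ body.wvars ∧ aNext ∉ body.warrs)
    {σ : Perm (El n m)} (hσ : NextIs s₀ σ) {z : El n m} (hz : s₀.var vZ = enc z)
    (I : ℕ → State → Prop) (T : ℕ)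
    (hI : ∀ j s s', s'.arr = s.arr → (∀ x, x ≠ vX → x ≠ vGo → s'.var x = s.var x) →
      I j s → I j s') (h₀ : I 0 s₀)
    (step : ∀ j s, s.Bdd W → (∀ x, x ≠ vX → x ≠ vGo → x ∉ body.wvars → s.var x = s₀.var x) →
      (∀ a, a ∉ body.warrs → s.arr a = s₀.arr a) → I j s → s.var vX = enc ((σ ^ j) z) →
      ∃ t s', Runs W body s t s' ∧ t ≤ T ∧ I (j + 1) s') :
    ∃ t s', Runs W (walk body) s₀ t s' ∧ t ≤ (T + 20) * (cyc σ z).card + 20 ∧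
      ∃ J, 0 < J ∧ (σ ^ J) z = z ∧ I J s' := by
  obtain ⟨t1, hr1, ht1⟩ := Program.Safe.runs (p := assign vX (var vZ)) hW hs₀
    (by simp [Program.Safe, Expr.Ok])
  obtain ⟨t2, hr2, ht2⟩ := Program.Safe.runs (p := assign vGo (const 1)) hW (hr1.bdd hs₀)
    (by simpa [Program.Safe, Expr.Ok] using hW)
  set s₁ := (assign vX (var vZ)).run s₀ with hs₁
  set s₂ := (assign vGo (const 1)).run s₁ with hs₂
  have harr : s₂.arr = s₀.arr := rfl
  have hvar : ∀ x, x ≠ vX → x ≠ vGo → s₂.var x = s₀.var x := fun x h1 h2 => by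
    simp [hs₂, hs₁, run, h1, h2]
  have hnotin : ∀ x, x ≠ vX → x ≠ vGo → x ∉ body.wvars →
      x ∉ (body ;; assign vX (load aNext (var vX)) ;;
        assign vGo (const 1 -ₑ (var vX =ₑ var vZ))).wvars := fun x h1 h2 h3 => by
    simp [wvars, h1, h2, h3]
  have hnotin' : ∀ a, a ∉ body.warrs →
      a ∉ (body ;; assign vX (load aNext (var vX)) ;;
        assign vGo (const 1 -ₑ (var vX =ₑ var vZ))).warrs := fun a h1 => by
    simp [warrs, h1]
  obtain ⟨t3, s₃, k, hr3, ⟨hk1, hk2, hk3, hk4⟩, hb, ht3⟩ := runs_loop hW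
    (hr2.bdd (hr1.bdd hs₀)) (b := var vGo)
    (p := body ;; assign vX (load aNext (var vX)) ;;
      assign vGo (const 1 -ₑ (var vX =ₑ var vZ)))
    (I := fun j s => I j s ∧ (∀ i, 0 < i → i < j → (σ ^ i) z ≠ z) ∧
      s.var vX = enc ((σ ^ j) z) ∧ s.var vGo = if 0 < j ∧ (σ ^ j) z = z then 0 else 1)
    (Φ := fun j => (T + 20) * ((cyc σ z).card - j)) (k₀ := 0)
    ⟨hI 0 s₀ s₂ harr hvar h₀, by omega, by simp [hs₂, hs₁, run, eval, hz],
      by simp [hs₂, run, eval]⟩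
    (fun s k _ _ => by simp [Expr.Ok])
    (by
      rintro s j hs hv ha ⟨h1, h2, h3, h4⟩ hgo
      have hret : ¬ (0 < j ∧ (σ ^ j) z = z) := by
        intro e
        rw [if_pos e] at h4
        exact hgo h4
      have h2' : ∀ i, 0 < i → i < j + 1 → (σ ^ i) z ≠ z := by
        intro i hi hij
        rcases Nat.lt_succ_iff_lt_or_eq.1 hij with e | e
        · exact h2 i hi e
        · exact fun g => hret ⟨e ▸ hi, e ▸ g⟩
      have hle := le_card_cyc h2'
      obtain ⟨t, s', hr, ht, hI'⟩ := step j s hs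
        (fun x e1 e2 e3 => (hv x (hnotin x e1 e2 e3)).trans (hvar x e1 e2))
        (fun a e => (ha a (hnotin' a e)).trans (by rw [harr])) h1 h3
      have hXZ : s'.var vX = enc ((σ ^ j) z) := (hr.var_eq _ hbv.1).trans h3
      have hZ : s'.var vZ = enc z := by
        rw [hr.var_eq _ hbv.2.2.1, hv _ (hnotin _ (by decide) (by decide) hbv.2.2.1),
          hvar _ (by decide) (by decide), hz]
      have hN : s'.arr aNext (enc ((σ ^ j) z)) = enc ((σ ^ (j + 1)) z) := by
        rw [hr.arr_eq _ hbv.2.2.2, ha _ (hnotin' _ hbv.2.2.2), harr, hσ, pow_succ', Perm.mul_apply]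
      obtain ⟨t', hr', ht'⟩ := Program.Safe.runs (p := assign vX (load aNext (var vX)) ;;
        assign vGo (const 1 -ₑ (var vX =ₑ var vZ))) hW (hr.bdd hs)
        (by simpa [Program.Safe, Expr.Ok] using hW)
      refine ⟨_, _, j + 1, .seq hr hr', ⟨?_, h2', ?_, ?_⟩, ?_⟩
      · refine hI _ s' _ rfl (fun x e1 e2 => ?_) hI'
        simp [run, e1, e2]
      · simp [run, eval, hXZ, hN]
      · simp only [run, eval, State.setVar_var, hXZ, hN, hZ, BinOp.eval]
        by_cases e : (σ ^ (j + 1)) z = z <;> simp [e, enc_inj]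
      · have : (assign vX (load aNext (var vX)) ;;
          assign vGo (const 1 -ₑ (var vX =ₑ var vZ))).time = 9 := by decide
        have hc : (var vGo).cost = 1 := rfl
        rw [this] at ht'
        rw [hc]
        obtain ⟨e, he⟩ : ∃ e, (cyc σ z).card - j = e + 1 := ⟨(cyc σ z).card - j - 1, by omega⟩
        have he' : (cyc σ z).card - (j + 1) = e := by omega
        simp only [he, he']
        rw [Nat.mul_succ]
        omega)
  have hk : 0 < k ∧ (σ ^ k) z = z := by
    by_contra e
    rw [if_neg e] at hk4
    simp [eval, hk4] at hb
  refine ⟨_, s₃, .seq hr1 (.seq hr2 hr3), ?_, k, hk.1, hk.2, hk1⟩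
  have e1 : (assign vX (var vZ)).time = 2 := rfl
  have e2 : (assign vGo (const 1)).time = 2 := rfl
  have e3 : (var vGo).cost = 1 := rfl
  simp only [Nat.sub_zero] at ht3
  omega

/-- Give the label `vLabel` to all elements of the cycle of the element `vZ`. -/
def relabel : Program := walk (store aLabel (var vX) (var vLabel))

theorem relabel_spec (hW : 1 < W) {s : State} (hs : s.Bdd W) {σ : Perm (El n m)}
    (hσ : NextIs s σ) {z : El n m} (hz : s.var vZ = enc z) {lab : El n m → ℕ}
    (hlab : LabelIs s lab) [DecidablePred (σ.SameCycle z)] :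
    ∃ t s', Runs W relabel s t s' ∧ t ≤ 30 * (cyc σ z).card + 20 ∧
      LabelIs s' fun x => if σ.SameCycle z x then s.var vLabel else lab x := by
  classical
  obtain ⟨t, s', hr, ht, J, hJ, hJz, hI⟩ := walk_spec hW
    (body := store aLabel (var vX) (var vLabel)) hs (by decide) hσ hz
    (I := fun j s' => LabelIs s' fun x : El n m =>
      if ∃ i, i < j ∧ (σ ^ i) z = x then s.var vLabel else lab x) (T := 5)
    (fun j s s' h _ h1 x => by rw [h]; exact h1 x)
    (fun x => by simpa using hlab x)
    (by
      intro j s' hs' hv ha hI hX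
      obtain ⟨t, hr, ht⟩ := Program.Safe.runs (p := store aLabel (var vX) (var vLabel)) hW hs'
        (by simp [Program.Safe, Expr.Ok])
      refine ⟨t, _, hr, ht.trans (by decide), fun x => ?_⟩
      have hl : s'.var vLabel = s.var vLabel := hv _ (by decide) (by decide) (by decide)
      simp only [run, eval, State.setArr_arr, if_true, hX, hl, Function.update_apply, enc_inj]
      by_cases hx : x = (σ ^ j) z
      · rw [if_pos hx, if_pos ⟨j, by omega, hx.symm⟩]
      · rw [if_neg hx, hI x]
        refine if_congr ⟨?_, ?_⟩ rfl rfl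
        · rintro ⟨i, hi, e⟩; exact ⟨i, by omega, e⟩
        · rintro ⟨i, hi, e⟩
          rcases Nat.lt_succ_iff_lt_or_eq.1 hi with g | g
          · exact ⟨i, g, e⟩
          · exact absurd (g ▸ e.symm) hx)
  refine ⟨t, s', hr, ht.trans (by omega), fun x => ?_⟩
  rw [hI x]
  refine if_congr ⟨?_, fun h => exists_lt_of_sameCycle hJ hJz h⟩ rfl rfl
  rintro ⟨i, -, rfl⟩
  exact ⟨i, by simp⟩

/-- Append the edge of the element `vX` to the queue if its two darts in the layer of `vX` have
different labels and it has not been in the queue before. -/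
def enqueue : Program :=
  ite (load aLabel (var vX) =ₑ load aLabel (load aRev (var vX))) skip
    (ite (load aQueued (load aEdge (var vX))) skip
      (store aQueued (load aEdge (var vX)) (const 1) ;;
        store aQueue (var vQueued) (load aEdge (var vX)) ;;
        assign vQueued (var vQueued +ₑ const 1)))

theorem enqueue_spec (hW : Room n m W) {s : State} (hs : s.Bdd W) (hD : Wired D s)
    {x : El n m} (hx : s.var vX = enc x) {lab : El n m → ℕ} (hlab : LabelIs s lab)
    {q : List (Fin m)} (hq : QueueIs s q) :
    ∃ t s' q', Runs W enqueue s t s' ∧ t ≤ 40 ∧ QueueIs s' q' ∧ q <+: q' ∧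
      ∀ i, i ∈ q' ↔ i ∈ q ∨ ∃ b c, x = dart n i b c ∧
        lab (dart n i false c) ≠ lab (dart n i true c) := by
  have h2 := hW.two_le
  have hm := hW.count
  have hWn := hW.le
  have hql := hq.length_le
  have hlen := hq.length
  obtain ⟨t, hr, ht⟩ := Program.Safe.runs (p := enqueue) hW.one_lt hs
    (by simp [enqueue, Program.Safe, Expr.Ok, run, eval, hlen]; intros; omega)
  have ht : t ≤ 40 := ht.trans (by decide)
  have e1 : (load aLabel (var vX) =ₑ load aLabel (load aRev (var vX))).eval s =
      if lab x = lab (rev x) then 1 else 0 := by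
    simp [eval, BinOp.eval, hx, hD.rev x, hlab x, hlab (rev x)]
  -- the two cases in which nothing is appended
  have trivial_case : enqueue.run s = s → (∀ i b c, x = dart n i b c →
      lab (dart n i false c) ≠ lab (dart n i true c) → i ∈ q) →
      ∃ t s' q', Runs W enqueue s t s' ∧ t ≤ 40 ∧ QueueIs s' q' ∧ q <+: q' ∧
      ∀ i, i ∈ q' ↔ i ∈ q ∨ ∃ b c, x = dart n i b c ∧
        lab (dart n i false c) ≠ lab (dart n i true c) := fun h1 h2 =>
    ⟨t, s, q, by rwa [h1] at hr, ht, hq, List.prefix_rfl, fun i => ⟨Or.inl, fun h =>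
      h.elim id fun ⟨b, c, g1, g2⟩ => h2 i b c g1 g2⟩⟩
  by_cases hl : lab x = lab (rev x)
  · apply trivial_case
    · rw [enqueue, run, e1, if_pos hl]; rfl
    · rintro i b c rfl h
      cases b
      exacts [absurd hl h, absurd hl.symm h]
  · obtain ⟨i, b, c, rfl⟩ : ∃ i b c, x = dart n i b c := by
      obtain ⟨v | ⟨i, b⟩, c⟩ := x
      · exact absurd rfl hl
      · exact ⟨i, b, c, rfl⟩
    have e2 : (load aQueued (load aEdge (var vX))).eval s = if i ∈ q then 1 else 0 := by
      simp [eval, hx, hD.edge, hq.mark]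
    have hl' : lab (dart n i false c) ≠ lab (dart n i true c) := by
      cases b
      exacts [hl, fun e => hl e.symm]
    have huniq : ∀ j b' c', dart n i b c = dart n j b' c' → j = i := by
      rintro j b' c' h
      simp only [dart, Prod.mk.injEq, Sum.inr.injEq] at h
      exact h.1.1.symm
    by_cases hi : i ∈ q
    · apply trivial_case
      · rw [enqueue, run, e1, if_neg hl, if_pos rfl, run, e2, if_pos hi]; rfl
      · intro j b' c' h _
        rw [huniq j b' c' h]; exact hi
    · refine ⟨t, _, q ++ [i], hr, ht, ?_, List.prefix_append _ _, fun j => ?_⟩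
      · have hrun : enqueue.run s = ((s.setArr aQueued i 1).setArr aQueue q.length i).setVar
            vQueued (q.length + 1) := by
          rw [enqueue, run, e1, if_neg hl, if_pos rfl, run, e2, if_neg hi, if_pos rfl]
          simp [run, eval, BinOp.eval, hx, hD.edge, hlen]
        rw [hrun]
        refine ⟨by simp, fun j hj => ?_, fun j => ?_, ?_⟩
        · simp only [State.setVar_arr, State.setArr_arr, if_true, Function.update_apply]
          by_cases e : j = q.length
          · subst e; simp
          · have : j < q.length := by simp at hj; omega
            rw [List.getElem_append_left this]
            simp [e, hq.get j this]
        · simp only [State.setVar_arr, State.setArr_arr]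
          by_cases e : j = i
          · simp [e]
          · simp [e, hq.mark, Fin.val_inj]
        · rw [List.nodup_append]
          exact ⟨hq.nodup, by simp, fun a ha c hc e => hi (by
            rw [List.mem_singleton] at hc; rwa [← hc, ← e])⟩
      · rw [List.mem_append, List.mem_singleton]
        refine or_congr_right ⟨?_, ?_⟩
        · rintro rfl; exact ⟨b, c, rfl, hl'⟩
        · rintro ⟨b', c', h, -⟩; exact huniq j b' c' h

/-- Append to the queue all edges that are found at the elements of the cycle of `vZ`. -/
def scan : Program := walk enqueue

theorem scan_spec (hW : Room n m W) {s : State} (hs : s.Bdd W) (hD : Wired D s)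
    {σ : Perm (El n m)} (hσ : NextIs s σ) {z : El n m} (hz : s.var vZ = enc z)
    {lab : El n m → ℕ} (hlab : LabelIs s lab) {q : List (Fin m)} (hq : QueueIs s q) :
    ∃ t s' q', Runs W scan s t s' ∧ t ≤ 60 * (cyc σ z).card + 20 ∧ QueueIs s' q' ∧ q <+: q' ∧
      ∀ i, i ∈ q' ↔ i ∈ q ∨ ∃ b c, σ.SameCycle z (dart n i b c) ∧
        lab (dart n i false c) ≠ lab (dart n i true c) := by
  obtain ⟨t, s', hr, ht, J, hJ, hJz, q', hq', hp, hI⟩ := walk_spec hW.one_lt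
    (body := enqueue) hs (by decide) hσ hz
    (I := fun j s' => ∃ q', QueueIs s' q' ∧ q <+: q' ∧ ∀ i, i ∈ q' ↔ i ∈ q ∨
      ∃ l, l < j ∧ ∃ b c, (σ ^ l) z = dart n i b c ∧
        lab (dart n i false c) ≠ lab (dart n i true c)) (T := 40)
    (by
      rintro j s s' h1 h2 ⟨q', h3, h4⟩
      refine ⟨q', ⟨?_, ?_, ?_, h3.nodup⟩, h4⟩
      · rw [h2 _ (by decide) (by decide)]; exact h3.length
      · rw [h1]; exact h3.get
      · rw [h1]; exact h3.mark)
    ⟨q, hq, List.prefix_rfl, fun i => by simp⟩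
    (by
      rintro j s' hs' hv ha ⟨q', hq', hp, hI⟩ hX
      have hD' : Wired D s' := by
        refine ⟨?_, ?_, ?_, ?_, ?_⟩
        · rw [hv _ (by decide) (by decide) (by decide)]; exact hD.count
        · rw [hv _ (by decide) (by decide) (by decide)]; exact hD.edges
        · rw [ha _ (by decide)]; exact hD.colour
        · rw [ha _ (by decide)]; exact hD.rev
        · rw [ha _ (by decide)]; exact hD.edge
      have hlab' : LabelIs s' lab := fun x => by rw [ha _ (by decide)]; exact hlab x
      obtain ⟨t, s'', q'', hr, ht, hq'', hp', hI'⟩ := enqueue_spec hW hs' hD' hX hlab' hq'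
      refine ⟨t, s'', hr, ht, q'', hq'', hp.trans hp', fun i => ?_⟩
      rw [hI', hI, or_assoc]
      refine or_congr_right ⟨?_, ?_⟩
      · rintro (⟨l, hl, h⟩ | h)
        exacts [⟨l, by omega, h⟩, ⟨j, by omega, h⟩]
      · rintro ⟨l, hl, h⟩
        rcases Nat.lt_succ_iff_lt_or_eq.1 hl with g | g
        · exact Or.inl ⟨l, g, h⟩
        · exact Or.inr (g ▸ h))
  refine ⟨t, s', q', hr, ht.trans (by omega), hq', hp, fun i => ?_⟩
  rw [hI]
  refine or_congr_right ⟨?_, ?_⟩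
  · rintro ⟨l, -, b, c, h1, h2⟩
    exact ⟨b, c, ⟨l, by simpa using h1⟩, h2⟩
  · rintro ⟨b, c, h1, h2⟩
    obtain ⟨l, hl, h⟩ := exists_lt_of_sameCycle hJ hJz h1
    exact ⟨l, hl, b, c, h, h2⟩

/-- Walk in parallel along the cycles of the elements `vA` and `vB` until one of the walks is
complete, and assign the starting point of this walk to `vZ`. -/
def findSmaller : Program :=
  assign vP (load aNext (var vA)) ;; assign vQ (load aNext (var vB)) ;;
    loop ((const 1 -ₑ (var vP =ₑ var vA)) *ₑ (const 1 -ₑ (var vQ =ₑ var vB)))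
      (assign vP (load aNext (var vP)) ;; assign vQ (load aNext (var vQ))) ;;
    ite (var vP =ₑ var vA) (assign vZ (var vA)) (assign vZ (var vB))

theorem findSmaller_spec (hW : 1 < W) {s : State} (hs : s.Bdd W) {σ : Perm (El n m)}
    (hσ : NextIs s σ) {a b : El n m} (ha : s.var vA = enc a) (hb : s.var vB = enc b) :
    ∃ t s' z, Runs W findSmaller s t s' ∧ s'.var vZ = enc z ∧
      (z = a ∧ (cyc σ a).card ≤ (cyc σ b).card ∨ z = b ∧ (cyc σ b).card ≤ (cyc σ a).card) ∧
      t ≤ 30 * (cyc σ z).card + 30 := by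
  set b₀ := (const 1 -ₑ (var vP =ₑ var vA)) *ₑ (const 1 -ₑ (var vQ =ₑ var vB)) with hb₀
  set p₀ := (assign vP (load aNext (var vP)) ;; assign vQ (load aNext (var vQ))) with hp₀
  obtain ⟨t1, hr1, ht1⟩ := Program.Safe.runs (p := assign vP (load aNext (var vA))) hW hs
    (by simp [Program.Safe, Expr.Ok])
  obtain ⟨t2, hr2, ht2⟩ := Program.Safe.runs (p := assign vQ (load aNext (var vB))) hW
    (hr1.bdd hs) (by simp [Program.Safe, Expr.Ok])
  set s₁ := (assign vP (load aNext (var vA))).run s with hs₁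
  set s₂ := (assign vQ (load aNext (var vB))).run s₁ with hs₂
  have hA2 : s₂.var vA = enc a := by simp [hs₂, hs₁, run, ha]
  have hB2 : s₂.var vB = enc b := by simp [hs₂, hs₁, run, hb]
  have hP2 : s₂.var vP = enc (σ a) := by simp [hs₂, hs₁, run, eval, ha, hσ a]
  have hQ2 : s₂.var vQ = enc (σ b) := by simp [hs₂, hs₁, run, eval, hb, hσ b]
  have hσ2 : NextIs s₂ σ := hσ
  have hb₀e : ∀ s k, s.var vA = enc a → s.var vB = enc b → s.var vP = enc ((σ ^ k) a) →
      s.var vQ = enc ((σ ^ k) b) →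
      b₀.eval s = if (σ ^ k) a = a ∨ (σ ^ k) b = b then 0 else 1 := by
    intro s k h1 h2 h3 h4
    simp only [hb₀, eval, BinOp.eval, h1, h2, h3, h4, enc_inj]
    by_cases e1 : (σ ^ k) a = a <;> by_cases e2 : (σ ^ k) b = b <;> simp [e1, e2]
  obtain ⟨t3, s₃, k, hr3, ⟨hk1, hk2, hk3, hk4, hk5, hk6, hk7⟩, hbf, ht3⟩ := runs_loop hW
    (hr2.bdd (hr1.bdd hs)) (b := b₀) (p := p₀)
    (I := fun k s => (∀ i, 0 < i → i < k + 1 → (σ ^ i) a ≠ a) ∧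
      (∀ i, 0 < i → i < k + 1 → (σ ^ i) b ≠ b) ∧ s.var vP = enc ((σ ^ (k + 1)) a) ∧
      s.var vQ = enc ((σ ^ (k + 1)) b) ∧ s.var vA = enc a ∧ s.var vB = enc b ∧ NextIs s σ)
    (Φ := fun k => 20 * ((cyc σ a).card - k)) (k₀ := 0)
    ⟨by omega, by omega, by simpa using hP2, by simpa using hQ2, hA2, hB2, hσ2⟩
    (by
      rintro s k hs ⟨h1, h2, h3, h4, h5, h6, h7⟩
      simp only [hb₀, Expr.Ok, and_true]
      refine ⟨hW, hW, ?_⟩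
      simp only [eval, BinOp.eval]
      refine lt_of_le_of_lt (Nat.mul_le_mul (Nat.sub_le 1 _) (Nat.sub_le 1 _)) (by simpa using hW))
    (by
      rintro s k hs hv _ ⟨h1, h2, h3, h4, h5, h6, h7⟩ hne
      rw [hb₀e s (k + 1) h5 h6 h3 h4] at hne
      have hne' : ¬ ((σ ^ (k + 1)) a = a ∨ (σ ^ (k + 1)) b = b) := fun e => by simp [e] at hne
      rw [not_or] at hne'
      have g1 : ∀ i, 0 < i → i < k + 1 + 1 → (σ ^ i) a ≠ a := by
        intro i hi hik
        rcases Nat.lt_succ_iff_lt_or_eq.1 hik with e | rfl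
        exacts [h1 i hi e, hne'.1]
      have g2 : ∀ i, 0 < i → i < k + 1 + 1 → (σ ^ i) b ≠ b := by
        intro i hi hik
        rcases Nat.lt_succ_iff_lt_or_eq.1 hik with e | rfl
        exacts [h2 i hi e, hne'.2]
      have hle := le_card_cyc g1
      obtain ⟨t, hr, ht⟩ := Program.Safe.runs (p := p₀) hW hs
        (by simp [hp₀, Program.Safe, Expr.Ok])
      have hN : ∀ x, s.arr aNext (enc x) = enc (σ x) := h7
      refine ⟨t, _, k + 1, hr, ⟨g1, g2, ?_, ?_, ?_, ?_, h7.of_runs hr (by decide)⟩, ?_⟩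
      · simp [hp₀, run, eval, h3, hN, pow_succ' σ (k + 1)]
      · simp [hp₀, run, eval, h4, hN, pow_succ' σ (k + 1)]
      · rw [hr.var_eq _ (by decide)]; exact h5
      · rw [hr.var_eq _ (by decide)]; exact h6
      · have e1 : p₀.time = 6 := rfl
        have e2 : b₀.cost = 11 := rfl
        rw [e1] at ht
        rw [e2]
        omega)
  have hlea := le_card_cyc hk1
  have hleb := le_card_cyc hk2
  obtain ⟨t4, hr4, ht4⟩ := Program.Safe.runs (p := ite (var vP =ₑ var vA)
    (assign vZ (var vA)) (assign vZ (var vB))) hW (hr3.bdd (hr2.bdd (hr1.bdd hs)))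
    (by simp [Program.Safe, Expr.Ok])
  have hbk : (σ ^ (k + 1)) a = a ∨ (σ ^ (k + 1)) b = b := by
    rw [hb₀e s₃ (k + 1) hk5 hk6 hk3 hk4] at hbf
    by_contra e
    simp [e] at hbf
  have e1 : (assign vP (load aNext (var vA))).time = 3 := rfl
  have e2 : (assign vQ (load aNext (var vB))).time = 3 := rfl
  have e3 : b₀.cost = 11 := rfl
  have e4 : (ite (var vP =ₑ var vA) (assign vZ (var vA)) (assign vZ (var vB))).time = 8 := rfl
  rw [e1] at ht1
  rw [e2] at ht2
  rw [e3] at ht3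
  rw [e4] at ht4
  by_cases hak : (σ ^ (k + 1)) a = a
  · have hc := card_cyc_eq (by omega) hk1 hak
    refine ⟨_, _, a, .seq hr1 (.seq hr2 (.seq hr3 hr4)), ?_, Or.inl ⟨rfl, by omega⟩, by omega⟩
    simp [run, eval, BinOp.eval, hk3, hk5, hak]
  · have hc := card_cyc_eq (by omega) hk2 (hbk.resolve_left hak)
    refine ⟨_, _, b, .seq hr1 (.seq hr2 (.seq hr3 hr4)), ?_, Or.inr ⟨rfl, by omega⟩, by omega⟩
    simp [run, eval, BinOp.eval, hk3, hk5, hk6, hak, enc_inj]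

/-! ### Cutting an edge -/

/-- The memory after the first `j` edges of the queue `q` have been cut: `σ` represents the tours
of the components and `lab` labels them, and the queue consists of the edges whose ends are
separated in the other colour. -/
structure CutState (D : EdgeData n m) (σ : Perm (El n m)) (lab : El n m → ℕ) (q : List (Fin m))
    (j : ℕ) (s : State) : Prop where
  wired : Wired D s
  tour : D.Tour {i | i ∈ q.take j} σ
  next : NextIs s σ
  label : LabelIs s lab
  label_iff : ∀ x y, lab x = lab y ↔ σ.SameCycle x y
  label_lt : ∀ x, lab x < 3 + j
  fresh : s.var vLabel = 3 + j
  queue : QueueIs s q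
  mem_queue : ∀ i, i ∈ q ↔ ¬ D.Conn (D.alive {i | i ∈ q.take j} !D.col i)
    (D.endpt i false) (D.endpt i true)

/-- Labels of the cycles of `σ` remain correct labels of the cycles of `flip σ i` if one of the
two parts of the split cycle gets a new label. -/
theorem label_flip {σ : Perm (El n m)} {i : Fin m} {lab : El n m → ℕ} {l : ℕ}
    (hlab : ∀ x y, lab x = lab y ↔ σ.SameCycle x y) (hl : ∀ x, lab x < l)
    (hnot : ¬ (D.flip σ i).SameCycle (dart n i false (D.col i)) (dart n i true (D.col i)))
    {z : El n m} (hz : z = dart n i false (D.col i) ∨ z = dart n i true (D.col i))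
    [DecidablePred ((D.flip σ i).SameCycle z)] (x y : El n m) :
    ((if (D.flip σ i).SameCycle z x then l else lab x) =
      if (D.flip σ i).SameCycle z y then l else lab y) ↔ (D.flip σ i).SameCycle x y := by
  by_cases hx : (D.flip σ i).SameCycle z x <;> by_cases hy : (D.flip σ i).SameCycle z y
  · simp only [hx, hy, if_true, true_iff]
    exact hx.symm.trans hy
  · simp only [hx, hy, if_true, if_false, (hl y).ne', false_iff]
    exact fun e => hy (hx.trans e)
  · simp only [hx, hy, if_true, if_false, (hl x).ne, false_iff]
    exact fun e => hx (hy.trans e.symm)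
  · simp only [hx, hy, if_false]
    rw [hlab]
    conv_lhs => rw [← EdgeData.flip_flip (D := D) σ i, EdgeData.flip,
      Perm.sameCycle_mul_swap_iff hnot]
    refine ⟨?_, Or.inl⟩
    rintro (h | ⟨h1, h2⟩ | ⟨h1, h2⟩)
    · exact h
    · rcases hz with rfl | rfl
      exacts [absurd h1.symm hx, absurd h2.symm hy]
    · rcases hz with rfl | rfl
      exacts [absurd h2.symm hy, absurd h1.symm hx]

/-- Assign the two darts of the edge `vI` in the layer of its colour to `vA` and `vB`. -/
def locate : Program :=
  assign vC (load aColour (var vI)) ;;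
  assign vA (var vCount +ₑ var vCount +ₑ (var vI +ₑ var vI +ₑ (var vI +ₑ var vI)) +ₑ var vC) ;;
  assign vB (var vA +ₑ const 2)

theorem locate_spec (hW : Room n m W) {s : State} (hs : s.Bdd W) (hD : Wired D s) {i : Fin m}
    (hI : s.var vI = i) : ∃ t s', Runs W locate s t s' ∧ t ≤ 40 ∧
      s'.var vA = enc (dart n i false (D.col i)) ∧ s'.var vB = enc (dart n i true (D.col i)) := by
  have h2 := hW.two_le
  have hm := hW.count
  have hWn := hW.le
  have hi := i.2
  have hc := Bool.toNat_lt (D.col i)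
  have hn := hD.count
  have hcol := hD.colour i
  obtain ⟨t, hr, ht⟩ := Program.Safe.runs (p := locate) hW.one_lt hs
    (by simp [locate, Program.Safe, Expr.Ok, run, eval, BinOp.eval, hI, hn, hcol]; omega)
  refine ⟨t, _, hr, ht.trans (by decide), ?_, ?_⟩
  · simp [locate, run, eval, BinOp.eval, hI, hn, hcol, enc, dart]
  · simp [locate, run, eval, BinOp.eval, hI, hn, hcol, enc, dart]; omega

/-- Cut the edge `vI`, and append to the queue the edges of the other colour whose ends become
separated. -/
def cutEdge : Program :=
  locate ;; swapNext ;; findSmaller ;; relabel ;; scan ;; assign vLabel (var vLabel +ₑ const 1)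

theorem cutEdge_spec (hW : Room n m W) (hF : ∀ c, D.IsForest c) {s : State} (hs : s.Bdd W)
    {σ : Perm (El n m)} {lab : El n m → ℕ} {q : List (Fin m)} {j : ℕ}
    (h : CutState D σ lab q j s) {i : Fin m} (hj : q[j]? = some i) (hI : s.var vI = i) :
    ∃ t s' lab' q', Runs W cutEdge s t s' ∧ CutState D (D.flip σ i) lab' q' (j + 1) s' ∧
      q <+: q' ∧ (∀ x, lab' x = lab x ∨ (lab' x = 3 + j ∧ x.2 = D.col i ∧ ∃ b,
        D.Conn (D.alive {i | i ∈ q.take j} (D.col i)) (D.endpt i b) (D.src x))) ∧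
      t + 200 * logPotential (D.flip σ i) ≤ 200 * logPotential σ + 200 := by
  classical
  have h2 := hW.two_le
  have hm := hW.count
  have hWn := hW.le
  have hql := h.queue.length_le
  obtain ⟨hjl, hij⟩ := List.getElem?_eq_some_iff.1 hj
  obtain ⟨t1, s₁, hr1, ht1, hA, hB⟩ := locate_spec hW hs h.wired hI
  have hb1 := hr1.bdd hs
  obtain ⟨t2, s₂, hr2, ht2, hσ2⟩ := swapNext_spec hW.one_lt hb1
    (h.next.of_runs hr1 (by decide)) hA hB
  have hb2 := hr2.bdd hb1
  change NextIs s₂ (D.flip σ i) at hσ2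
  obtain ⟨t3, s₃, z, hr3, hz3, hz, ht3⟩ := findSmaller_spec hW.one_lt hb2 hσ2
    ((hr2.var_eq _ (by decide)).trans hA) ((hr2.var_eq _ (by decide)).trans hB)
  have hb3 := hr3.bdd hb2
  have hσ3 := hσ2.of_runs hr3 (by decide)
  have hlab3 : LabelIs s₃ lab := ((h.label.of_runs hr1 (by decide)).of_runs hr2
    (by decide)).of_runs hr3 (by decide)
  obtain ⟨t4, s₄, hr4, ht4, hlab4⟩ := relabel_spec hW.one_lt hb3 hσ3 hz3 hlab3
  have hb4 := hr4.bdd hb3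
  have hfr : s₃.var vLabel = 3 + j := by
    rw [hr3.var_eq _ (by decide), hr2.var_eq _ (by decide), hr1.var_eq _ (by decide), h.fresh]
  rw [hfr] at hlab4
  have hD4 : Wired D s₄ := (((h.wired.of_runs hr1 (by decide)).of_runs hr2
    (by decide)).of_runs hr3 (by decide)).of_runs hr4 (by decide)
  have hq4 : QueueIs s₄ q := (((h.queue.of_runs hr1 (by decide)).of_runs hr2
    (by decide)).of_runs hr3 (by decide)).of_runs hr4 (by decide)
  have hσ4 := hσ3.of_runs hr4 (by decide)
  obtain ⟨t5, s₅, q', hr5, ht5, hq5, hpre, hmem⟩ := scan_spec hW hb4 hD4 hσ4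
    ((hr4.var_eq _ (by decide)).trans hz3) hlab4 hq4
  have hb5 := hr5.bdd hb4
  have hfr5 : s₅.var vLabel = 3 + j := by
    rw [hr5.var_eq _ (by decide), hr4.var_eq _ (by decide), hfr]
  obtain ⟨t6, hr6, ht6⟩ := Program.Safe.runs (p := assign vLabel (var vLabel +ₑ const 1))
    hW.one_lt hb5 (by simp [Program.Safe, Expr.Ok, eval, hfr5]; omega)
  set lab' : El n m → ℕ := fun x => if (D.flip σ i).SameCycle z x then 3 + j else lab x with hlab'
  -- the combinatorial effect of the cut
  set K : Set (Fin m) := {i | i ∈ q.take j} with hK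
  have hK' : {i | i ∈ q'.take (j + 1)} = insert i K := by
    obtain ⟨l, rfl⟩ := hpre
    ext x
    rw [List.take_append_of_le_length (by omega), List.take_add_one, hj]
    simp [hK, or_comm]
  have hiK : i ∉ K := by
    intro e
    have e : i ∈ q.take j := e
    obtain ⟨k, hk, hk'⟩ := List.mem_iff_getElem.1 e
    rw [List.getElem_take] at hk'
    rw [List.length_take] at hk
    have := (h.queue.nodup.getElem_inj_iff (hi := by omega) (hj := hjl)).1 (hk'.trans hij.symm)
    omega
  have hbridge : ¬ D.Conn (D.alive (insert i K) (D.col i)) (D.endpt i false) (D.endpt i true) :=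
    fun e => hF _ i rfl (e.mono fun k hk => ⟨hk.1, fun e => hk.2 (e ▸ Set.mem_insert _ _)⟩)
  obtain ⟨htour, hnot⟩ := h.tour.cut hiK hbridge
  have hzab : z = dart n i false (D.col i) ∨ z = dart n i true (D.col i) :=
    hz.imp And.left And.left
  have hlab_iff := label_flip h.label_iff h.label_lt hnot hzab
  have hpot : logPotential (D.flip σ i) + (cyc (D.flip σ i) z).card ≤ logPotential σ := by
    rcases hz with ⟨rfl, hle⟩ | ⟨rfl, hle⟩
    · have := logPotential_split hnot hle
      rwa [← EdgeData.flip, EdgeData.flip_flip] at this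
    · have := logPotential_split (fun e => hnot e.symm) hle
      rwa [Equiv.swap_comm, ← EdgeData.flip, EdgeData.flip_flip] at this
  have hmem' : ∀ i', i' ∈ q' ↔ i' ∈ q ∨ ∃ b c, (D.flip σ i).SameCycle z (dart n i' b c) ∧
      ¬ (D.flip σ i).SameCycle (dart n i' false c) (dart n i' true c) := by
    simpa only [Ne, hlab_iff] using hmem
  refine ⟨_, _, lab', q', .seq hr1 (.seq hr2 (.seq hr3 (.seq hr4 (.seq hr5 hr6)))),
    ⟨(hD4.of_runs hr5 (by decide)).of_runs hr6 (by decide), hK' ▸ htour,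
      (hσ4.of_runs hr5 (by decide)).of_runs hr6 (by decide),
      (hlab4.of_runs hr5 (by decide)).of_runs hr6 (by decide), hlab_iff, fun x => ?_, ?_,
      hq5.of_runs hr6 (by decide), fun i' => ?_⟩, hpre, fun x => ?_, ?_⟩
  · have := h.label_lt x
    simp only [hlab']
    split_ifs <;> omega
  · simp [run, eval, BinOp.eval, hfr5, Nat.add_assoc]
  · rw [hK', hmem']
    constructor
    · rintro (hi' | ⟨b, c, -, h2⟩)
      · exact fun e => (h.mem_queue i').1 hi'
          (e.mono (EdgeData.alive_anti (Set.subset_insert i K) _))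
      · intro e
        by_cases hc : c = D.col i'
        · -- in the layer of its own colour, only an edge that has been cut joins two tours
          by_cases hi' : i' ∈ insert i K
          · have : i' ∈ q := by
              rcases hi' with rfl | hi'
              · exact hij ▸ List.getElem_mem hjl
              · exact List.mem_of_mem_take hi'
            exact (h.mem_queue i').1 this
              (e.mono (EdgeData.alive_anti (Set.subset_insert i K) _))
          · exact h2 (htour.sameCycle_of_conn _ _ rfl (EdgeData.Conn.edge ⟨hc.symm, hi'⟩))
        · have hc : c = !D.col i' := by
            cases c <;> cases hci : D.col i' <;> simp [hci] at hc ⊢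
          exact h2 (htour.sameCycle_of_conn _ _ rfl (hc ▸ e))
    · intro hnc
      by_cases hi' : i' ∈ q
      · exact Or.inl hi'
      · right
        rw [h.mem_queue, not_not] at hi'
        have hsame : σ.SameCycle (dart n i' false !D.col i') (dart n i' true !D.col i') :=
          h.tour.sameCycle_of_conn _ _ rfl hi'
        have hdiff : ¬ (D.flip σ i).SameCycle (dart n i' false !D.col i')
            (dart n i' true !D.col i') := fun e => hnc ((htour.sameCycle_iff _ _).1 e).2
        rw [← EdgeData.flip_flip (D := D) σ i, EdgeData.flip,
          Perm.sameCycle_mul_swap_iff hnot] at hsame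
        rcases hsame with e | ⟨e1, e2⟩ | ⟨e1, e2⟩
        · exact absurd e hdiff
        · rcases hzab with rfl | rfl
          exacts [⟨_, _, e1.symm, hdiff⟩, ⟨_, _, e2.symm, hdiff⟩]
        · rcases hzab with rfl | rfl
          exacts [⟨_, _, e2.symm, hdiff⟩, ⟨_, _, e1.symm, hdiff⟩]
  · simp only [hlab']
    split_ifs with hx
    · have hl := ((htour.sameCycle_iff _ _).1 hx).1
      have hc := ((htour.sameCycle_iff _ _).1 hx).2
      refine Or.inr ⟨rfl, ?_, ?_⟩
      · rcases hzab with rfl | rfl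
        exacts [hl.symm, hl.symm]
      rcases hzab with rfl | rfl
      exacts [⟨false, hc.mono (EdgeData.alive_anti (Set.subset_insert i K) _)⟩,
        ⟨true, hc.mono (EdgeData.alive_anti (Set.subset_insert i K) _)⟩]
    · exact Or.inl rfl
  · have e6 : (assign vLabel (var vLabel +ₑ const 1)).time = 4 := rfl
    omega

/-! ### One round: cutting a batch of edges and numbering the new nodes -/

/-- Cut the edges of the queue from position `vJ` up to position `vStop`. -/
def cutBatch : Program :=
  loop (var vJ <ₑ var vStop)
    (assign vI (load aQueue (var vJ)) ;; cutEdge ;; assign vJ (var vJ +ₑ const 1))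

theorem cutBatch_spec (hW : Room n m W) (hF : ∀ c, D.IsForest c) {s : State} (hs : s.Bdd W)
    {σ : Perm (El n m)} {lab : El n m → ℕ} {q : List (Fin m)} {j : ℕ}
    (h : CutState D σ lab q j s) (hj : s.var vJ = j) (hjq : j ≤ q.length)
    (hlim : s.var vStop = q.length) :
    ∃ t s' σ' lab' q', Runs W cutBatch s t s' ∧ CutState D σ' lab' q' q.length s' ∧
      q <+: q' ∧ (∀ x, lab' x = lab x ∨ (3 + j ≤ lab' x ∧ ∃ i b, i ∈ q ∧ i ∉ q.take j ∧
        x.2 = D.col i ∧ D.Conn (D.alive {i | i ∈ q.take j} (D.col i)) (D.endpt i b) (D.src x))) ∧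
      t + 200 * logPotential σ' ≤ 200 * logPotential σ + 250 * (q.length - j) + 10 := by
  obtain ⟨t, s', ⟨σ', lab', q', j'⟩, hr, ⟨h1, h2, h3, h4, h5, h6⟩, hb, ht⟩ :=
    runs_loop (ι := Perm (El n m) × (El n m → ℕ) × List (Fin m) × ℕ) hW.one_lt hs
    (b := var vJ <ₑ var vStop)
    (p := assign vI (load aQueue (var vJ)) ;; cutEdge ;; assign vJ (var vJ +ₑ const 1))
    (I := fun k s' => CutState D k.1 k.2.1 k.2.2.1 k.2.2.2 s' ∧ s'.var vJ = k.2.2.2 ∧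
      k.2.2.2 ≤ q.length ∧ j ≤ k.2.2.2 ∧ q <+: k.2.2.1 ∧
      ∀ x, k.2.1 x = lab x ∨ (3 + j ≤ k.2.1 x ∧ ∃ i b, i ∈ q ∧ i ∉ q.take j ∧
        x.2 = D.col i ∧ D.Conn (D.alive {i | i ∈ q.take j} (D.col i)) (D.endpt i b) (D.src x)))
    (Φ := fun k => 200 * logPotential k.1 + 250 * (q.length - k.2.2.2)) (k₀ := (σ, lab, q, j))
    ⟨h, hj, hjq, le_rfl, List.prefix_rfl, fun x => Or.inl rfl⟩
    (fun s k _ _ => by simp [Expr.Ok])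
    (by
      rintro s' ⟨σ', lab', q', j'⟩ hs' hv ha ⟨h1, h2, h3, h4, h5, h6⟩ hb
      simp only at h1 h2 h3 h4 h5 h6 ⊢
      have hst : s'.var vStop = q.length := (hv _ (by decide)).trans hlim
      have hlt : j' < q.length := by
        simp only [eval, BinOp.eval, h2, hst] at hb
        by_contra e
        simp [e] at hb
      have hpl := h5.length_le
      have hlt' : j' < q'.length := by omega
      have hq : q'[j'] = q[j'] := (h5.getElem hlt).symm
      obtain ⟨t1, hr1, ht1⟩ := Program.Safe.runs (p := assign vI (load aQueue (var vJ)))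
        hW.one_lt hs' (by simp [Program.Safe, Expr.Ok])
      have hI : ((assign vI (load aQueue (var vJ))).run s').var vI = q'[j'] := by
        simp [run, eval, h2, h1.queue.get j' hlt']
      have h1' : CutState D σ' lab' q' j' ((assign vI (load aQueue (var vJ))).run s') :=
        ⟨h1.wired.of_runs hr1 (by decide), h1.tour, h1.next, h1.label, h1.label_iff, h1.label_lt,
          h1.fresh, h1.queue.of_runs hr1 (by decide), h1.mem_queue⟩
      obtain ⟨t2, s₂, lab₂, q₂, hr2, hc, hpre, hlab, ht2⟩ := cutEdge_spec hW hF (hr1.bdd hs') h1'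
        (List.getElem?_eq_getElem hlt') hI
      have hJ2 : s₂.var vJ = j' := by
        rw [hr2.var_eq _ (by decide), hr1.var_eq _ (by decide), h2]
      have hql := h1.queue.length_le
      have hm := hW.count
      have hWn := hW.le
      obtain ⟨t3, hr3, ht3⟩ := Program.Safe.runs (p := assign vJ (var vJ +ₑ const 1))
        hW.one_lt (hr2.bdd (hr1.bdd hs')) (by
          simp [Program.Safe, Expr.Ok, eval, hJ2]; have := hW.two_le; omega)
      refine ⟨_, _, ⟨D.flip σ' q'[j'], lab₂, q₂, j' + 1⟩, .seq hr1 (.seq hr2 hr3),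
        ⟨⟨hc.wired.of_runs hr3 (by decide), hc.tour, hc.next, hc.label, hc.label_iff, hc.label_lt,
          hc.fresh, hc.queue.of_runs hr3 (by decide), hc.mem_queue⟩, ?_, hlt, Nat.le_succ_of_le h4,
          h5.trans hpre, fun x => ?_⟩, ?_⟩
      · simp [run, eval, BinOp.eval, hJ2]
      · dsimp only
        rcases hlab x with e | ⟨e, hxi, b, hcb⟩
        · rw [e]; exact h6 x
        · refine Or.inr ⟨by omega, q'[j'], b, hq ▸ List.getElem_mem hlt, ?_, hxi,
            hcb.mono ?_⟩
          · rw [hq]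
            intro e
            obtain ⟨k, hk, hk'⟩ := List.mem_iff_getElem.1 e
            rw [List.getElem_take] at hk'
            rw [List.length_take] at hk
            have := (h.queue.nodup.getElem_inj_iff (hi := by omega) (hj := hlt)).1 hk'
            omega
          · apply EdgeData.alive_anti
            intro i hi
            obtain ⟨l, rfl⟩ := h5
            have hi : i ∈ q.take j := hi
            change i ∈ (q ++ l).take j'
            rw [List.take_append_of_le_length hlt.le]
            exact List.take_subset_take_left q h4 hi
      · have e1 : (assign vI (load aQueue (var vJ))).time = 3 := rfl
        have e2 : (assign vJ (var vJ +ₑ const 1)).time = 4 := rfl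
        have e3 : (var vJ <ₑ var vStop).cost = 3 := rfl
        dsimp only
        omega)
  simp only at h1 h2 h3 h4 h5 h6 ht
  have hst : s'.var vStop = q.length := (hr.var_eq _ (by decide)).trans hlim
  have hj' : j' = q.length := by
    simp only [eval, BinOp.eval, h2, hst] at hb
    by_contra e
    rw [if_pos (by omega)] at hb
    omega
  subst hj'
  refine ⟨t, s', σ', lab', q', hr, h1, h5, h6, ?_⟩
  have e3 : (var vJ <ₑ var vStop).cost = 3 := rfl
  omega

/-- The array of the ends on side `b` of the cross edges. -/
def crossArr (b : Bool) : ℕ := if b then aCrossHead else aCrossTail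

/-- Consider the dart of the edge `vI` at its end `b`, in the layer `vC` of its colour. If the node
of its cycle is still a node of an earlier round, create a new node, whose parent is the current
node of the same vertex in the other layer. Record the node as an end of the cross edge. -/
def assignSide (b : Bool) : Program :=
  assign vD (var vCount +ₑ var vCount +ₑ (var vI +ₑ var vI +ₑ (var vI +ₑ var vI)) +ₑ
    const (b.toNat + b.toNat)) ;;
  assign vP (load aLabel (var vD +ₑ var vC)) ;;
  ite (load aNode (var vP) <ₑ var vOld)
    (store aNode (var vP) (var vNodes) ;;
      store aParent (var vNodes) (load aNode (load aLabel (var vD +ₑ const 1 -ₑ var vC))) ;;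
      assign vNodes (var vNodes +ₑ const 1)) skip ;;
  store (crossArr b) (var vI) (load aNode (var vP))

/-- The memory while new nodes `N₀, N₀ + 1, …` are created in layer `c`, after the ends `P` of edges
have been considered. The memory before is described by `node₀`, `par₀`, `cr₀`, and `up` yields
the parents. -/
structure Assigned (D : EdgeData n m) (lab : El n m → ℕ) (c : Bool) (N₀ : ℕ) (node₀ par₀ : ℕ → ℕ)
    (cr₀ : Bool → Fin m → ℕ) (up : Fin n → ℕ) (P : Set (Fin m × Bool)) (s : State) : Prop where
  old_node : ∀ l, (∀ p ∈ P, lab (dart n p.1 p.2 c) ≠ l) → s.arr aNode l = node₀ l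
  new_node : ∀ p ∈ P, N₀ ≤ s.arr aNode (lab (dart n p.1 p.2 c)) ∧
    s.arr aNode (lab (dart n p.1 p.2 c)) < s.var vNodes
  inj : ∀ p ∈ P, ∀ p' ∈ P, s.arr aNode (lab (dart n p.1 p.2 c)) =
    s.arr aNode (lab (dart n p'.1 p'.2 c)) → lab (dart n p.1 p.2 c) = lab (dart n p'.1 p'.2 c)
  surj : ∀ y, N₀ ≤ y → y < s.var vNodes → ∃ p ∈ P, s.arr aNode (lab (dart n p.1 p.2 c)) = y
  parent : ∀ p ∈ P, s.arr aParent (s.arr aNode (lab (dart n p.1 p.2 c))) = up (D.endpt p.1 p.2)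
  old_parent : ∀ y < N₀, s.arr aParent y = par₀ y
  cross : ∀ p ∈ P, s.arr (crossArr p.2) p.1 = s.arr aNode (lab (dart n p.1 p.2 c))
  old_cross : ∀ p ∉ P, s.arr (crossArr p.2) p.1 = cr₀ p.2 p.1
  le : N₀ ≤ s.var vNodes

theorem assignSide_spec (hW : Room n m W) {s : State} (hs : s.Bdd W) (hD : Wired D s)
    {lab : El n m → ℕ} (hlab : LabelIs s lab) {N₀ : ℕ} {node₀ par₀ : ℕ → ℕ}
    {cr₀ : Bool → Fin m → ℕ} {up : Fin n → ℕ} {P : Set (Fin m × Bool)} {i : Fin m} (b : Bool)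
    (h : Assigned D lab (D.col i) N₀ node₀ par₀ cr₀ up P s) (hI : s.var vI = i)
    (hC : s.var vC = (D.col i).toNat) (hold : s.var vOld = N₀) (hN : s.var vNodes < 50 * n)
    (hlow : node₀ (lab (dart n i b (D.col i))) < N₀)
    (hsep : ∀ p : Fin m × Bool, lab (dart n p.1 p.2 (D.col i)) ≠ lab (dart n i b !D.col i))
    (hup : node₀ (lab (dart n i b !D.col i)) = up (D.endpt i b))
    (hup' : ∀ p : Fin m × Bool, lab (dart n p.1 p.2 (D.col i)) = lab (dart n i b (D.col i)) →
      up (D.endpt p.1 p.2) = up (D.endpt i b)) :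
    ∃ t s', Runs W (assignSide b) s t s' ∧ t ≤ 100 ∧
      Assigned D lab (D.col i) N₀ node₀ par₀ cr₀ up (insert (i, b) P) s' ∧
      s'.var vNodes ≤ s.var vNodes + 1 := by
  have h2 := hW.two_le
  have hm := hW.count
  have hWn := hW.le
  have hi := i.2
  have hc := Bool.toNat_lt (D.col i)
  have hb := Bool.toNat_lt b
  have hn := hD.count
  set l := lab (dart n i b (D.col i)) with hl
  have e1 : s.arr aLabel (n + n + (i + i + (i + i)) + (b.toNat + b.toNat) + (D.col i).toNat) = l :=
    hlab (dart n i b (D.col i))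
  have e2 : s.arr aLabel (n + n + (i + i + (i + i)) + (b.toNat + b.toNat) + 1 - (D.col i).toNat) =
      lab (dart n i b !D.col i) := by
    rw [← hlab]
    congr 1
    cases D.col i <;> simp [enc, dart]
  have hcr : crossArr b = 5 ∨ crossArr b = 6 := by cases b <;> simp [crossArr]
  have hcrb : ∀ b', crossArr b' = crossArr b ↔ b' = b := by
    cases b <;> intro b' <;> cases b' <;> simp [crossArr]
  have hcr7 : crossArr b ≠ aNode ∧ crossArr b ≠ aParent := by
    rcases hcr with e | e <;> simp [e]
  obtain ⟨t, hr, ht⟩ := Program.Safe.runs (p := assignSide b) hW.one_lt hs (by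
    simp [assignSide, Program.Safe, Expr.Ok, run, eval, BinOp.eval, hI, hn, hC]
    omega)
  have ht : t ≤ 100 := ht.trans (by cases b <;> decide)
  refine ⟨t, _, hr, ht, ?_⟩
  set s' := (assignSide b).run s with hs'
  have hupv : s.arr aNode (lab (dart n i b !D.col i)) = up (D.endpt i b) := by
    rw [h.old_node _ fun p _ => hsep p, hup]
  by_cases hnew : s.arr aNode l < N₀
  · -- a new node
    have hv : s'.var vNodes = s.var vNodes + 1 := by
      simp [hs', assignSide, run, eval, BinOp.eval, hI, hn, hC, hold, e1, hnew]
    have hnd : ∀ k, s'.arr aNode k = if k = l then s.var vNodes else s.arr aNode k := by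
      intro k
      simp [hs', assignSide, run, eval, BinOp.eval, hI, hn, hC, hold, e1, hnew, hcr7.1.symm,
        Function.update_apply]
    have hpa : ∀ k, s'.arr aParent k =
        if k = s.var vNodes then up (D.endpt i b) else s.arr aParent k := by
      intro k
      have hll : lab (dart n i b !D.col i) ≠ l := fun e => hsep (i, b) e.symm
      simp [hs', assignSide, run, eval, BinOp.eval, hI, hn, hC, hold, e1, e2, hnew, hcr7.2.symm,
        Function.update_apply, hll, hupv]
    have hcrs : ∀ p : Fin m × Bool, s'.arr (crossArr p.2) p.1 =
        if p = (i, b) then s.var vNodes else s.arr (crossArr p.2) p.1 := by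
      rintro ⟨k, b'⟩
      have hb' : crossArr b' ≠ aNode ∧ crossArr b' ≠ aParent := by cases b' <;> simp [crossArr]
      by_cases g : b' = b
      · subst g
        by_cases g' : k = i <;>
          simp [hs', assignSide, run, eval, BinOp.eval, g', hI, hn, hC, hold, e1, hnew,
            Fin.val_inj, Function.update_apply, hcr7.1, hcr7.2]
      · have g1 : crossArr b' ≠ crossArr b := fun e => g ((hcrb b').1 e)
        simp [hs', assignSide, run, eval, BinOp.eval, g, g1, hI, hn, hC, hold, e1, hnew,
          hb'.1, hb'.2]
    have hPl : ∀ p ∈ P, lab (dart n p.1 p.2 (D.col i)) ≠ l := by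
      intro p hp e
      have := (h.new_node p hp).1
      rw [e] at this
      omega
    have hNd : ∀ p ∈ P, s'.arr aNode (lab (dart n p.1 p.2 (D.col i))) =
        s.arr aNode (lab (dart n p.1 p.2 (D.col i))) := fun p hp => by
      rw [hnd, if_neg (hPl p hp)]
    have hNl : s'.arr aNode l = s.var vNodes := by rw [hnd, if_pos rfl]
    refine ⟨⟨?_, ?_, ?_, ?_, ?_, ?_, ?_, ?_, ?_⟩, hv.le⟩
    · intro k hk
      rw [hnd, if_neg fun e => hk (i, b) (Set.mem_insert _ _) e.symm]
      exact h.old_node k fun p hp => hk p (Set.mem_insert_of_mem _ hp)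
    · rintro p (rfl | hp)
      · rw [hNl, hv]; exact ⟨h.le, by omega⟩
      · rw [hNd p hp, hv]; have := h.new_node p hp; omega
    · rintro p (rfl | hp) p' (rfl | hp') e
      · rfl
      · rw [hNl, hNd p' hp'] at e; have := h.new_node p' hp'; omega
      · rw [hNl, hNd p hp] at e; have := h.new_node p hp; omega
      · rw [hNd p hp, hNd p' hp'] at e; exact h.inj p hp p' hp' e
    · intro y hy hy'
      by_cases e : y = s.var vNodes
      · exact ⟨(i, b), Set.mem_insert _ _, by rw [hNl, e]⟩
      · obtain ⟨p, hp, e'⟩ := h.surj y hy (by omega)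
        exact ⟨p, Set.mem_insert_of_mem _ hp, by rw [hNd p hp, e']⟩
    · rintro p (rfl | hp)
      · rw [hNl, hpa, if_pos rfl]
      · have := h.new_node p hp
        rw [hNd p hp, hpa, if_neg (by omega), h.parent p hp]
    · intro y hy
      have := h.le
      rw [hpa, if_neg (by omega), h.old_parent y hy]
    · rintro p (rfl | hp)
      · rw [hcrs, if_pos rfl, hNl]
      · have : p ≠ (i, b) := by rintro rfl; exact hPl _ hp rfl
        rw [hcrs, if_neg this, hNd p hp, h.cross p hp]
    · intro p hp
      rw [Set.mem_insert_iff, not_or] at hp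
      rw [hcrs, if_neg hp.1, h.old_cross p hp.2]
    · have := h.le; omega
  · -- the cycle already has a new node
    obtain ⟨p₀, hp₀, hp₀l⟩ : ∃ p ∈ P, lab (dart n p.1 p.2 (D.col i)) = l := by
      by_contra! e
      rw [h.old_node l e] at hnew
      exact hnew hlow
    have hv : s'.var vNodes = s.var vNodes := by
      simp [hs', assignSide, run, eval, BinOp.eval, hI, hn, hC, hold, e1, hnew]
    have hnd : s'.arr aNode = s.arr aNode := by
      simp [hs', assignSide, run, eval, BinOp.eval, hI, hn, hC, hold, e1, hnew, hcr7.1.symm]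
    have hpa : s'.arr aParent = s.arr aParent := by
      simp [hs', assignSide, run, eval, BinOp.eval, hI, hn, hC, hold, e1, hnew, hcr7.2.symm]
    have hcrs : ∀ p : Fin m × Bool, s'.arr (crossArr p.2) p.1 =
        if p = (i, b) then s.arr aNode l else s.arr (crossArr p.2) p.1 := by
      rintro ⟨k, b'⟩
      by_cases g : b' = b
      · subst g
        by_cases g' : k = i <;>
          simp [hs', assignSide, run, eval, BinOp.eval, g', hI, hn, hC, hold, e1, hnew,
            Fin.val_inj]
      · have g1 : crossArr b' ≠ crossArr b := fun e => g ((hcrb b').1 e)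
        simp [hs', assignSide, run, eval, BinOp.eval, g, g1, hI, hn, hC, hold, e1, hnew]
    refine ⟨⟨?_, ?_, ?_, ?_, ?_, ?_, ?_, ?_, ?_⟩, by omega⟩
    · intro k hk
      rw [hnd]
      exact h.old_node k fun p hp => hk p (Set.mem_insert_of_mem _ hp)
    · rintro p (rfl | hp)
      · rw [hnd, hv]; have := h.new_node p₀ hp₀; rwa [hp₀l] at this
      · rw [hnd, hv]; exact h.new_node p hp
    · rw [hnd]
      rintro p (rfl | hp) p' (rfl | hp') e
      · rfl
      · rw [← hl, ← hp₀l] at e ⊢; exact h.inj p₀ hp₀ p' hp' e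
      · rw [← hl, ← hp₀l] at e ⊢; exact h.inj p hp p₀ hp₀ e
      · exact h.inj p hp p' hp' e
    · intro y hy hy'
      rw [hv] at hy'
      obtain ⟨p, hp, e⟩ := h.surj y hy hy'
      exact ⟨p, Set.mem_insert_of_mem _ hp, by rw [hnd, e]⟩
    · rw [hnd, hpa]
      rintro p (rfl | hp)
      · rw [← hup' p₀ hp₀l, ← h.parent p₀ hp₀, hp₀l]
      · exact h.parent p hp
    · rw [hpa]; exact h.old_parent
    · rintro p (rfl | hp)
      · rw [hcrs, if_pos rfl, hnd]
      · rw [hcrs]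
        split_ifs with e
        · rw [hnd, e]
        · rw [hnd, h.cross p hp]
    · intro p hp
      rw [Set.mem_insert_iff, not_or] at hp
      rw [hcrs, if_neg hp.1, h.old_cross p hp.2]
    · rw [hv]; exact h.le


theorem Assigned.of_runs {p : Program} {s s' : State} {t : ℕ} {lab : El n m → ℕ} {c : Bool}
    {N₀ : ℕ} {node₀ par₀ : ℕ → ℕ} {cr₀ : Bool → Fin m → ℕ} {up : Fin n → ℕ}
    {P : Set (Fin m × Bool)} (h : Assigned D lab c N₀ node₀ par₀ cr₀ up P s)
    (hr : Runs W p s t s') (hp : vNodes ∉ p.wvars ∧ aNode ∉ p.warrs ∧ aParent ∉ p.warrs ∧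
      aCrossTail ∉ p.warrs ∧ aCrossHead ∉ p.warrs) :
    Assigned D lab c N₀ node₀ par₀ cr₀ up P s' := by
  have e1 := hr.var_eq _ hp.1
  have e2 := hr.arr_eq _ hp.2.1
  have e3 := hr.arr_eq _ hp.2.2.1
  have e4 : ∀ b, s'.arr (crossArr b) = s.arr (crossArr b) := by
    intro b
    cases b
    exacts [hr.arr_eq _ hp.2.2.2.1, hr.arr_eq _ hp.2.2.2.2]
  constructor <;> simp only [e1, e2, e3, e4]
  exacts [h.old_node, h.new_node, h.inj, h.surj, h.parent, h.old_parent, h.cross, h.old_cross,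
    h.le]

/-- Create the new nodes that belong to the edges of the queue from position `vJ` up to position
`vStop`. -/
def assignBatch : Program :=
  loop (var vJ <ₑ var vStop)
    ((assign vI (load aQueue (var vJ)) ;; assign vC (load aColour (var vI))) ;;
      assignSide false ;; assignSide true ;; assign vJ (var vJ +ₑ const 1))

theorem assignBatch_spec (hW : Room n m W) {s : State} (hs : s.Bdd W) (hD : Wired D s)
    {lab : El n m → ℕ} (hlab : LabelIs s lab) {q : List (Fin m)} (hq : QueueIs s q) {j k : ℕ}
    (hjk : j ≤ k) (hk : k ≤ q.length) (hj : s.var vJ = j) (hlim : s.var vStop = k)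
    (hold : s.var vOld = s.var vNodes) (hN : s.var vNodes + 2 * (k - j) ≤ 50 * n) {c : Bool}
    {up : Fin n → ℕ} {B : Set (Fin m)} (hB : ∀ l i, j ≤ l → l < k → q[l]? = some i → i ∈ B)
    (hcol : ∀ i ∈ B, D.col i = c)
    (hlow : ∀ i ∈ B, ∀ b, s.arr aNode (lab (dart n i b c)) < s.var vNodes)
    (hsep : ∀ (p p' : Fin m × Bool), lab (dart n p.1 p.2 c) ≠ lab (dart n p'.1 p'.2 !c))
    (hup : ∀ i ∈ B, ∀ b, s.arr aNode (lab (dart n i b !c)) = up (D.endpt i b))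
    (hup' : ∀ i ∈ B, ∀ b, ∀ p : Fin m × Bool,
      lab (dart n p.1 p.2 c) = lab (dart n i b c) → up (D.endpt p.1 p.2) = up (D.endpt i b)) :
    ∃ t s', Runs W assignBatch s t s' ∧ t ≤ 250 * (k - j) + 10 ∧
      Assigned D lab c (s.var vNodes) (s.arr aNode) (s.arr aParent)
        (fun b i => s.arr (crossArr b) i) up
        {p | ∃ l, j ≤ l ∧ l < k ∧ q[l]? = some p.1} s' ∧
      s'.var vNodes ≤ s.var vNodes + 2 * (k - j) := by
  set A := fun (l : ℕ) => Assigned D lab c (s.var vNodes) (s.arr aNode) (s.arr aParent)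
    (fun b i => s.arr (crossArr b) i) up {p | ∃ l', j ≤ l' ∧ l' < l ∧ q[l']? = some p.1} with hA
  have hm := hW.count
  have hWn := hW.le
  have h2 := hW.two_le
  have hql := hq.length_le
  obtain ⟨t, s', l, hr, ⟨h1, h2, h3, h4, h5⟩, hb, ht⟩ := runs_loop hW.one_lt hs
    (b := var vJ <ₑ var vStop)
    (p := (assign vI (load aQueue (var vJ)) ;; assign vC (load aColour (var vI))) ;;
      assignSide false ;; assignSide true ;; assign vJ (var vJ +ₑ const 1))
    (I := fun l s' => A l s' ∧ s'.var vJ = l ∧ j ≤ l ∧ l ≤ k ∧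
      s'.var vNodes ≤ s.var vNodes + 2 * (l - j)) (Φ := fun l => 250 * (k - l)) (k₀ := j)
    ⟨by
      have e : {p : Fin m × Bool | ∃ l', j ≤ l' ∧ l' < j ∧ q[l']? = some p.1} = ∅ := by
        ext p
        simp only [Set.mem_ofPred_eq, Set.mem_empty_iff_false, iff_false, not_exists]
        rintro l ⟨h1, h2, -⟩
        omega
      rw [hA]
      simp only [e]
      constructor <;> simp, hj, le_rfl, hjk, by omega⟩
    (fun s k _ _ => by simp [Expr.Ok])
    (by
      rintro s' l hs' hv ha ⟨h1, h2, h3, h4, h5⟩ hb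
      have hst : s'.var vStop = k := (hv _ (by decide)).trans hlim
      have hlt : l < k := by
        simp only [eval, BinOp.eval, h2, hst] at hb
        by_contra e
        simp [e] at hb
      have hlq : l < q.length := by omega
      have hD' : Wired D s' := by
        refine ⟨?_, ?_, ?_, ?_, ?_⟩
        · rw [hv _ (by decide)]; exact hD.count
        · rw [hv _ (by decide)]; exact hD.edges
        · rw [ha _ (by decide)]; exact hD.colour
        · rw [ha _ (by decide)]; exact hD.rev
        · rw [ha _ (by decide)]; exact hD.edge
      have hlab' : LabelIs s' lab := fun x => by rw [ha _ (by decide)]; exact hlab x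
      have hQ : s'.arr aQueue l = q[l] := by rw [ha _ (by decide), hq.get l hlq]
      have hiB : q[l] ∈ B := hB l _ h3 hlt (List.getElem?_eq_getElem hlq)
      have hci := hcol _ hiB
      set i := q[l] with hi
      obtain ⟨t1, hr1, ht1⟩ := Program.Safe.runs
        (p := assign vI (load aQueue (var vJ)) ;; assign vC (load aColour (var vI)))
        hW.one_lt hs' (by simp [Program.Safe, Expr.Ok])
      set s₁ := (assign vI (load aQueue (var vJ)) ;; assign vC (load aColour (var vI))).run s'
        with hs₁
      have hI1 : s₁.var vI = i := by simp [hs₁, run, eval, h2, hQ]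
      have hC1 : s₁.var vC = (D.col i).toNat := by
        simp [hs₁, run, eval, h2, hQ, hD'.colour]
      have ho1 : s₁.var vOld = s.var vNodes := by
        rw [hr1.var_eq _ (by decide), hv _ (by decide), hold]
      have hn1 : s₁.var vNodes = s'.var vNodes := hr1.var_eq _ (by decide)
      have hA1 := Assigned.of_runs h1 hr1 (by decide)
      rw [← hci] at hA1
      obtain ⟨t2, s₂, hr2, ht2, hA2, hn2⟩ := assignSide_spec hW (hr1.bdd hs')
        (hD'.of_runs hr1 (by decide)) (hlab'.of_runs hr1 (by decide)) (i := i) false hA1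
        hI1 hC1 ho1 (by omega) (hci ▸ hlow i hiB false) (fun p => hci ▸ hsep p (i, false))
        (hci ▸ hup i hiB false) (hci ▸ hup' i hiB false)
      obtain ⟨t3, s₃, hr3, ht3, hA3, hn3⟩ := assignSide_spec hW (hr2.bdd (hr1.bdd hs'))
        ((hD'.of_runs hr1 (by decide)).of_runs hr2 (by decide))
        ((hlab'.of_runs hr1 (by decide)).of_runs hr2 (by decide)) (i := i) true hA2
        ((hr2.var_eq _ (by decide)).trans hI1) ((hr2.var_eq _ (by decide)).trans hC1)
        ((hr2.var_eq _ (by decide)).trans ho1)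
        (by omega) (hci ▸ hlow i hiB true) (fun p => hci ▸ hsep p (i, true))
        (hci ▸ hup i hiB true) (hci ▸ hup' i hiB true)
      have hJ3 : s₃.var vJ = l := by
        rw [hr3.var_eq _ (by decide), hr2.var_eq _ (by decide), hr1.var_eq _ (by decide), h2]
      obtain ⟨t4, hr4, ht4⟩ := Program.Safe.runs (p := assign vJ (var vJ +ₑ const 1))
        hW.one_lt (hr3.bdd (hr2.bdd (hr1.bdd hs'))) (by
          simp [Program.Safe, Expr.Ok, eval, hJ3]; omega)
      have hA4 := hA3.of_runs hr4 (by decide)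
      have hP : insert (i, true) (insert (i, false)
          {p : Fin m × Bool | ∃ l', j ≤ l' ∧ l' < l ∧ q[l']? = some p.1}) =
          {p : Fin m × Bool | ∃ l', j ≤ l' ∧ l' < l + 1 ∧ q[l']? = some p.1} := by
        ext ⟨x, b⟩
        simp only [Set.mem_insert_iff, Set.mem_ofPred_eq, Prod.mk.injEq]
        constructor
        · rintro (⟨rfl, -⟩ | ⟨rfl, -⟩ | ⟨l', e1, e2, e3⟩)
          · exact ⟨l, h3, by omega, List.getElem?_eq_getElem hlq⟩
          · exact ⟨l, h3, by omega, List.getElem?_eq_getElem hlq⟩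
          · exact ⟨l', e1, by omega, e3⟩
        · rintro ⟨l', e1, e2, e3⟩
          rcases Nat.lt_succ_iff_lt_or_eq.1 e2 with g | rfl
          · exact Or.inr (Or.inr ⟨l', e1, g, e3⟩)
          · rw [List.getElem?_eq_getElem hlq, Option.some.injEq] at e3
            cases b
            exacts [Or.inr (Or.inl ⟨e3.symm, rfl⟩), Or.inl ⟨e3.symm, rfl⟩]
      rw [hP, hci] at hA4
      refine ⟨_, _, l + 1, .seq hr1 (.seq hr2 (.seq hr3 hr4)), ⟨hA4, ?_, by omega, hlt, ?_⟩, ?_⟩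
      · simp [run, eval, BinOp.eval, hJ3]
      · rw [hr4.var_eq _ (by decide)]; omega
      · have e1 : (assign vI (load aQueue (var vJ)) ;;
          assign vC (load aColour (var vI))).time = 6 := rfl
        have e2 : (assign vJ (var vJ +ₑ const 1)).time = 4 := rfl
        have e3 : (var vJ <ₑ var vStop).cost = 3 := rfl
        omega)
  have hst : s'.var vStop = k := (hr.var_eq _ (by decide)).trans hlim
  have hlk : l = k := by
    simp only [eval, BinOp.eval, h2, hst] at hb
    by_contra e
    rw [if_pos (by omega)] at hb
    omega
  subst hlk
  have e3 : (var vJ <ₑ var vStop).cost = 3 := rfl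
  exact ⟨t, s', hr, by omega, h1, h5⟩

/-! ### The rounds -/

variable {t : Bool} {r : ℕ}

/-- The memory before round `r`, in which the edges are cut that are separated between the levels
`r` and `r + 1` and the nodes of level `r + 2` are created. In the layer of the colour of level `r`
the tours represent the classes of level `r`, in the other layer those of level `r + 1`. -/
structure RoundState (D : EdgeData n m) (t : Bool) (r : ℕ) (σ : Perm (El n m)) (lab : El n m → ℕ)
    (q : List (Fin m)) (j : ℕ) (nd : ℕ → Fin n → ℕ) (s : State) : Prop where
  cut : CutState D σ lab q j s
  done : s.var vDone = j
  le : j ≤ q.length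
  taken : ∀ i, i ∈ q.take j ↔ i ∈ D.cutSet t r
  numbering : D.Numbering t (r + 1) (s.var vNodes) nd (s.arr aParent)
    fun b i => s.arr (crossArr b) i
  node : ∀ v, s.arr aNode (lab (marker m v (levelColour t r))) = nd r v
  node_succ : ∀ v, s.arr aNode (lab (marker m v (levelColour t (r + 1)))) = nd (r + 1) v
  fresh : ∀ l, 3 + j ≤ l → s.arr aNode l = 0
  nodes_le : s.var vNodes ≤ 3 + 2 * j

section labels

variable {σ : Perm (El n m)} {lab : El n m → ℕ} {q : List (Fin m)} {j : ℕ} {s : State}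
  (h : CutState D σ lab q j s) (ht : ∀ i, i ∈ q.take j ↔ i ∈ D.cutSet t r)
include h ht

theorem CutState.label_eq_iff_level (hS : D.IsLamanSplit t) {x y : El n m}
    (hx : x.2 = levelColour t r) :
    lab x = lab y ↔ x.2 = y.2 ∧ D.Level t r (D.src x) (D.src y) := by
  rw [h.label_iff, h.tour.sameCycle_iff, hS.level_iff_conn, hx,
    show {i | i ∈ q.take j} = D.cutSet t r from Set.ext ht]
  rfl

theorem CutState.label_eq_iff_level_succ {x y : El n m} (hx : x.2 = levelColour t (r + 1)) :
    lab x = lab y ↔ x.2 = y.2 ∧ D.Level t (r + 1) (D.src x) (D.src y) := by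
  rw [h.label_iff, h.tour.sameCycle_iff, EdgeData.IsLamanSplit.level_succ_iff_conn, hx,
    show {i | i ∈ q.take j} = D.cutSet t r from Set.ext ht]
  rfl

/-- When all edges have been cut that are separated at level `r`, the queue consists of the edges
that are separated at level `r + 1`. -/
theorem CutState.mem_queue_iff (hS : D.IsLamanSplit t) (i : Fin m) :
    i ∈ q ↔ i ∈ D.cutSet t (r + 1) := by
  rw [h.mem_queue, show {i | i ∈ q.take j} = D.cutSet t r from Set.ext ht]
  rcases EdgeData.col_eq_or (t := t) i r with hc | hc
  · have : (!D.col i) = levelColour t (r + 1) := by rw [hc]; rfl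
    rw [this]
    exact not_congr (EdgeData.IsLamanSplit.level_succ_iff_conn r _ _).symm
  · have : (!D.col i) = levelColour t r := by rw [hc]; simp [levelColour]
    rw [this, EdgeData.IsLamanSplit.mem_cutSet_succ_iff hc]
    exact not_congr (hS.level_iff_conn r _ _).symm

end labels

/-- Cut all edges that are in the queue, and create the corresponding nodes. -/
def round : Program :=
  (assign vStop (var vQueued) ;; assign vOld (var vNodes) ;; assign vJ (var vDone)) ;;
    cutBatch ;; assign vJ (var vDone) ;; assignBatch ;; assign vDone (var vStop)

theorem round_spec (hW : Room n m W) (hS : D.IsLamanSplit t) {s : State} (hs : s.Bdd W)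
    {σ : Perm (El n m)} {lab : El n m → ℕ} {q : List (Fin m)} {j : ℕ} {nd : ℕ → Fin n → ℕ}
    (h : RoundState D t r σ lab q j nd s) :
    ∃ T s' σ' lab' q' nd', Runs W round s T s' ∧
      RoundState D t (r + 1) σ' lab' q' q.length nd' s' ∧
      T + 200 * logPotential σ' ≤ 200 * logPotential σ + 500 * (q.length - j) + 40 := by
  have hm := hW.count
  have hWn := hW.le
  have h2 := hW.two_le
  have hql := h.cut.queue.length_le
  have hjq := h.le
  have hnl := h.nodes_le
  set c := levelColour t r with hc
  have hc1 : levelColour t (r + 1) = !c := rfl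
  have hc2 : levelColour t (r + 2) = c := EdgeData.levelColour_add_two r
  have hcc : c ≠ !c := by cases c <;> simp
  have hq : ∀ i, i ∈ q ↔ i ∈ D.cutSet t (r + 1) := h.cut.mem_queue_iff h.taken hS
  -- the program
  obtain ⟨T1, hr1, hT1⟩ := Program.Safe.runs (p := assign vStop (var vQueued) ;;
    assign vOld (var vNodes) ;; assign vJ (var vDone)) hW.one_lt hs
    (by simp [Program.Safe, Expr.Ok])
  set s₁ := (assign vStop (var vQueued) ;; assign vOld (var vNodes) ;;
    assign vJ (var vDone)).run s with hs₁
  have hb1 := hr1.bdd hs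
  have h1 : CutState D σ lab q j s₁ :=
    ⟨h.cut.wired.of_runs hr1 (by decide), h.cut.tour, h.cut.next, h.cut.label, h.cut.label_iff,
      h.cut.label_lt, h.cut.fresh, h.cut.queue.of_runs hr1 (by decide), h.cut.mem_queue⟩
  obtain ⟨T2, s₂, σ', lab', q', hr2, h2', hpre, hlab, hT2⟩ := cutBatch_spec hW hS.forest hb1 h1
    (by simp [hs₁, run, eval, h.done]) h.le (by simp [hs₁, run, eval, h.cut.queue.length])
  have hb2 := hr2.bdd hb1
  obtain ⟨T3, hr3, hT3⟩ := Program.Safe.runs (p := assign vJ (var vDone)) hW.one_lt hb2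
    (by simp [Program.Safe, Expr.Ok])
  set s₃ := (assign vJ (var vDone)).run s₂ with hs₃
  have hb3 := hr3.bdd hb2
  have hnodes3 : s₃.var vNodes = s.var vNodes := by
    rw [hr3.var_eq _ (by decide), hr2.var_eq _ (by decide), hr1.var_eq _ (by decide)]
  have hold3 : s₃.var vOld = s.var vNodes := by
    rw [hr3.var_eq _ (by decide), hr2.var_eq _ (by decide)]
    simp [hs₁, run, eval]
  have hlim3 : s₃.var vStop = q.length := by
    rw [hr3.var_eq _ (by decide), hr2.var_eq _ (by decide)]
    simp [hs₁, run, eval, h.cut.queue.length]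
  have hJ3 : s₃.var vJ = j := by
    have : s₂.var vDone = j := by
      rw [hr2.var_eq _ (by decide), hr1.var_eq _ (by decide), h.done]
    simp [hs₃, run, eval, this]
  have harr3 : ∀ a, a ∉ cutBatch.warrs → s₃.arr a = s.arr a := by
    intro a ha
    rw [hr3.arr_eq _ (by simp [warrs]), hr2.arr_eq _ ha, hr1.arr_eq _ (by simp [warrs])]
  have hcut3 : CutState D σ' lab' q' q.length s₃ :=
    ⟨h2'.wired.of_runs hr3 (by decide), h2'.tour, h2'.next, h2'.label, h2'.label_iff,
      h2'.label_lt, h2'.fresh, h2'.queue.of_runs hr3 (by decide), h2'.mem_queue⟩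
  -- the new labels
  have htake : q'.take q.length = q := (List.prefix_iff_eq_take.1 hpre).symm
  have htaken : ∀ i, i ∈ q'.take q.length ↔ i ∈ D.cutSet t (r + 1) := by rwa [htake]
  have hbatch : ∀ i, (i ∈ q ∧ i ∉ q.take j) → i ∉ D.cutSet t r ∧ i ∈ D.cutSet t (r + 1) :=
    fun i hi => ⟨fun e => hi.2 ((h.taken i).2 e), (hq i).1 hi.1⟩
  have hcolB : ∀ i, i ∉ D.cutSet t r → i ∈ D.cutSet t (r + 1) → D.col i = c :=
    fun i => EdgeData.Realizes.col_of_cut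
  have hL0 : ∀ x y, x.2 = c → (lab x = lab y ↔ x.2 = y.2 ∧ D.Level t r (D.src x) (D.src y)) :=
    fun x y => h.cut.label_eq_iff_level h.taken hS
  have hL1 : ∀ x y, x.2 = !c → (lab x = lab y ↔
      x.2 = y.2 ∧ D.Level t (r + 1) (D.src x) (D.src y)) :=
    fun x y hx => h.cut.label_eq_iff_level_succ h.taken hx
  have hL1' : ∀ x y, x.2 = !c → (lab' x = lab' y ↔
      x.2 = y.2 ∧ D.Level t (r + 1) (D.src x) (D.src y)) :=
    fun x y hx => hcut3.label_eq_iff_level htaken hS hx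
  have hL2' : ∀ x y, x.2 = c → (lab' x = lab' y ↔
      x.2 = y.2 ∧ D.Level t (r + 2) (D.src x) (D.src y)) :=
    fun x y hx => hcut3.label_eq_iff_level_succ htaken (hx.trans hc2.symm)
  have hsame : ∀ x, x.2 = (!c) → lab' x = lab x := by
    intro x hx
    rcases hlab x with e | ⟨-, i, b, hi, hi', hxi, -⟩
    · exact e
    · obtain ⟨g1, g2⟩ := hbatch i ⟨hi, hi'⟩
      rw [hcolB i g1 g2, hx] at hxi
      exact absurd hxi.symm hcc
  have hsame' : ∀ v, ¬ D.IsNode t (r + 2) v →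
      lab' (marker m v c) = lab (marker m v c) := by
    intro v hv
    rcases hlab (marker m v c) with e | ⟨-, i, b, hi, hi', hxi, hcon⟩
    · exact e
    · obtain ⟨g1, g2⟩ := hbatch i ⟨hi, hi'⟩
      refine absurd ((EdgeData.Realizes.isNode_of_cut hS g1 b).congr ?_) hv
      rw [← hxi, show {i | i ∈ q.take j} = D.cutSet t r from Set.ext h.taken] at hcon
      exact (hS.level_iff_conn r _ _).2 hcon
  -- the nodes before the round
  have hnode3 : s₃.arr aNode = s.arr aNode := harr3 _ (by decide)
  have hpos : 0 < s.var vNodes :=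
    (Nat.zero_le _).trans_lt (h.numbering.lt 0 (by omega) ⟨0, by omega⟩)
  have hsep : ∀ p p' : Fin m × Bool, lab' (dart n p.1 p.2 c) ≠ lab' (dart n p'.1 p'.2 !c) :=
    fun p p' e => hcc ((hL2' _ _ rfl).1 e).1
  obtain ⟨T4, s₄, hr4, hT4, hA, hN4⟩ := assignBatch_spec hW hb3 hcut3.wired hcut3.label
    hcut3.queue (j := j) (k := q.length) h.le (hpre.length_le) hJ3 hlim3
    (hold3.trans hnodes3.symm) (by omega) (c := c) (up := nd (r + 1))
    (B := {i | i ∉ D.cutSet t r ∧ i ∈ D.cutSet t (r + 1)})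
    (by
      intro l i hl hl' hi
      have hi' : q[l]? = some i := by
        obtain ⟨q₂, rfl⟩ := hpre
        rwa [List.getElem?_append_left hl'] at hi
      obtain ⟨_, e⟩ := List.getElem?_eq_some_iff.1 hi'
      refine hbatch i ⟨e ▸ List.getElem_mem hl', fun g => ?_⟩
      obtain ⟨l', g1, g2⟩ := List.mem_iff_getElem.1 g
      rw [List.getElem_take] at g2
      rw [List.length_take] at g1
      have := (h.cut.queue.nodup.getElem_inj_iff (hi := by omega) (hj := hl')).1
        (g2.trans e.symm)
      omega)
    (fun i hi => hcolB i hi.1 hi.2)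
    (by
      intro i hi b
      rw [hnode3, hnodes3]
      rcases hlab (dart n i b c) with e | ⟨e, -⟩
      · rw [e, (hL0 (dart n i b c) (marker m (D.endpt i b) c) rfl).2
          ⟨rfl, EdgeData.Level.refl _ _⟩, h.node]
        exact h.numbering.lt r (by omega) _
      · rwa [h.fresh _ e])
    hsep
    (by
      intro i hi b
      rw [hnode3, hsame _ rfl, (hL1 (dart n i b !c) (marker m (D.endpt i b) !c) rfl).2
          ⟨rfl, EdgeData.Level.refl _ _⟩]
      exact h.node_succ _)
    (by
      intro i hi b p hp
      have e := ((hL2' _ _ rfl).1 hp).2.of_succ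
      rw [← h.node_succ, ← h.node_succ]
      congr 1
      exact (hL1 _ _ rfl).2 ⟨rfl, e⟩)
  rw [hnodes3, hnode3, harr3 aParent (by decide),
    show (fun b (i : Fin m) => s₃.arr (crossArr b) i) = fun b i =>
      s.arr (crossArr b) i.1 by
      funext b i; cases b <;> rw [harr3 _ (by decide)]] at hA
  rw [hnodes3] at hN4
  set P : Set (Fin m × Bool) := {p | ∃ l, j ≤ l ∧ l < q.length ∧ q'[l]? = some p.1} with hP
  have hPmem : ∀ i b, (i, b) ∈ P ↔ i ∉ D.cutSet t r ∧ i ∈ D.cutSet t (r + 1) := by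
    intro i b
    have e : ∀ l, l < q.length → q'[l]? = q[l]? := fun l hl => by
      obtain ⟨q₂, rfl⟩ := hpre
      rw [List.getElem?_append_left hl]
    rw [← h.taken, ← hq]
    constructor
    · rintro ⟨l, hl, hl', g⟩
      rw [e l hl'] at g
      obtain ⟨_, g⟩ := List.getElem?_eq_some_iff.1 g
      change q[l] = i at g
      refine ⟨fun k => ?_, g ▸ List.getElem_mem hl'⟩
      obtain ⟨l', g1, g2⟩ := List.mem_iff_getElem.1 k
      rw [List.getElem_take] at g2
      rw [List.length_take] at g1
      have := (h.cut.queue.nodup.getElem_inj_iff (hi := by omega) (hj := hl')).1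
        (g2.trans g.symm)
      omega
    · rintro ⟨g1, g2⟩
      obtain ⟨l, hl, g⟩ := List.mem_iff_getElem.1 g2
      refine ⟨l, ?_, hl, by rw [e l hl, List.getElem?_eq_getElem hl, g]⟩
      by_contra hlt
      apply g1
      rw [← g]
      exact List.mem_iff_getElem.2 ⟨l, by rw [List.length_take]; omega, List.getElem_take⟩
  obtain ⟨T5, hr5, hT5⟩ := Program.Safe.runs (p := assign vDone (var vStop)) hW.one_lt
    (hr4.bdd hb3) (by simp [Program.Safe, Expr.Ok])
  set s₅ := (assign vDone (var vStop)).run s₄ with hs₅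
  have hA5 := hA.of_runs hr5 (by decide)
  have hN5 : s₅.var vNodes = s₄.var vNodes := hr5.var_eq _ (by decide)
  -- the nodes after the round
  set f : Fin n → ℕ := fun v => s₅.arr aNode (lab' (marker m v c)) with hf
  have hdart : ∀ i b v, D.Level t (r + 2) (D.endpt i b) v →
      lab' (dart n i b c) = lab' (marker m v c) := fun i b v e => (hL2' _ _ rfl).2 ⟨rfl, e⟩
  have hexP : ∀ v, D.IsNode t (r + 2) v → ∃ p ∈ P, lab' (dart n p.1 p.2 c) =
      lab' (marker m v c) ∧ D.Level t (r + 2) (D.endpt p.1 p.2) v := by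
    intro v hv
    obtain ⟨i, b, g1, g2, g3⟩ := hS.exists_cut_level hv
    exact ⟨(i, b), (hPmem i b).2 ⟨g1, g2⟩, hdart i b v g3, g3⟩
  have hup : ∀ v w, D.Level t (r + 1) v w → nd (r + 1) v = nd (r + 1) w := by
    intro v w e
    rw [← h.node_succ, ← h.node_succ]
    congr 1
    exact (hL1 _ _ rfl).2 ⟨rfl, e⟩
  have hnum : D.Numbering t (r + 2) (s₅.var vNodes) (Function.update nd (r + 2) f)
      (s₅.arr aParent) fun b i => s₅.arr (crossArr b) i := by
    refine h.numbering.extend hpos hA5.le ?_ ?_ ?_ ?_ hA5.old_parent ?_ ?_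
    · intro v hv
      obtain ⟨p, hp, e, hl⟩ := hexP v hv
      have e1 := hA5.new_node p hp
      have e2 := hA5.parent p hp
      rw [e] at e1 e2
      exact ⟨e1.1, e1.2, e2.trans (hup _ _ hl.of_succ)⟩
    · intro v hv
      simp only [hf]
      rw [hA5.old_node, hsame' v hv, h.node]
      intro p hp e
      have e' := ((hL2' _ _ rfl).1 e).2
      exact hv ((EdgeData.Realizes.isNode_of_cut hS ((hPmem p.1 p.2).1 hp).1 p.2).congr
        (e'.anti (by omega)))
    · intro v w hv hw
      obtain ⟨p, hp, e, hl⟩ := hexP v hv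
      obtain ⟨p', hp', e', hl'⟩ := hexP w hw
      simp only [hf]
      constructor
      · intro g
        rw [← e, ← e'] at g
        have g := hA5.inj p hp p' hp' g
        rw [e, e'] at g
        exact ((hL2' _ _ rfl).1 g).2
      · intro g
        rw [(hL2' (marker m v c) (marker m w c) rfl).2 ⟨rfl, g⟩]
    · intro y hy hy'
      obtain ⟨p, hp, e⟩ := hA5.surj y hy hy'
      refine ⟨D.endpt p.1 p.2, EdgeData.Realizes.isNode_of_cut hS ((hPmem p.1 p.2).1 hp).1 p.2, ?_⟩
      simp only [hf]
      rw [← hdart p.1 p.2 _ (EdgeData.Level.refl _ _), e]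
    · intro i b g1 g2
      have := hA5.cross (i, b) ((hPmem i b).2 ⟨g1, g2⟩)
      simp only [hf]
      rw [this, ← hdart i b _ (EdgeData.Level.refl _ _)]
    · intro i b g
      exact hA5.old_cross (i, b) fun e => ((hPmem i b).1 e).1 g
  have hupd : Function.update nd (r + 2) f (r + 1) = nd (r + 1) :=
    Function.update_of_ne (by omega) _ _
  refine ⟨_, s₅, σ', lab', q', Function.update nd (r + 2) f,
    .seq hr1 (.seq hr2 (.seq hr3 (.seq hr4 hr5))),
    ⟨⟨(hcut3.wired.of_runs hr4 (by decide)).of_runs hr5 (by decide), hcut3.tour,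
      (hcut3.next.of_runs hr4 (by decide)).of_runs hr5 (by decide),
      (hcut3.label.of_runs hr4 (by decide)).of_runs hr5 (by decide), hcut3.label_iff,
      hcut3.label_lt, ?_, (hcut3.queue.of_runs hr4 (by decide)).of_runs hr5 (by decide),
      hcut3.mem_queue⟩, ?_, hpre.length_le, htaken, hnum, fun v => ?_, fun v => ?_,
      fun l hl => ?_, ?_⟩, ?_⟩
  · rw [hr5.var_eq _ (by decide), hr4.var_eq _ (by decide)]; exact hcut3.fresh
  · have : s₄.var vStop = q.length := (hr4.var_eq _ (by decide)).trans hlim3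
    simp [hs₅, run, eval, this]
  · rw [hupd, hc1, hA5.old_node, hsame _ rfl, ← h.node_succ]
    · rfl
    · exact fun p hp e => hcc ((hL2' _ _ rfl).1 e).1
  · rw [Function.update_self, hc2]
  · rw [hA5.old_node, h.fresh l (by omega)]
    intro p hp e
    have := hcut3.label_lt (dart n p.1 p.2 c)
    omega
  · omega
  · have e1 : (assign vStop (var vQueued) ;; assign vOld (var vNodes) ;;
      assign vJ (var vDone)).time = 6 := rfl
    have e2 : (assign vJ (var vDone)).time = 2 := rfl
    have e3 : (assign vDone (var vStop)).time = 2 := rfl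
    omega

/-- Repeat the rounds as long as there are edges in the queue. -/
def rounds : Program := loop (var vDone <ₑ var vQueued) round

theorem rounds_spec (hW : Room n m W) (hS : D.IsLamanSplit t) {s : State} (hs : s.Bdd W)
    {σ : Perm (El n m)} {lab : El n m → ℕ} {q : List (Fin m)} {nd : ℕ → Fin n → ℕ}
    (h : RoundState D t 0 σ lab q 0 nd s) :
    ∃ T s' r σ' lab' q' nd', Runs W rounds s T s' ∧
      RoundState D t r σ' lab' q' q'.length nd' s' ∧
      T ≤ 200 * logPotential σ + 600 * m + 10 := by
  obtain ⟨T, s', ⟨r, σ', lab', q', j, nd'⟩, hr, h1, hb, hT⟩ :=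
    runs_loop (ι := ℕ × Perm (El n m) × (El n m → ℕ) × List (Fin m) × ℕ × (ℕ → Fin n → ℕ))
    hW.one_lt hs (b := var vDone <ₑ var vQueued) (p := round)
    (I := fun k s => RoundState D t k.1 k.2.1 k.2.2.1 k.2.2.2.1 k.2.2.2.2.1 k.2.2.2.2.2 s)
    (Φ := fun k => 200 * logPotential k.2.1 + 600 * (m - k.2.2.2.2.1))
    (k₀ := (0, σ, lab, q, 0, nd)) h (fun s k _ _ => by simp [Expr.Ok])
    (by
      rintro s' ⟨r, σ', lab', q', j, nd'⟩ hs' - - h1 hb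
      simp only at h1 ⊢
      have hlt : j < q'.length := by
        simp only [eval, BinOp.eval, h1.done, h1.cut.queue.length] at hb
        by_contra e
        simp [e] at hb
      obtain ⟨T, s₂, σ₂, lab₂, q₂, nd₂, hr, h2, hT⟩ := round_spec hW hS hs' h1
      have := h1.cut.queue.length_le
      have e : (var vDone <ₑ var vQueued).cost = 3 := rfl
      refine ⟨T, s₂, (r + 1, σ₂, lab₂, q₂, q'.length, nd₂), hr, h2, ?_⟩
      dsimp only
      omega)
  simp only at h1 hT
  have hj : j = q'.length := by
    have := h1.le
    simp only [eval, BinOp.eval, h1.done, h1.cut.queue.length] at hb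
    by_contra e
    rw [if_pos (by omega)] at hb
    omega
  subst hj
  have e : (var vDone <ₑ var vQueued).cost = 3 := rfl
  exact ⟨T, s', r, σ', lab', q', nd', hr, h1, by omega⟩

/-! ### Counting loops -/

/-- Run `p` for all values of the variable `x` from `0` to the value of the variable `y` minus
`1`. -/
def forLoop (x y : ℕ) (p : Program) : Program :=
  assign x (const 0) ;; loop (var x <ₑ var y) (p ;; assign x (var x +ₑ const 1))

theorem forLoop_spec (hW : 1 < W) {s₀ : State} (hs₀ : s₀.Bdd W) {x y : ℕ} {p : Program}
    (hx : x ∉ p.wvars) (hy : y ∉ p.wvars) (hxy : y ≠ x) (I : ℕ → State → Prop) (T : ℕ)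
    (hI : ∀ k s v, I k s → I k (s.setVar x v)) (h₀ : I 0 s₀)
    (step : ∀ k s, k < s₀.var y → s.Bdd W → (∀ z, z ≠ x → z ∉ p.wvars → s.var z = s₀.var z) →
      (∀ a, a ∉ p.warrs → s.arr a = s₀.arr a) → I k s → s.var x = k →
      ∃ t s', Runs W p s t s' ∧ t ≤ T ∧ I (k + 1) s') :
    ∃ t s', Runs W (forLoop x y p) s₀ t s' ∧ t ≤ (T + 8) * s₀.var y + 8 ∧ I (s₀.var y) s' := by
  have hyW := hs₀.1 y
  obtain ⟨t1, hr1, ht1⟩ := Program.Safe.runs (p := assign x (const 0)) hW hs₀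
    (by simp [Program.Safe, Expr.Ok]; omega)
  have hvar1 : ∀ z, z ≠ x → ((assign x (const 0)).run s₀).var z = s₀.var z := fun z hz => by
    simp [run, hz]
  have hnot : ∀ z, z ≠ x → z ∉ p.wvars → z ∉ (p ;; assign x (var x +ₑ const 1)).wvars :=
    fun z h1 h2 => by simp [wvars, h1, h2]
  obtain ⟨t2, s', k, hr2, ⟨h1, h2, h3⟩, hb, ht2⟩ := runs_loop hW (hr1.bdd hs₀)
    (b := var x <ₑ var y) (p := p ;; assign x (var x +ₑ const 1))
    (I := fun k s => I k s ∧ s.var x = k ∧ k ≤ s₀.var y)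
    (Φ := fun k => (T + 8) * (s₀.var y - k)) (k₀ := 0)
    ⟨hI _ _ _ h₀, by simp [run, eval], Nat.zero_le _⟩ (fun s k _ _ => by simp [Expr.Ok])
    (by
      rintro s k hs hv ha ⟨h1, h2, h3⟩ hb
      have hyk : s.var y = s₀.var y := by rw [hv _ (hnot y hxy hy), hvar1 y hxy]
      have hlt : k < s₀.var y := by
        simp only [eval, BinOp.eval, h2, hyk] at hb
        by_contra e
        simp [e] at hb
      obtain ⟨t, s', hr, ht, hI'⟩ := step k s hlt hs
        (fun z hz hz' => (hv z (hnot z hz hz')).trans (hvar1 z hz))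
        (fun a e => ha a (by simp [warrs, e])) h1 h2
      have hx' : s'.var x = k := (hr.var_eq _ hx).trans h2
      obtain ⟨t', hr', ht'⟩ := Program.Safe.runs (p := assign x (var x +ₑ const 1)) hW
        (hr.bdd hs) (by simp [Program.Safe, Expr.Ok, eval, hx']; omega)
      refine ⟨_, _, k + 1, .seq hr hr', ⟨hI _ _ _ hI', by simp [run, eval, BinOp.eval, hx'], hlt⟩,
        ?_⟩
      have e1 : (assign x (var x +ₑ const 1)).time = 4 := rfl
      have e2 : (var x <ₑ var y).cost = 3 := rfl
      obtain ⟨d, hd⟩ : ∃ d, s₀.var y = k + 1 + d := Nat.exists_eq_add_of_le hlt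
      rw [hd, show k + 1 + d - k = d + 1 by omega, show k + 1 + d - (k + 1) = d by omega,
        Nat.mul_succ]
      omega)
  have hyk : s'.var y = s₀.var y := by rw [hr2.var_eq _ (hnot y hxy hy), hvar1 y hxy]
  have hk : k = s₀.var y := by
    simp only [eval, BinOp.eval, h2, hyk] at hb
    by_contra e
    rw [if_pos (by omega)] at hb
    omega
  subst hk
  have e1 : (assign x (const 0)).time = 2 := rfl
  have e2 : (var x <ₑ var y).cost = 3 := rfl
  simp only [Nat.sub_zero, Nat.sub_self, Nat.mul_zero] at ht2
  exact ⟨_, s', .seq hr1 hr2, by omega, h1⟩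

/-! ### The leaves -/

/-- For every vertex, record the larger one of its two current nodes as its leaf. -/
def recordLeaves : Program :=
  forLoop vI vCount
    (assign vA (load aNode (load aLabel (var vI +ₑ var vI))) ;;
      assign vB (load aNode (load aLabel (var vI +ₑ var vI +ₑ const 1))) ;;
      ite (var vA <ₑ var vB) (store aLeaf (var vI) (var vB)) (store aLeaf (var vI) (var vA)))

theorem recordLeaves_spec (hW : Room n m W) {s : State} (hs : s.Bdd W) (hn : s.var vCount = n)
    {lab : El n m → ℕ} (hlab : LabelIs s lab) :
    ∃ t s', Runs W recordLeaves s t s' ∧ t ≤ 50 * n + 10 ∧ ∀ v : Fin n, s'.arr aLeaf v =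
      max (s.arr aNode (lab (marker m v false))) (s.arr aNode (lab (marker m v true))) := by
  have hWn := hW.le
  obtain ⟨t, s', hr, ht, hI⟩ := forLoop_spec hW.one_lt hs (x := vI) (y := vCount)
    (p := assign vA (load aNode (load aLabel (var vI +ₑ var vI))) ;;
      assign vB (load aNode (load aLabel (var vI +ₑ var vI +ₑ const 1))) ;;
      ite (var vA <ₑ var vB) (store aLeaf (var vI) (var vB)) (store aLeaf (var vI) (var vA)))
    (by decide) (by decide) (by decide)
    (fun k s' => ∀ v : Fin n, v < k → s'.arr aLeaf v =
      max (s.arr aNode (lab (marker m v false))) (s.arr aNode (lab (marker m v true)))) 40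
    (fun k s v h => h) (fun v hv => by omega)
    (by
      intro k s' hk hs' hv ha hI hX
      rw [hn] at hk
      obtain ⟨t, hr, ht⟩ := Program.Safe.runs (p := assign vA (load aNode (load aLabel
          (var vI +ₑ var vI))) ;;
        assign vB (load aNode (load aLabel (var vI +ₑ var vI +ₑ const 1))) ;;
        ite (var vA <ₑ var vB) (store aLeaf (var vI) (var vB)) (store aLeaf (var vI) (var vA)))
        hW.one_lt hs' (by
          simp [Program.Safe, Expr.Ok, run, eval, BinOp.eval, hX]; omega)
      refine ⟨t, _, hr, ht.trans (by decide), fun v hv => ?_⟩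
      have e1 : s'.arr aNode = s.arr aNode := ha _ (by decide)
      have e2 : s'.arr aLabel = s.arr aLabel := ha _ (by decide)
      have e3 : s.arr aLabel (k + k) = lab (marker m ⟨k, hk⟩ false) := by
        rw [← hlab]; simp [enc, marker]
      have e4 : s.arr aLabel (k + k + 1) = lab (marker m ⟨k, hk⟩ true) := by
        rw [← hlab]; simp [enc, marker]
      by_cases hvk : v.1 = k
      · obtain rfl : v = ⟨k, hk⟩ := Fin.ext hvk
        by_cases hlt : s.arr aNode (lab (marker m ⟨k, hk⟩ false)) <
            s.arr aNode (lab (marker m ⟨k, hk⟩ true))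
        · simp [run, eval, BinOp.eval, hX, e1, e2, e3, e4, hlt, hlt.le]
        · simp [run, eval, BinOp.eval, hX, e1, e2, e3, e4, hlt, not_lt.1 hlt]
      · have := hI v (by omega)
        by_cases hlt : s.arr aNode (lab (marker m ⟨k, hk⟩ false)) <
            s.arr aNode (lab (marker m ⟨k, hk⟩ true)) <;>
          simp [run, eval, BinOp.eval, hX, e1, e2, e3, e4, hlt, hvk, this])
  rw [hn] at ht hI
  exact ⟨t, s', hr, by omega, fun v => hI v v.2⟩

/-! ### The initial tours -/

/-- The index of the dart of the edge `vI` at its end `b` in layer `c`. -/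
def dartIndex (b c : Bool) : Expr :=
  var vCount +ₑ var vCount +ₑ (var vI +ₑ var vI +ₑ (var vI +ₑ var vI)) +ₑ
    const (b.toNat + b.toNat) +ₑ const c.toNat

/-- The array of the ends on side `b` of the edges. -/
def endArr (b : Bool) : ℕ := if b then aHead else aTail

/-- Insert the dart of the edge `vI` at its end `b` in layer `c` into the cycle of the marker of
this end. -/
def insertDart (b c : Bool) : Program :=
  (assign vA (load (endArr b) (var vI) +ₑ load (endArr b) (var vI) +ₑ const c.toNat) ;;
    assign vB (dartIndex b c)) ;; swapNext ;;
    store aRev (var vB) (dartIndex (!b) c) ;; store aEdge (var vB) (var vI)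

/-- The memory when the elements of `I` have been inserted into the cycles of the markers. -/
structure Inserted (D : EdgeData n m) (I : Set (El n m)) (σ : Perm (El n m)) (s : State) :
    Prop where
  count : s.var vCount = n
  ends : ∀ i b, s.arr (endArr b) (i : Fin m) = D.endpt i b
  star : D.Star I σ
  next : NextIs s σ
  rev : ∀ x ∈ I, s.arr aRev (enc x) = enc (rev x)
  edge : ∀ i b c, dart n i b c ∈ I → s.arr aEdge (enc (dart n i b c)) = i
  marker : ∀ v c, marker m v c ∈ I

theorem insertDart_spec (hW : Room n m W) {s : State} (hs : s.Bdd W) {I : Set (El n m)}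
    {σ : Perm (El n m)} (h : Inserted D I σ s) {i : Fin m} (hI : s.var vI = i) (b c : Bool)
    (hx : dart n i b c ∉ I) : ∃ t s' σ', Runs W (insertDart b c) s t s' ∧ t ≤ 80 ∧
      Inserted D (insert (dart n i b c) I) σ' s' := by
  have hm := hW.count
  have hWn := hW.le
  have hi := i.2
  have h2 := hW.two_le
  have hcl := Bool.toNat_lt c
  have hbl := Bool.toNat_lt b
  have hbl' := Bool.toNat_lt (!b)
  have hv := (D.endpt i b).2
  have hn := h.count
  have he := h.ends i b
  obtain ⟨t1, hr1, ht1⟩ := Program.Safe.runs (p := assign vA (load (endArr b) (var vI) +ₑ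
    load (endArr b) (var vI) +ₑ const c.toNat) ;; assign vB (dartIndex b c)) hW.one_lt hs (by
      simp [Program.Safe, Expr.Ok, dartIndex, run, eval, BinOp.eval, hI, hn, he]; omega)
  set s₁ := (assign vA (load (endArr b) (var vI) +ₑ load (endArr b) (var vI) +ₑ const c.toNat) ;;
    assign vB (dartIndex b c)).run s with hs₁
  have hA : s₁.var vA = enc (marker m (D.endpt i b) c) := by
    simp [hs₁, run, eval, BinOp.eval, hI, he, enc, marker]
  have hB : s₁.var vB = enc (dart n i b c) := by
    simp [hs₁, run, dartIndex, eval, BinOp.eval, hI, hn, enc, dart]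
  have hb1 := hr1.bdd hs
  obtain ⟨t2, s₂, hr2, ht2, hσ⟩ := swapNext_spec hW.one_lt hb1
    (h.next.of_runs hr1 (by simp [warrs])) hA hB
  have hb2 := hr2.bdd hb1
  have hB2 : s₂.var vB = enc (dart n i b c) := (hr2.var_eq _ (by decide)).trans hB
  have hI2 : s₂.var vI = i := by
    rw [hr2.var_eq _ (by decide), hr1.var_eq _ (by simp [wvars]), hI]
  have hn2 : s₂.var vCount = n := by
    rw [hr2.var_eq _ (by decide), hr1.var_eq _ (by simp [wvars]), hn]
  have harr2 : ∀ a, a ≠ aNext → s₂.arr a = s.arr a := by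
    intro a ha
    rw [hr2.arr_eq _ (by simp [swapNext, warrs, ha]), hr1.arr_eq _ (by simp [warrs])]
  have hR : ∀ s : State, s.var vI = i.1 → s.var vCount = n →
      (dartIndex (!b) c).eval s = enc (dart n i (!b) c) := by
    intro s e1 e2
    simp [dartIndex, eval, BinOp.eval, e1, e2, enc, dart]
  obtain ⟨t3, hr3, ht3⟩ := Program.Safe.runs (p := store aRev (var vB) (dartIndex (!b) c) ;;
    store aEdge (var vB) (var vI)) hW.one_lt hb2 (by
      simp [Program.Safe, Expr.Ok, dartIndex, eval, BinOp.eval, hI2, hn2]; omega)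
  set s₃ := (store aRev (var vB) (dartIndex (!b) c) ;; store aEdge (var vB) (var vI)).run s₂
    with hs₃
  have hrev3 : ∀ x : El n m, s₃.arr aRev (enc x) =
      if x = dart n i b c then enc (dart n i (!b) c) else s.arr aRev (enc x) := by
    intro x
    simp [hs₃, run, eval, hB2, hR s₂ hI2 hn2, Function.update_apply, enc_inj, harr2]
  have hedge3 : ∀ x : El n m, s₃.arr aEdge (enc x) =
      if x = dart n i b c then i.1 else s.arr aEdge (enc x) := by
    intro x
    simp [hs₃, run, eval, hB2, hI2, Function.update_apply, enc_inj, harr2]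
  have hends : ∀ b, endArr b ≠ aNext ∧ endArr b ≠ aRev ∧ endArr b ≠ aEdge := by decide
  refine ⟨_, s₃, _, .seq hr1 (.seq hr2 hr3), ?_, ?_, fun j b' => ?_,
    h.star.insert hx (h.marker _ c) rfl rfl, hσ.of_runs hr3 (by simp [warrs]), fun x hx' => ?_,
    fun j b' c' hx' => ?_, fun v c => Set.mem_insert_of_mem _ (h.marker v c)⟩
  · have e1 : (assign vA (load (endArr b) (var vI) +ₑ load (endArr b) (var vI) +ₑ const c.toNat) ;;
      assign vB (dartIndex b c)).time = 24 := rfl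
    have e2 : (store aRev (var vB) (dartIndex (!b) c) ;; store aEdge (var vB) (var vI)).time =
      20 := rfl
    omega
  · rw [hr3.var_eq _ (by simp [wvars]), hn2]
  · rw [hr3.arr_eq _ (by simp [warrs, hends b']), harr2 _ (hends b').1, h.ends]
  · rw [hrev3]
    split_ifs with e
    · rw [e]; rfl
    · exact h.rev x (hx'.resolve_left e)
  · rw [hedge3]
    split_ifs with e
    · simp only [dart, Prod.mk.injEq, Sum.inr.injEq] at e
      rw [e.1.1]
    · exact h.edge j b' c' (hx'.resolve_left e)

/-- Insert the darts of all edges. -/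
def insertDarts : Program :=
  forLoop vI vEdges
    (insertDart false false ;; insertDart false true ;; insertDart true false ;;
      insertDart true true)

theorem insertDarts_spec (hW : Room n m W) {s : State} (hs : s.Bdd W)
    (hm : s.var vEdges = m) (h : Inserted D {x | ∃ v c, x = marker m v c} 1 s) :
    ∃ t s' σ, Runs W insertDarts s t s' ∧ t ≤ 400 * m + 10 ∧ Inserted D Set.univ σ s' := by
  obtain ⟨t, s', hr, ht, σ, hI⟩ := forLoop_spec hW.one_lt hs (x := vI) (y := vEdges)
    (p := insertDart false false ;; insertDart false true ;; insertDart true false ;;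
      insertDart true true) (by decide) (by decide) (by decide)
    (fun k s' => ∃ σ, Inserted D {x | ∀ i b c, x = dart n i b c → i < k} σ s') 350
    (by
      rintro k s v ⟨σ, h⟩
      exact ⟨σ, by simpa using h.count, h.ends, h.star, h.next, h.rev, h.edge, h.marker⟩)
    ⟨1, by
      have e : {x : El n m | ∀ i b c, x = dart n i b c → i.1 < 0} =
          {x | ∃ v c, x = marker m v c} := by
        ext ⟨v | ⟨i, b⟩, c⟩
        · exact ⟨fun _ => ⟨v, c, rfl⟩, fun _ i b c' e => by simp [dart] at e⟩
        · exact ⟨fun e => absurd (e i b c rfl) (by omega), by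
            rintro ⟨v, c', e⟩; simp [marker] at e⟩
      rwa [e]⟩
    (by
      rintro k s' hk hs' hv ha ⟨σ, h⟩ hX
      rw [hm] at hk
      have hnot : ∀ b c, dart n (⟨k, hk⟩ : Fin m) b c ∉
          {x : El n m | ∀ i b c, x = dart n i b c → i.1 < k} := fun b c e =>
        lt_irrefl k (e _ b c rfl)
      have hne : ∀ b c b' c', (b, c) ≠ (b', c') →
          dart n (⟨k, hk⟩ : Fin m) b c ≠ dart n ⟨k, hk⟩ b' c' := by
        intro b c b' c' e e'
        simp only [dart, Prod.mk.injEq, Sum.inr.injEq, true_and] at e'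
        exact e (Prod.ext e'.1 e'.2)
      have hX : s'.var vI = (⟨k, hk⟩ : Fin m).1 := hX
      obtain ⟨t1, s₁, σ₁, hr1, ht1, h1⟩ := insertDart_spec hW hs' h hX false false (hnot _ _)
      obtain ⟨t2, s₂, σ₂, hr2, ht2, h2⟩ := insertDart_spec hW (hr1.bdd hs') h1 (i := ⟨k, hk⟩)
        ((hr1.var_eq _ (by decide)).trans hX) false true
        (by simp only [Set.mem_insert_iff, not_or]
            exact ⟨hne _ _ _ _ (by decide), hnot _ _⟩)
      obtain ⟨t3, s₃, σ₃, hr3, ht3, h3⟩ := insertDart_spec hW (hr2.bdd (hr1.bdd hs')) h2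
        (i := ⟨k, hk⟩)
        ((hr2.var_eq _ (by decide)).trans ((hr1.var_eq _ (by decide)).trans hX)) true false
        (by simp only [Set.mem_insert_iff, not_or]
            exact ⟨hne _ _ _ _ (by decide), hne _ _ _ _ (by decide), hnot _ _⟩)
      obtain ⟨t4, s₄, σ₄, hr4, ht4, h4⟩ := insertDart_spec hW
        (hr3.bdd (hr2.bdd (hr1.bdd hs'))) h3 (i := ⟨k, hk⟩)
        ((hr3.var_eq _ (by decide)).trans ((hr2.var_eq _ (by decide)).trans
          ((hr1.var_eq _ (by decide)).trans hX))) true true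
        (by simp only [Set.mem_insert_iff, not_or]
            exact ⟨hne _ _ _ _ (by decide), hne _ _ _ _ (by decide), hne _ _ _ _ (by decide),
              hnot _ _⟩)
      refine ⟨_, s₄, .seq hr1 (.seq hr2 (.seq hr3 hr4)), by omega, σ₄, ?_⟩
      convert h4 using 1
      ext ⟨v | ⟨i, b⟩, c⟩
      · simp [dart]
      · have : (∀ i' b' c', ((Sum.inr (i, b), c) : El n m) = dart n i' b' c' → i'.1 < k + 1) ↔
            i.1 < k + 1 := by simp [dart]
        rw [Set.mem_ofPred_eq, this]
        simp only [Set.mem_insert_iff, Set.mem_ofPred_eq]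
        have : (∀ i' b' c', ((Sum.inr (i, b), c) : El n m) = dart n i' b' c' → i'.1 < k) ↔
            i.1 < k := by simp [dart]
        rw [this, Nat.lt_succ_iff_lt_or_eq]
        simp only [dart, Prod.mk.injEq, Sum.inr.injEq, Fin.ext_iff]
        cases b <;> cases c <;> simp [or_comm])
  rw [hm] at ht hI
  refine ⟨t, s', σ, hr, by omega, ?_⟩
  convert hI
  ext x
  simp

/-! ### The initialization -/

theorem exists_enc_eq_add (x : El n m) : ∃ k < n + (m + m), enc x = k + k + x.2.toNat := by
  obtain ⟨v | ⟨i, b⟩, c⟩ := x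
  · exact ⟨v, by omega, rfl⟩
  · have := Bool.toNat_lt b
    exact ⟨n + (i + i) + b.toNat, by omega, by simp only [enc]; omega⟩

/-- Let every element be its own successor and its own reversal. -/
def fill : Program :=
  forLoop vX vSize
    (store aNext (var vX +ₑ var vX) (var vX +ₑ var vX) ;;
      store aNext (var vX +ₑ var vX +ₑ const 1) (var vX +ₑ var vX +ₑ const 1) ;;
      store aRev (var vX +ₑ var vX) (var vX +ₑ var vX) ;;
      store aRev (var vX +ₑ var vX +ₑ const 1) (var vX +ₑ var vX +ₑ const 1))

theorem fill_spec (hW : Room n m W) {s : State} (hs : s.Bdd W) (hsz : s.var vSize = n + (m + m)) :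
    ∃ t s', Runs W fill s t s' ∧ t ≤ 60 * (n + (m + m)) + 8 ∧ ∀ x : El n m,
      s'.arr aNext (enc x) = enc x ∧ s'.arr aRev (enc x) = enc x := by
  have hm := hW.count
  have hWn := hW.le
  obtain ⟨t, s', hr, ht, hI⟩ := forLoop_spec hW.one_lt hs (x := vX) (y := vSize)
    (p := store aNext (var vX +ₑ var vX) (var vX +ₑ var vX) ;;
      store aNext (var vX +ₑ var vX +ₑ const 1) (var vX +ₑ var vX +ₑ const 1) ;;
      store aRev (var vX +ₑ var vX) (var vX +ₑ var vX) ;;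
      store aRev (var vX +ₑ var vX +ₑ const 1) (var vX +ₑ var vX +ₑ const 1))
    (by decide) (by decide) (by decide)
    (fun k s' => ∀ l < k + k, s'.arr aNext l = l ∧ s'.arr aRev l = l) 52
    (fun k s v h => h) (fun l hl => by omega)
    (by
      intro k s' hk hs' hv ha hI hX
      obtain ⟨t, hr, ht⟩ := Program.Safe.runs
        (p := store aNext (var vX +ₑ var vX) (var vX +ₑ var vX) ;;
          store aNext (var vX +ₑ var vX +ₑ const 1) (var vX +ₑ var vX +ₑ const 1) ;;
          store aRev (var vX +ₑ var vX) (var vX +ₑ var vX) ;;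
          store aRev (var vX +ₑ var vX +ₑ const 1) (var vX +ₑ var vX +ₑ const 1))
        hW.one_lt hs' (by
          simp [Program.Safe, Expr.Ok, run, eval, BinOp.eval, hX]; omega)
      refine ⟨t, _, hr, ht.trans (by decide), fun l hl => ?_⟩
      simp only [run, eval, BinOp.eval, State.setArr_arr, State.setArr_var, hX]
      by_cases e1 : l = k + k + 1
      · simp [e1]
      · by_cases e2 : l = k + k
        · simp [e2]
        · simp [e1, e2, hI l (by omega)])
  rw [hsz] at ht hI
  refine ⟨t, s', hr, by omega, fun x => hI _ ?_⟩
  obtain ⟨k, hk, e⟩ := exists_enc_eq_add x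
  have := Bool.toNat_lt x.2
  omega

/-- Link the tours by all edges, and count the edges of colour `true`. -/
def linkEdges : Program :=
  assign vSum (const 0) ;;
    forLoop vI vEdges (locate ;; swapNext ;; assign vSum (var vSum +ₑ load aColour (var vI)))

theorem linkEdges_spec (hW : Room n m W) (hF : ∀ c, D.IsForest c) {s : State} (hs : s.Bdd W)
    (hD : Wired D s) {σ : Perm (El n m)} (hσ : NextIs s σ) (ht : D.Tour Set.univ σ) :
    ∃ T s' σ', Runs W linkEdges s T s' ∧ T ≤ 100 * m + 20 ∧ NextIs s' σ' ∧ D.Tour ∅ σ' ∧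
      s'.var vSum = (Finset.univ.filter fun i => D.col i = true).card := by
  have hm := hW.count
  have hWn := hW.le
  obtain ⟨T1, hr1, hT1⟩ := Program.Safe.runs (p := assign vSum (const 0)) hW.one_lt hs
    (by have := hW.two_le; simp [Program.Safe, Expr.Ok]; omega)
  have hE1 : ((assign vSum (const 0)).run s).var vEdges = m := by simp [run, hD.edges]
  have hD1 := hD.of_runs hr1 (by decide)
  obtain ⟨T2, s', hr2, hT2, σ', h1, h2, h3⟩ := forLoop_spec hW.one_lt (hr1.bdd hs) (x := vI)
    (y := vEdges)
    (p := locate ;; swapNext ;; assign vSum (var vSum +ₑ load aColour (var vI)))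
    (by decide) (by decide) (by decide)
    (fun k s' => ∃ σ' : Perm (El n m), NextIs s' σ' ∧ D.Tour {j | k ≤ j.1} σ' ∧
      s'.var vSum = (Finset.univ.filter fun i => i.1 < k ∧ D.col i = true).card) 80
    (by
      rintro k s v ⟨σ, h1, h2, h3⟩
      exact ⟨σ, h1, h2, by simpa using h3⟩)
    ⟨σ, hσ.of_runs hr1 (by decide), by simpa using ht, by simp [run, eval]⟩
    (by
      rintro k s' hk hs' hv ha ⟨σ', h1, h2, h3⟩ hX
      rw [hE1] at hk
      have hD' : Wired D s' := by
        refine ⟨?_, ?_, ?_, ?_, ?_⟩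
        · rw [hv _ (by decide) (by decide)]; exact hD1.count
        · rw [hv _ (by decide) (by decide)]; exact hD1.edges
        · rw [ha _ (by decide)]; exact hD1.colour
        · rw [ha _ (by decide)]; exact hD1.rev
        · rw [ha _ (by decide)]; exact hD1.edge
      obtain ⟨t1, s₁, hr1, ht1, hA, hB⟩ := locate_spec hW hs' hD' (i := ⟨k, hk⟩) hX
      obtain ⟨t2, s₂, hr2, ht2, hσ2⟩ := swapNext_spec hW.one_lt (hr1.bdd hs')
        (h1.of_runs hr1 (by decide)) hA hB
      have hX2 : s₂.var vI = k := by
        rw [hr2.var_eq _ (by decide), hr1.var_eq _ (by decide), hX]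
      have hS2 : s₂.var vSum = (Finset.univ.filter fun i => i.1 < k ∧ D.col i = true).card := by
        rw [hr2.var_eq _ (by decide), hr1.var_eq _ (by decide), h3]
      have hcol2 : s₂.arr aColour k = (D.col ⟨k, hk⟩).toNat := by
        rw [hr2.arr_eq _ (by decide), hr1.arr_eq _ (by decide)]
        exact hD'.colour ⟨k, hk⟩
      have hle : (Finset.univ.filter fun i : Fin m => i.1 < k ∧ D.col i = true).card ≤ m := by
        simpa using Finset.card_le_univ
          (Finset.univ.filter fun i : Fin m => i.1 < k ∧ D.col i = true)
      have hlt := Bool.toNat_lt (D.col ⟨k, hk⟩)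
      obtain ⟨t3, hr3, ht3⟩ := Program.Safe.runs
        (p := assign vSum (var vSum +ₑ load aColour (var vI))) hW.one_lt (hr2.bdd (hr1.bdd hs'))
        (by simp [Program.Safe, Expr.Ok, eval, hX2, hS2, hcol2]; omega)
      have hins : insert (⟨k, hk⟩ : Fin m) {j : Fin m | k + 1 ≤ j.1} = {j | k ≤ j.1} := by
        ext j
        simp only [Set.mem_insert_iff, Set.mem_ofPred_eq, Fin.ext_iff]
        omega
      refine ⟨_, _, .seq hr1 (.seq hr2 hr3), ?_, _, hσ2.of_runs hr3 (by decide),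
        EdgeData.Tour.link (hins.symm ▸ h2) ?_ ?_, ?_⟩
      · have e : (assign vSum (var vSum +ₑ load aColour (var vI))).time = 5 := rfl
        omega
      · simp
      · refine fun e => hF _ ⟨k, hk⟩ rfl (e.mono fun j hj => ⟨hj.1, ?_⟩)
        rintro rfl
        exact hj.2 (Set.mem_insert _ _)
      · have e : (Finset.univ.filter fun i : Fin m => i.1 < k + 1 ∧ D.col i = true) =
            if D.col ⟨k, hk⟩ = true then
              insert ⟨k, hk⟩ (Finset.univ.filter fun i : Fin m => i.1 < k ∧ D.col i = true)
            else Finset.univ.filter fun i : Fin m => i.1 < k ∧ D.col i = true := by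
          split_ifs with hc
          · ext i
            simp only [Finset.mem_filter, Finset.mem_univ, true_and, Finset.mem_insert]
            rw [Nat.lt_succ_iff_lt_or_eq]
            constructor
            · rintro ⟨g | g, g'⟩
              exacts [Or.inr ⟨g, g'⟩, Or.inl (Fin.ext g)]
            · rintro (rfl | ⟨g, g'⟩)
              exacts [⟨Or.inr rfl, hc⟩, ⟨Or.inl g, g'⟩]
          · ext i
            simp only [Finset.mem_filter, Finset.mem_univ, true_and]
            refine ⟨fun g => ⟨?_, g.2⟩, fun g => ⟨by omega, g.2⟩⟩
            have : i.1 ≠ k := by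
              rintro rfl
              exact hc g.2
            omega
        rw [e]
        simp only [run, eval, BinOp.eval, State.setVar_var, if_true, hS2, hX2, hcol2]
        cases hc : D.col ⟨k, hk⟩
        · simp
        · rw [if_pos rfl, Finset.card_insert_of_notMem (by simp)]; rfl)
  rw [hE1] at hT2 h2 h3
  refine ⟨_, s', σ', .seq hr1 hr2, ?_, h1, ?_, ?_⟩
  · have e : (assign vSum (const 0)).time = 2 := rfl
    omega
  · convert h2
    ext j
    simp
  · rw [h3]
    congr 1
    ext j
    simp

/-- Give the label `1` to all elements of the layer `vOther`. -/
def labelLayer : Program :=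
  forLoop vX vSize (store aLabel (var vX +ₑ var vX +ₑ var vOther) (const 1))

theorem labelLayer_spec (hW : Room n m W) {s : State} (hs : s.Bdd W)
    (hsz : s.var vSize = n + (m + m)) {o : Bool} (ho : s.var vOther = o.toNat)
    (hl : LabelIs (n := n) (m := m) s fun _ => 0) :
    ∃ t s', Runs W labelLayer s t s' ∧ t ≤ 20 * (n + (m + m)) + 8 ∧
      LabelIs (n := n) (m := m) s' fun x => if x.2 = o then 1 else 0 := by
  have hm := hW.count
  have hWn := hW.le
  have hol := Bool.toNat_lt o
  have tn : ∀ {a b : Bool}, a.toNat = b.toNat → a = b := by decide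
  obtain ⟨t, s', hr, ht, hI⟩ := forLoop_spec hW.one_lt hs (x := vX) (y := vSize)
    (p := store aLabel (var vX +ₑ var vX +ₑ var vOther) (const 1))
    (by decide) (by decide) (by decide)
    (fun k s' => ∀ x : El n m, s'.arr aLabel (enc x) =
      if x.2 = o ∧ enc x < k + k + o.toNat then 1 else 0) 12
    (fun k s v h => h)
    (fun x => by
      rw [hl x, if_neg]
      rintro ⟨e, h⟩
      obtain ⟨k, -, hk⟩ := exists_enc_eq_add x
      rw [hk, e] at h
      omega)
    (by
      intro k s' hk hs' hv ha hI hX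
      have ho' : s'.var vOther = o.toNat := (hv _ (by decide) (by decide)).trans ho
      obtain ⟨t, hr, ht⟩ := Program.Safe.runs
        (p := store aLabel (var vX +ₑ var vX +ₑ var vOther) (const 1))
        hW.one_lt hs' (by
          have := hW.two_le
          simp [Program.Safe, Expr.Ok, eval, BinOp.eval, hX, ho']; omega)
      refine ⟨t, _, hr, ht.trans (by decide), fun x => ?_⟩
      obtain ⟨l, -, hl⟩ := exists_enc_eq_add x
      have hxl := Bool.toNat_lt x.2
      simp only [run, eval, BinOp.eval, State.setArr_arr, hX, ho', if_true, Function.update_apply,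
        hI x]
      by_cases e : enc x = k + k + o.toNat
      · have : x.2 = o := tn (by omega)
        rw [if_pos e, if_pos ⟨this, by omega⟩]
      · rw [if_neg e]
        refine if_congr (and_congr_right fun hx => ?_) rfl rfl
        rw [hx] at hl
        omega)
  rw [hsz] at ht hI
  refine ⟨t, s', hr, by omega, fun x => ?_⟩
  rw [hI x]
  refine if_congr (and_iff_left_of_imp fun hx => ?_) rfl rfl
  obtain ⟨l, hl, hl'⟩ := exists_enc_eq_add x
  rw [hx] at hl'
  omega

/-- The initial memory, which contains the edges. -/
structure Fed (D : EdgeData n m) (s : State) : Prop where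
  count : s.var vCount = n
  ends : ∀ i b, s.arr (endArr b) (i : Fin m) = D.endpt i b
  colour : ∀ i : Fin m, s.arr aColour i = (D.col i).toNat
  var_eq_zero : ∀ x, 2 ≤ x → s.var x = 0
  arr_eq_zero : ∀ a, 3 ≤ a → ∀ i, s.arr a i = 0

/-- Build the tours of all components. -/
def buildTours : Program :=
  (assign vEdges (var vCount +ₑ var vCount -ₑ const 3) ;;
    assign vSize (var vCount +ₑ (var vEdges +ₑ var vEdges))) ;; fill ;; insertDarts ;; linkEdges

theorem buildTours_spec (hW : Room n m W) (hF : ∀ c, D.IsForest c) {s : State} (hs : s.Bdd W)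
    (h : Fed D s) : ∃ T s' σ, Runs W buildTours s T s' ∧ T ≤ 2000 * n ∧ Wired D s' ∧
      NextIs s' σ ∧ D.Tour ∅ σ ∧ s'.var vSize = n + (m + m) ∧
      s'.var vSum = (Finset.univ.filter fun i => D.col i = true).card := by
  have hm := hW.count
  have hWn := hW.le
  have h2 := hW.two_le
  have hn := h.count
  obtain ⟨T1, hr1, hT1⟩ := Program.Safe.runs (p := assign vEdges (var vCount +ₑ var vCount -ₑ
    const 3) ;; assign vSize (var vCount +ₑ (var vEdges +ₑ var vEdges))) hW.one_lt hs
    (by simp [Program.Safe, Expr.Ok, run, eval, BinOp.eval, hn]; omega)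
  set s₁ := (assign vEdges (var vCount +ₑ var vCount -ₑ const 3) ;;
    assign vSize (var vCount +ₑ (var vEdges +ₑ var vEdges))).run s with hs₁
  have hE1 : s₁.var vEdges = m := by simp [hs₁, run, eval, BinOp.eval, hn]; omega
  have hS1 : s₁.var vSize = n + (m + m) := by simp [hs₁, run, eval, BinOp.eval, hn]; omega
  have hb1 := hr1.bdd hs
  obtain ⟨T2, s₂, hr2, hT2, hfill⟩ := fill_spec hW hb1 hS1
  have hb2 := hr2.bdd hb1
  have hends : ∀ b, endArr b ∉ fill.warrs ∧ endArr b ∉ insertDarts.warrs := by decide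
  have hins : Inserted D {x | ∃ v c, x = marker m v c} 1 s₂ := by
    refine ⟨?_, fun i b => ?_, EdgeData.star_one, fun x => (hfill x).1, ?_, ?_, ?_⟩
    · rw [hr2.var_eq _ (by decide), hr1.var_eq _ (by decide), hn]
    · rw [hr2.arr_eq _ (hends b).1, hr1.arr_eq _ (by simp [warrs]), h.ends]
    · rintro x ⟨v, c, rfl⟩
      exact (hfill _).2
    · rintro i b c ⟨v, c, e⟩
      simp [dart, marker] at e
    · exact fun v c => ⟨v, c, rfl⟩
  obtain ⟨T3, s₃, σ, hr3, hT3, hin3⟩ := insertDarts_spec hW hb2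
    ((hr2.var_eq _ (by decide)).trans hE1) hins
  have hb3 := hr3.bdd hb2
  have hD3 : Wired D s₃ := by
    refine ⟨hin3.count, ?_, fun i => ?_, fun x => hin3.rev x (Set.mem_univ x),
      fun i b c => hin3.edge i b c (Set.mem_univ _)⟩
    · rw [hr3.var_eq _ (by decide), hr2.var_eq _ (by decide), hE1]
    · rw [hr3.arr_eq _ (by decide), hr2.arr_eq _ (by decide), hr1.arr_eq _ (by decide), h.colour]
  obtain ⟨T4, s₄, σ', hr4, hT4, hσ', htour, hsum⟩ := linkEdges_spec hW hF hb3 hD3 hin3.next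
    hin3.star.tour
  refine ⟨_, s₄, σ', .seq hr1 (.seq hr2 (.seq hr3 hr4)), ?_, hD3.of_runs hr4 (by decide), hσ',
    htour, ?_, hsum⟩
  · have e : (assign vEdges (var vCount +ₑ var vCount -ₑ const 3) ;;
      assign vSize (var vCount +ₑ (var vEdges +ₑ var vEdges))).time = 12 := rfl
    omega
  · rw [hr4.var_eq _ (by decide), hr3.var_eq _ (by decide), hr2.var_eq _ (by decide), hS1]

/-- Build the tours, find out which colour is that of the spanning tree, label the components, and
queue the edges of the tree that join the two components of the other colour. -/
def prepare : Program :=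
  buildTours ;;
    assign vOther (const 1 -ₑ (var vSum +ₑ const 1 =ₑ var vCount)) ;; labelLayer ;;
    (assign vLabel (const 2) ;; assign vZ (var vOther)) ;; relabel ;; scan ;;
    store aNode (const 1) (const 1) ;; store aNode (const 2) (const 2) ;;
    assign vLabel (const 3) ;; assign vNodes (const 3)

theorem prepare_spec (hW : Room n m W) (hS : D.IsLamanSplit t)
    (htree : (Finset.univ.filter fun i => D.col i = t).card + 1 = n)
    (hother : (Finset.univ.filter fun i => D.col i = !t).card + 2 = n) {s : State} (hs : s.Bdd W)
    (h : Fed D s) : ∃ T s' σ lab q nd, Runs W prepare s T s' ∧ T ≤ 5000 * n ∧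
      RoundState D t 0 σ lab q 0 nd s' := by
  classical
  have hm := hW.count
  have hWn := hW.le
  have h2 := hW.two_le
  obtain ⟨T1, s₁, σ, hr1, hT1, hD1, hσ1, htour, hsz1, hsum1⟩ := buildTours_spec hW hS.forest hs h
  have hb1 := hr1.bdd hs
  have hsumle : s₁.var vSum + 1 < W := by
    have : (Finset.univ.filter fun i => D.col i = true).card ≤ n := by
      cases t
      · have := hother; simp only [Bool.not_false] at this; omega
      · omega
    omega
  obtain ⟨T2, hr2, hT2⟩ := Program.Safe.runs
    (p := assign vOther (const 1 -ₑ (var vSum +ₑ const 1 =ₑ var vCount))) hW.one_lt hb1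
    (by simp [Program.Safe, Expr.Ok, eval]; omega)
  set s₂ := (assign vOther (const 1 -ₑ (var vSum +ₑ const 1 =ₑ var vCount))).run s₁ with hs₂
  have hb2 := hr2.bdd hb1
  have hO2 : s₂.var vOther = (!t).toNat := by
    simp only [hs₂, run, eval, BinOp.eval, State.setVar_var, if_true, hsum1, hD1.count]
    cases t
    · rw [if_neg]
      · rfl
      · simp only [Bool.not_false] at hother; omega
    · rw [if_pos htree]; rfl
  have hlab0 : ∀ a, 3 ≤ a → a ∉ buildTours.warrs → ∀ i, s₂.arr a i = 0 := by
    intro a ha ha' i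
    rw [hr2.arr_eq _ (by simp [warrs]), hr1.arr_eq _ ha', h.arr_eq_zero a ha]
  obtain ⟨T3, s₃, hr3, hT3, hl3⟩ := labelLayer_spec hW hb2
    ((hr2.var_eq _ (by decide)).trans hsz1) hO2 (fun x => hlab0 _ (by decide) (by decide) _)
  have hb3 := hr3.bdd hb2
  obtain ⟨T4, hr4, hT4⟩ := Program.Safe.runs (p := assign vLabel (const 2) ;;
    assign vZ (var vOther)) hW.one_lt hb3 (by simp [Program.Safe, Expr.Ok]; omega)
  set s₄ := (assign vLabel (const 2) ;; assign vZ (var vOther)).run s₃ with hs₄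
  have hb4 := hr4.bdd hb3
  set v₀ : Fin n := ⟨0, by omega⟩ with hv₀
  have hZ4 : s₄.var vZ = enc (marker m v₀ !t) := by
    have : s₃.var vOther = (!t).toNat := (hr3.var_eq _ (by decide)).trans hO2
    simp [hs₄, run, eval, this, enc, marker, hv₀]
  have hL4 : s₄.var vLabel = 2 := by simp [hs₄, run, eval]
  have hσ4 : NextIs s₄ σ := ((hσ1.of_runs hr2 (by decide)).of_runs hr3 (by decide)).of_runs hr4
    (by decide)
  obtain ⟨T5, s₅, hr5, hT5, hl5⟩ := relabel_spec hW.one_lt hb4 hσ4 hZ4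
    (hl3.of_runs hr4 (by decide))
  rw [hL4] at hl5
  have hb5 := hr5.bdd hb4
  have hD5 : Wired D s₅ := (((hD1.of_runs hr2 (by decide)).of_runs hr3 (by decide)).of_runs hr4
    (by decide)).of_runs hr5 (by decide)
  have hq5 : QueueIs s₅ ([] : List (Fin m)) := by
    refine ⟨?_, by simp, fun i => ?_, List.nodup_nil⟩
    · rw [hr5.var_eq _ (by decide), hr4.var_eq _ (by decide), hr3.var_eq _ (by decide),
        hr2.var_eq _ (by decide), hr1.var_eq _ (by decide), h.var_eq_zero _ (by decide)]
      rfl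
    · rw [hr5.arr_eq _ (by decide), hr4.arr_eq _ (by decide), hr3.arr_eq _ (by decide),
        hlab0 _ (by decide) (by decide)]
      simp
  set lab : El n m → ℕ := fun x => if σ.SameCycle (marker m v₀ !t) x then 2 else
    if x.2 = !t then 1 else 0 with hlab
  obtain ⟨T6, s₆, q, hr6, hT6, hq6, -, hmem⟩ := scan_spec hW hb5 hD5 (hσ4.of_runs hr5 (by decide))
    ((hr5.var_eq _ (by decide)).trans hZ4) hl5 hq5
  have hb6 := hr6.bdd hb5
  obtain ⟨T7, hr7, hT7⟩ := Program.Safe.runs (p := store aNode (const 1) (const 1) ;;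
    store aNode (const 2) (const 2) ;; assign vLabel (const 3) ;; assign vNodes (const 3))
    hW.one_lt hb6 (by simp [Program.Safe, Expr.Ok]; omega)
  set s₇ := (store aNode (const 1) (const 1) ;; store aNode (const 2) (const 2) ;;
    assign vLabel (const 3) ;; assign vNodes (const 3)).run s₆ with hs₇
  -- the labels
  have halive : ∀ c, D.alive ∅ c = {i | D.col i = c} := fun c => by simp [EdgeData.alive]
  have hcyc : ∀ x y, σ.SameCycle x y ↔ x.2 = y.2 ∧
      D.Conn {i | D.col i = x.2} (D.src x) (D.src y) := fun x y => by
    rw [htour.sameCycle_iff, halive]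
  have htt : t ≠ !t := by cases t <;> simp
  have hlayer : ∀ x : El n m, x.2 = t ∨ x.2 = !t := fun x => by
    cases t <;> cases x.2 <;> simp
  have hcyc0 : ∀ x, σ.SameCycle (marker m v₀ !t) x ↔
      x.2 = (!t) ∧ D.Conn {i | D.col i = !t} v₀ (D.src x) := fun x => by
    rw [hcyc]
    exact and_congr_left' eq_comm
  have hlabt : ∀ x, x.2 = t → lab x = 0 := fun x hx => by
    simp only [hlab, hcyc0, hx, htt, false_and, if_false]
  have hlabo : ∀ x, x.2 = (!t) →
      lab x = if D.Conn {i | D.col i = !t} v₀ (D.src x) then 2 else 1 := fun x hx => by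
    simp only [hlab, hcyc0, hx, true_and, if_true]
  have hlab_iff : ∀ x y, lab x = lab y ↔ σ.SameCycle x y := by
    intro x y
    rw [hcyc]
    rcases hlayer x with hx | hx <;> rcases hlayer y with hy | hy
    · rw [hlabt x hx, hlabt y hy, hx, hy]
      simp only [true_and, true_iff]
      exact hS.conn _ _
    · rw [hlabt x hx, hlabo y hy, hx, hy]
      simp only [htt, false_and, iff_false]
      split_ifs <;> simp
    · rw [hlabo x hx, hlabt y hy, hx, hy]
      simp only [htt.symm, false_and, iff_false]
      split_ifs <;> simp
    · rw [hlabo x hx, hlabo y hy, hx, hy]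
      simp only [true_and]
      split_ifs with g g' g'
      · exact iff_of_true rfl (g.symm.trans g')
      · exact iff_of_false (by omega) fun e => g' (g.trans e)
      · exact iff_of_false (by omega) fun e => g (g'.trans e.symm)
      · exact iff_of_true rfl (hS.two' _ _ _ g g')
  have hmem' : ∀ i, i ∈ q ↔ ¬ D.Conn (D.alive {i | i ∈ q.take 0} !D.col i)
      (D.endpt i false) (D.endpt i true) := by
    intro i
    have e0 : {i | i ∈ q.take 0} = (∅ : Set (Fin m)) := by simp
    rw [hmem, e0, halive]
    simp only [List.not_mem_nil, false_or, Ne, hlab_iff, hcyc0]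
    constructor
    · rintro ⟨b, c, ⟨h1, -⟩, h3⟩ e
      have h1 : c = !t := h1
      subst h1
      apply h3
      rw [hcyc]
      refine ⟨rfl, ?_⟩
      by_cases hc : D.col i = t
      · rw [hc] at e; exact e
      · have hc : D.col i = !t := by cases t <;> simpa using hc
        exact EdgeData.Conn.edge (A := {i | D.col i = !t}) hc
    · intro e
      have hc : D.col i = t := by
        by_contra hc
        have hc : D.col i = !t := by cases t <;> simpa using hc
        rw [hc, Bool.not_not] at e
        exact e (hS.conn _ _)
      rw [hc] at e
      have h3 : ¬ σ.SameCycle (dart n i false !t) (dart n i true !t) := fun g =>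
        e ((hcyc _ _).1 g).2
      by_cases g : D.Conn {i | D.col i = !t} v₀ (D.endpt i false)
      · exact ⟨false, !t, ⟨rfl, g⟩, h3⟩
      · refine ⟨true, !t, ⟨rfl, ?_⟩, h3⟩
        by_contra g'
        exact e (hS.two' _ _ _ g g')
  -- the nodes
  have hnode : ∀ l, s₇.arr aNode l = if l = 2 then 2 else if l = 1 then 1 else 0 := by
    intro l
    have : s₆.arr aNode l = 0 := by
      rw [hr6.arr_eq _ (by decide), hr5.arr_eq _ (by decide), hr4.arr_eq _ (by decide),
        hr3.arr_eq _ (by decide), hlab0 _ (by decide) (by decide)]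
    simp [hs₇, run, eval, Function.update_apply, this]
  have hpar : ∀ y, s₇.arr aParent y = 0 := by
    intro y
    rw [hr7.arr_eq _ (by decide), hr6.arr_eq _ (by decide), hr5.arr_eq _ (by decide),
      hr4.arr_eq _ (by decide), hr3.arr_eq _ (by decide), hlab0 _ (by decide) (by decide)]
  have hN7 : s₇.var vNodes = 3 := by simp [hs₇, run, eval]
  have hmk : ∀ v, lab (marker m v !t) = if D.Conn {i | D.col i = !t} v₀ v then 2 else 1 :=
    fun v => hlabo _ rfl
  have hmk' : ∀ v, lab (marker m v !t) = 1 ∨ lab (marker m v !t) = 2 := fun v => by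
    rw [hmk]; split_ifs <;> simp
  have hlev : ∀ v w, D.Level t 1 v w ↔ lab (marker m v !t) = lab (marker m w !t) := by
    intro v w
    rw [hlab_iff, hcyc]
    simp only [EdgeData.Level, and_true, levelColour]
    exact ⟨fun e => ⟨rfl, e⟩, fun e => e.2⟩
  have hnum : D.Numbering t (0 + 1) (s₇.var vNodes)
      (fun k v => if k = 0 then 0 else lab (marker m v !t)) (s₇.arr aParent)
      fun b i => s₇.arr (crossArr b) i := by
    rw [hN7]
    have node : ∀ k v, k ≤ 1 → D.IsNode t k v := fun k v hk => Or.inl hk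
    constructor
    · exact fun v => rfl
    · intro k hk v
      have := hmk' v
      split_ifs <;> omega
    · intro y hy
      obtain ⟨w, hw⟩ : ∃ w, ¬ D.Conn {i | D.col i = !t} v₀ w := by
        obtain ⟨x, y, hxy⟩ := hS.two
        by_contra! e
        exact hxy ((e x).symm.trans (e y))
      have hy : y = 0 ∨ y = 1 ∨ y = 2 := by omega
      rcases hy with rfl | rfl | rfl
      · exact ⟨0, v₀, by omega, node _ _ (by omega), rfl⟩
      · exact ⟨1, w, by omega, node _ _ (by omega), by simp [hmk, hw]⟩
      · exact ⟨1, v₀, by omega, node _ _ (by omega), by simp [hmk, EdgeData.Conn.refl]⟩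
    · intro k v k' w hk hk' _ _
      have hv := hmk' v
      have hw := hmk' w
      have hk : k = 0 ∨ k = 1 := by omega
      have hk' : k' = 0 ∨ k' = 1 := by omega
      rcases hk with rfl | rfl <;> rcases hk' with rfl | rfl
      · simp only [if_true, true_and, true_iff]; trivial
      · simp; omega
      · simp; omega
      · simp [hlev]
    · intro k v k' w hk hk' _
      obtain rfl : k = 0 := by omega
      obtain rfl : k' = 1 := by omega
      have := hmk' w
      simp; omega
    · intro k v hk; omega
    · exact hpar 0
    · intro k v hk _
      obtain rfl : k = 0 := by omega
      exact hpar _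
    · intro k i b hk; omega
  have hcard : ∀ x, (cyc σ x).card ≤ 10 * n := by
    intro x
    refine (Finset.card_le_univ _).trans ?_
    simp only [El, Fintype.card_prod, Fintype.card_sum, Fintype.card_fin, Fintype.card_bool]
    omega
  have hc0 := hcard (marker m v₀ !t)
  refine ⟨_, s₇, σ, lab, q, _, .seq hr1 (.seq hr2 (.seq hr3 (.seq hr4 (.seq hr5 (.seq hr6 hr7))))),
    ?_, ⟨⟨(hD5.of_runs hr6 (by decide)).of_runs hr7 (by decide), by simpa using htour,
      ((hσ4.of_runs hr5 (by decide)).of_runs hr6 (by decide)).of_runs hr7 (by decide),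
      (hl5.of_runs hr6 (by decide)).of_runs hr7 (by decide), hlab_iff, fun x => ?_, ?_,
      hq6.of_runs hr7 (by decide), hmem'⟩, ?_, Nat.zero_le _, fun i => ?_, hnum, fun v => ?_,
      fun v => ?_, fun l hl => ?_, hN7.le⟩⟩
  · have e1 : (assign vOther (const 1 -ₑ (var vSum +ₑ const 1 =ₑ var vCount))).time = 8 := rfl
    have e2 : (assign vLabel (const 2) ;; assign vZ (var vOther)).time = 4 := rfl
    have e3 : (store aNode (const 1) (const 1) ;; store aNode (const 2) (const 2) ;;
      assign vLabel (const 3) ;; assign vNodes (const 3)).time = 10 := rfl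
    omega
  · simp only [hlab]
    split_ifs <;> omega
  · simp [hs₇, run, eval]
  · rw [hr7.var_eq _ (by decide), hr6.var_eq _ (by decide), hr5.var_eq _ (by decide),
      hr4.var_eq _ (by decide), hr3.var_eq _ (by decide), hr2.var_eq _ (by decide),
      hr1.var_eq _ (by decide), h.var_eq_zero _ (by decide)]
  · simp only [List.take_zero, List.not_mem_nil, false_iff]
    exact fun e => e trivial
  · rw [hnode, hlabt (marker m v (levelColour t 0)) rfl]; rfl
  · change s₇.arr aNode (lab (marker m v !t)) = lab (marker m v !t)
    rw [hnode]
    rcases hmk' v with e | e <;> rw [e] <;> rfl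
  · rw [hnode, if_neg (by omega), if_neg (by omega)]

/-! ### The complete program -/

/-- The program that constructs a red-black hierarchy. -/
def hierarchyProgram : Program := prepare ;; rounds ;; recordLeaves

theorem hierarchyProgram_spec (hW : Room n m W) (hS : D.IsLamanSplit t)
    (htree : (Finset.univ.filter fun i => D.col i = t).card + 1 = n)
    (hother : (Finset.univ.filter fun i => D.col i = !t).card + 2 = n) {s : State} (hs : s.Bdd W)
    (h : Fed D s) : ∃ T s' r N nd, Runs W hierarchyProgram s T s' ∧
      T ≤ 20000 * (n * Nat.log 2 n) ∧ s'.var 2 = N ∧ s'.var 3 = 0 ∧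
      D.Numbering t (r + 1) N nd (s'.arr 3) (fun b i => s'.arr (crossArr b) i) ∧
      (∀ v w, D.Level t r v w → v = w) ∧
      ∀ v, ∃ k, D.IsNode t k v ∧ ¬ D.IsNode t (k + 1) v ∧ s'.arr 4 (v : Fin n) = nd k v := by
  obtain ⟨T1, s₁, σ, lab, q, nd, hr1, hT1, h1⟩ := prepare_spec hW hS htree hother hs h
  have hb1 := hr1.bdd hs
  obtain ⟨T2, s₂, r, σ', lab', q', nd', hr2, h2, hT2⟩ := rounds_spec hW hS hb1 h1
  have hb2 := hr2.bdd hb1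
  obtain ⟨T3, s₃, hr3, hT3, hleaf⟩ := recordLeaves_spec hW hb2 h2.cut.wired.count h2.cut.label
  have hdisc : ∀ v w, D.Level t r v w → v = w := by
    refine hS.discrete_of_cutSet_subset fun i hi => ?_
    rw [← h2.taken, List.take_length]
    exact (h2.cut.mem_queue_iff h2.taken hS i).2 hi
  have hnum := h2.numbering
  refine ⟨_, s₃, r, s₂.var vNodes, nd', .seq hr1 (.seq hr2 hr3), ?_, hr3.var_eq _ (by decide), ?_,
    ?_, hdisc, fun v => ?_⟩
  · have hm := hW.count
    have hn := hW.two_le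
    set l := Nat.log 2 n with hl
    have hl1 : 1 ≤ l := Nat.log_pos (by omega) hn
    have hcard : Fintype.card (El n m) ≤ 10 * n := by
      simp only [El, Fintype.card_prod, Fintype.card_sum, Fintype.card_fin, Fintype.card_bool]
      omega
    have hlog : Nat.log 2 (Fintype.card (El n m)) ≤ l + 4 := by
      refine (Nat.log_mono_right (hcard.trans (show 10 * n ≤ n * 2 ^ 4 by omega))).trans ?_
      rw [pow_succ, pow_succ, pow_succ, pow_one, ← mul_assoc, ← mul_assoc, ← mul_assoc,
        Nat.log_mul_base (by omega) (by omega), Nat.log_mul_base (by omega) (by omega),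
        Nat.log_mul_base (by omega) (by omega), Nat.log_mul_base (by omega) (by omega)]
    have hpot : logPotential σ ≤ 10 * n * (l + 4) :=
      (logPotential_le σ).trans (Nat.mul_le_mul hcard hlog)
    have hnl : n ≤ n * l := Nat.le_mul_of_pos_right n hl1
    have e : 10 * n * (l + 4) = 10 * (n * l) + 40 * n := by ring
    omega
  · rw [hr3.var_eq _ (by decide), hr2.var_eq _ (by decide), hr1.var_eq _ (by decide),
      h.var_eq_zero _ (by decide)]
  · rw [hr3.arr_eq _ (by decide), show (fun b (i : Fin m) => s₃.arr (crossArr b) i) =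
      fun b i => s₂.arr (crossArr b) i.1 by
        funext b i; cases b <;> rw [hr3.arr_eq _ (by decide)]]
    exact hnum
  · obtain ⟨k, g1, g2, g3⟩ := hnum.exists_last hdisc v
    refine ⟨k, g1, g2, ?_⟩
    rw [hleaf, ← g3, ← h2.node, ← h2.node_succ]
    change _ = max _ (s₂.arr aNode (lab' (marker m v !levelColour t r)))
    cases levelColour t r
    · rfl
    · exact max_comm _ _

end RAM

/-! ### From the edge list to the hierarchy -/

section input

variable {n : ℕ} {G : SimpleGraph (Fin n)} {L input : List (ColouredEdge n)}

/-- The edge data of an edge list. -/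
def edgeData (L : List (ColouredEdge n)) : EdgeData n L.length where
  endpt i b := if b then L[i].head else L[i].tail
  col i := L[i].colour

theorem EnumeratesEdges.injective (h : EnumeratesEdges G L) :
    Function.Injective fun i : Fin L.length => L[i].edge := by
  intro i j hij
  have := h.1.getElem_inj_iff (i := i) (j := j) (hi := by simp) (hj := by simp)
  simp only [List.getElem_map] at this
  exact Fin.ext (this.1 hij)

theorem EnumeratesEdges.mem_edgeSet_iff (h : EnumeratesEdges G L) (e : Sym2 (Fin n)) :
    e ∈ G.edgeSet ↔ ∃ i : Fin L.length, L[i].edge = e := by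
  rw [← h.2, List.mem_map]
  constructor
  · rintro ⟨x, hx, rfl⟩
    obtain ⟨i, hi, rfl⟩ := List.mem_iff_getElem.1 hx
    exact ⟨⟨i, hi⟩, rfl⟩
  · rintro ⟨i, rfl⟩
    exact ⟨L[i], List.getElem_mem _, rfl⟩

theorem EnumeratesEdges.ncard (h : EnumeratesEdges G L) : G.edgeSet.ncard = L.length := by
  have : G.edgeSet = Set.range fun i : Fin L.length => L[i].edge :=
    Set.ext fun e => h.mem_edgeSet_iff e
  rw [this, ← Set.image_univ, Set.ncard_image_of_injective _ h.injective, Set.ncard_univ,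
    Nat.card_eq_fintype_card, Fintype.card_fin]

/-- If the edges of colour `c` belong to an acyclic graph, they form a forest. -/
theorem EnumeratesEdges.isForest (h : EnumeratesEdges G L) (hsub : L ⊆ input) {c : Bool}
    (hc : (colourGraph input c).IsAcyclic) : (edgeData L).IsForest c := by
  intro i hi hconn
  have hadj : ∀ j : Fin L.length, (edgeData L).col j = c →
      (colourGraph input c).Adj ((edgeData L).endpt j false) ((edgeData L).endpt j true) := by
    intro j hj
    rw [colourGraph, SimpleGraph.fromEdgeSet_adj]
    have hG : L[j].edge ∈ G.edgeSet := (h.mem_edgeSet_iff _).2 ⟨j, rfl⟩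
    refine ⟨?_, fun e => G.ne_of_adj hG e⟩
    change L[j].edge ∈ edgesOfColour input c
    exact List.mem_map_of_mem (List.mem_filter.2 ⟨hsub (List.getElem_mem _), decide_eq_true hj⟩)
  have hb := SimpleGraph.isAcyclic_iff_forall_adj_isBridge.1 hc (hadj i hi)
  rw [SimpleGraph.isBridge_iff] at hb
  refine hb (hconn.lift (SimpleGraph.reachable_is_equivalence _) fun j hj => ?_)
  refine SimpleGraph.Adj.reachable ?_
  rw [SimpleGraph.deleteEdges_adj]
  exact ⟨hadj j hj.1, fun e => hj.2 (h.injective e)⟩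

/-- A partition of the edges of a Laman graph into two forests consists of a spanning tree and a
forest with two components. -/
theorem EnumeratesEdges.exists_isLamanSplit (h : EnumeratesEdges G L) (hG : IsLaman G)
    (hF : ∀ c, (edgeData L).IsForest c) : ∃ t, (edgeData L).IsLamanSplit t ∧
      (Finset.univ.filter fun i => (edgeData L).col i = t).card + 1 = n ∧
      (Finset.univ.filter fun i => (edgeData L).col i = !t).card + 2 = n := by
  classical
  have hcount : L.length + 3 = 2 * n := by
    have := hG.1
    rwa [h.ncard, Fintype.card_fin] at this
  have hle : ∀ c, (Finset.univ.filter fun i => (edgeData L).col i = c).card + 1 ≤ n := by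
    intro c
    obtain ⟨f, -, hf⟩ := (hF c).exists_labelling
    have : 0 < (Finset.univ.image f).card :=
      Finset.card_pos.2 ⟨f ⟨0, by omega⟩, Finset.mem_image_of_mem f (Finset.mem_univ _)⟩
    omega
  have hsum : ∀ c, (Finset.univ.filter fun i => (edgeData L).col i = c).card +
      (Finset.univ.filter fun i => (edgeData L).col i = !c).card = L.length := by
    intro c
    have := Finset.card_filter_add_card_filter_not (s := Finset.univ)
      (fun i : Fin L.length => (edgeData L).col i = c)
    rw [Finset.card_univ, Fintype.card_fin] at this
    refine Eq.trans ?_ this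
    congr 2
    ext i
    cases (edgeData L).col i <;> cases c <;> simp
  obtain ⟨t, ht⟩ : ∃ t, (Finset.univ.filter fun i => (edgeData L).col i = t).card + 1 = n := by
    by_contra! hne
    have h1 := hle true
    have h2 := hle false
    have h3 := hsum true
    have h4 := hne true
    have h5 := hne false
    simp only [Bool.not_true] at h3
    omega
  have ht' : (Finset.univ.filter fun i => (edgeData L).col i = !t).card + 2 = n := by
    have := hsum t
    omega
  obtain ⟨two, two'⟩ := (hF !t).two_components ht'
  refine ⟨t, ⟨fun S hS => ?_, hcount, fun i e => ?_, hF, (hF t).conn ht, two, two'⟩, ht, ht'⟩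
  · refine le_trans (Nat.add_le_add_right ?_ 3) (hG.2 S hS)
    rw [← Set.ncard_coe_finset, ← Set.ncard_image_of_injective _ h.injective]
    refine Set.ncard_le_ncard ?_ (Set.toFinite _)
    rintro _ ⟨i, hi, rfl⟩
    have hi := (Finset.mem_filter.1 (Finset.mem_coe.1 hi)).2
    refine ⟨(h.mem_edgeSet_iff _).2 ⟨i, rfl⟩, fun v hv => ?_⟩
    rcases Sym2.mem_iff.1 hv with rfl | rfl
    exacts [hi false, hi true]
  · have hG : L[i].edge ∈ G.edgeSet := (h.mem_edgeSet_iff _).2 ⟨i, rfl⟩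
    exact G.ne_of_adj hG e

theorem fed_inputState (hpre : L <+: input) : RAM.Fed (edgeData L) (inputState input) := by
  have hget : ∀ i : Fin L.length, input[i.1]? = some L[i] := by
    intro i
    obtain ⟨l, rfl⟩ := hpre
    rw [List.getElem?_append_left i.2]
    exact List.getElem?_eq_getElem i.2
  refine ⟨rfl, fun i b => ?_, fun i => ?_, fun x hx => ?_, fun a ha i => ?_⟩
  · cases b <;> simp [inputState, RAM.endArr, hget, edgeData]
  · simp [inputState, hget, edgeData]
  · match x, hx with
    | x + 2, _ => rfl
  · match a, ha with
    | a + 3, _ => rfl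

theorem bdd_inputState {W : ℕ} (hn : n < W) (hl : input.length < W) (h1 : 1 < W) :
    (inputState input).Bdd W := by
  refine ⟨fun x => ?_, fun a i => ?_⟩
  · simp only [inputState]
    split <;> omega
  · simp only [inputState]
    split
    · exact (Fin.is_lt _).trans hn
    · exact (Fin.is_lt _).trans hn
    · rename_i e _
      have := Bool.toNat_lt e.colour
      omega
    · omega

end input

/-- There is one program that builds a red-black hierarchy of every Laman graph with `n` vertices
in time `O(n log n)` with words of `log₂ n + O(1)` bits. It is given the edge list `L` of the graph
with a partition into two forests, or the edge list of the graph and, as last entry, an added edge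
`e` (possibly parallel to an edge of the graph) with a partition into two spanning trees. -/
theorem theorem1 :
    ∃ (P : RAM.Program) (c C : ℕ),
      ∀ (n : ℕ) (G : SimpleGraph (Fin n)), IsLaman G →
        ∀ L : List (ColouredEdge n), EnumeratesEdges G L →
          ∀ input : List (ColouredEdge n),
            ((input = L ∧ IsForestPartition input) ∨
              (∃ e : ColouredEdge n, input = L ++ [e] ∧ IsTreePartition input)) →
            ∃ (t : ℕ) (s : RAM.State),
              RAM.Runs (c * n) P (inputState input) t s ∧
              t ≤ C * (n * Nat.log 2 n) ∧
              ∃ (N : ℕ) (T : RootedTreeOn (Fin N)) (α : Fin n → Fin N)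
                (β : Sym2 (Fin n) → Sym2 (Fin N)),
                IsRedBlackHierarchy G T α β ∧ HoldsHierarchy L T α β s := by
  refine ⟨RAM.hierarchyProgram, 100, 20000, fun n G hG L hL input hin => ?_⟩
  -- the added edge is not used: without it, the second spanning tree is a forest
  have hac : ∀ c, (colourGraph input c).IsAcyclic := by
    rcases hin with ⟨-, h⟩ | ⟨e, -, h⟩
    exacts [fun c => (h c).2, fun c => (h c).2.isAcyclic]
  have hpre : L <+: input := by
    rcases hin with ⟨rfl, -⟩ | ⟨e, rfl, -⟩
    exacts [List.prefix_rfl, List.prefix_append _ _]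
  have hlen : input.length ≤ L.length + 1 := by
    rcases hin with ⟨rfl, -⟩ | ⟨e, rfl, -⟩ <;> simp
  obtain ⟨t, hS, htree, hother⟩ := hL.exists_isLamanSplit hG
    fun c => hL.isForest hpre.subset (hac c)
  have h2 := hS.two_le
  have hm := hS.count
  have hW : RAM.Room n L.length (100 * n) := ⟨h2, hm, le_rfl⟩
  obtain ⟨T, s, r, N, nd, hr, hT, hN, hroot, hnum, hdisc, hleaf⟩ :=
    RAM.hierarchyProgram_spec hW hS htree hother
    (bdd_inputState (by omega) (by omega) (by omega)) (fed_inputState hpre)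
  obtain ⟨R, α, β, hH, e1, e2, e3, e4⟩ := hnum.exists_hierarchy hS hdisc hleaf
    (fun e => hL.mem_edgeSet_iff e) hL.injective
  refine ⟨T, s, hr, hT, N, R, α, β, hH, hN, ?_, fun x => (e2 x).symm, fun v => (e3 v).symm,
    fun i => ?_⟩
  · exact hroot.trans e1.symm
  · obtain ⟨a, b, g1, g2, g3⟩ := e4 i
    exact ⟨a, b, g1, g2.symm, g3.symm⟩
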